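/- **Setting.** Put $\epsilon_1=\epsilon_2=1$, $\epsilon_3=-1$, let $n\ge 1$, and let $(i,j,k)$ denote any cyclic permutation of $(1,2,3)$. Let $M$ be a paraquaternionic contact (pqc) manifold of dimension $4n+3$ with a fixed metric $g$ in its conformal class: $H\subset TM$ is a distribution of rank $4n$, $g$ is a metric of signature $(2n,2n)$ on $H$, and locally $H=\bigcap_s\ker\eta_s$ for one-forms $\eta_1,\eta_2,\eta_3$, and the bundle $\mathbb{PQ}\subset \mathrm{End}(H)$ is spanned by $I_1,I_2,I_3$ with $$I_s^2=\epsilon_s,\quad I_iI_j=-I_jI_i=-\epsilon_kI_k,\quad g(I_sX,I_sY)=-\epsilon_sg(X,Y),\quad d\eta_s(X,Y)=-2\epsilon_s\,\omega_s(X,Y),\quad \omega_s(X,Y)=g(I_sX,Y),$$ for $X,Y\in H$, where $d\eta(A,B)=A\eta(B)-B\eta(A)-\eta([A,B])$. The Reeb fields $\xi_s$ are given by $\eta_s(\xi_t)=\delta_{st}$ and $(\xi_s\lrcorner d\eta_s)|_H=0$; in dimension $7$ it is required that they also satisfy $(\xi_j\lrcorner d\eta_i)|_H=\epsilon_k(\xi_i\lrcorner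 d\eta_j)|_H$. They span the vertical bundle $V$, $TM=H\oplus V$. The canonical connection $\nabla$, with torsion $T$, is the connection that preserves $H$, $V$, $g$ and $\mathbb{PQ}$, has $T(X,Y)=-[X,Y]_V$ for $X,Y\in H$ and $T(\xi,\cdot)_H\in(sp(n,\mathbb R)\oplus sp(1,\mathbb R))^{\perp}\subset \mathrm{End}(H)$ for $\xi\in V$, and for which the identification $\xi_s\mapsto I_s$ of $V$ with $\mathbb{PQ}$ is parallel. Let $X,Y,Z$ be horizontal and let $e_1,\dots,e_{4n}$ be a local orthonormal frame of $H$; a repeated $e_a$ stands for $\sum_a g(e_a,e_a)(\cdots)$. Write $T(\xi,X,Y)=g(T(\xi,X),Y)=T^{sym}+T^{alt}$ for the decomposition into symmetric and skew-symmetric parts in $X,Y$, and put $$\tau(X,Y)=-\sum_s\epsilon_sT^{sym}(\xi_s,I_sX,Y),\qquad \mu(X,Y)=\epsilon_sT^{alt}(\xi_s,I_sX,Y)$$ (the latter does not depend on $s$). With $R(A,B)=[\nabla_A,\nabla_B]-\nabla_{[A,B]}$ and $R(A,B,X,Y)=g(R(A,B)X,Y)$ let $$\rho_s(A,B)=\tfrac1{4n}R(A,B,e_a,I_se_a),\quad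 Ric(X,Y)=R(e_a,X,Y,e_a),\quad Scal=Ric(e_a,e_a).$$ Finally $\nabla_A\rho_s$ denotes the contraction $\frac1{4n}(\nabla_AR)(\cdot,\cdot,e_a,I_se_a)$, that is, $(\nabla_A\rho_s)(B,D)=A(\rho_s(B,D))-\rho_s(\nabla_AB,D)-\rho_s(B,\nabla_AD)-\sum_t\eta_t(\nabla_A\xi_s)\rho_t(B,D)$. **Theorem.** The curvature of the canonical connection satisfies $$\begin{aligned}R(\xi_i,X,Y,Z)={}&-(\nabla_X\mu)(I_iY,Z)-\tfrac14\big[(\nabla_Y\tau)(I_iZ,X)+(\nabla_Y\tau)(Z,I_iX)\big]+\tfrac14\big[(\nabla_Z\tau)(I_iY,X)+(\nabla_Z\tau)(Y,I_iX)\big]\\&+\omega_j(X,Y)\rho_k(I_iZ,\xi_i)-\omega_k(X,Y)\rho_j(I_iZ,\xi_i)-\omega_j(X,Z)\rho_k(I_iY,\xi_i)+\omega_k(X,Z)\rho_j(I_iY,\xi_i)\\&-\omega_j(Y,Z)\rho_k(I_iX,\xi_i)+\omega_k(Y,Z)\rho_j(I_iX,\xi_i),\end{aligned}$$ $$\beg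in{aligned}R(\xi_i,\xi_j,X,Y)={}&(\nabla_{\xi_i}\mu)(I_jX,Y)-(\nabla_{\xi_j}\mu)(I_iX,Y)+\epsilon_j(\nabla_X\rho_k)(I_iY,\xi_i)\\&-\tfrac14\big[(\nabla_{\xi_i}\tau)(I_jX,Y)+(\nabla_{\xi_i}\tau)(X,I_jY)\big]+\tfrac14\big[(\nabla_{\xi_j}\tau)(I_iX,Y)+(\nabla_{\xi_j}\tau)(X,I_iY)\big]\\&+\epsilon_k\tfrac{Scal}{8n(n+2)}T(\xi_k,X,Y)-T(\xi_j,X,e_a)T(\xi_i,e_a,Y)+T(\xi_j,e_a,Y)T(\xi_i,X,e_a),\end{aligned}$$ where the mixed Ricci 2-forms are given by $$3(2n+1)\rho_i(\xi_i,X)=-\tfrac{\epsilon_i}4(\nabla_{e_a}\tau)(e_a,X)-\tfrac34(\nabla_{e_a}\tau)(I_ie_a,I_iX)+\epsilon_i(\nabla_{e_a}\mu)(e_a,X)-\epsilon_i\tfrac{2n+1}{16n(n+2)}X(Scal),$$ $$\begin{aligned}3(2n+1)\rho_i(I_kX,\xi_j)=-3(2n+1)\rho_i(I_jX,\xi_k)={}&-\tfrac{(2n+1)(2n-1)}{16n(n+2)}X(Scal)+2(n+1)(\nabla_{e_a}\mu)(e_a,X)\\&+\tfrac{4n+1}4(\nabla_{e_a}\tau)(e_a,X)-\tfrac34\epsilon_i(\nabla_{e_a}\tau)(I_ie_a,I_iX).\end{aligned}$$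 Hence the whole curvature is determined by its horizontal part: in addition to these formulas, $$T(\xi_s,X,Y)=\mu(I_sX,Y)-\tfrac14\big[\tau(I_sX,Y)+\tau(X,I_sY)\big],$$ $$(2n+2)\,\tau(X,Y)=\tfrac14\Big[3Ric(X,Y)+\sum_s\epsilon_sRic(I_sX,I_sY)\Big],\quad (4n+10)\,\mu(X,Y)=\tfrac14\Big[Ric(X,Y)-\sum_s\epsilon_sRic(I_sX,I_sY)\Big]-\tfrac{Scal}{4n}g(X,Y),$$ and, for all vector fields $A,B$, $R(A,B)$ maps $H$ to $H$ and $R(A,B)\xi_i=-2\epsilon_i\rho_k(A,B)\xi_j+2\epsilon_i\rho_j(A,B)\xi_k$. -/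

import Mathlib

open scoped Manifold ContDiff Topology

noncomputable section

namespace PQC

/-! ## Vector fields, one-forms and curvature on a `(4n+3)`-dimensional manifold -/

section Basics

variable {n : ℕ} {M : Type*} [TopologicalSpace M]
  [ChartedSpace (EuclideanSpace ℝ (Fin (4 * n + 3))) M]
  [IsManifold (𝓡 (4 * n + 3)) ∞ M]

/-- The (not necessarily smooth) vector field `A` is smooth on `U`. -/
def SmoothField (U : Set M) (A : (x : M) → TangentSpace (𝓡 (4 * n + 3)) x) : Prop :=
  ContMDiffOn (𝓡 (4 * n + 3)) (𝓡 (4 * n + 3)).tangent ∞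
    (fun x => (⟨x, A x⟩ : TangentBundle (𝓡 (4 * n + 3)) M)) U

/-- The function `f` is smooth on `U`. -/
def SmoothFun (n : ℕ) {M : Type*} [TopologicalSpace M]
    [ChartedSpace (EuclideanSpace ℝ (Fin (4 * n + 3))) M] (U : Set M) (f : M → ℝ) : Prop :=
  ContMDiffOn (𝓡 (4 * n + 3)) 𝓘(ℝ, ℝ) ∞ f U

/-- The one-form `η` is smooth on the open set `U`: its values on smooth local vector fields are
smooth. -/
def SmoothForm (U : Set M) (η : (x : M) → TangentSpace (𝓡 (4 * n + 3)) x →L[ℝ] ℝ) : Prop :=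
  ∀ W : Set M, IsOpen W → W ⊆ U → ∀ A : (x : M) → TangentSpace (𝓡 (4 * n + 3)) x,
    SmoothField W A → SmoothFun n W (fun x => η x (A x))

/-- The derivative `v(f)` of the function `f` along the tangent vector `v` at `x`. -/
def dirDeriv (f : M → ℝ) (x : M) (v : TangentSpace (𝓡 (4 * n + 3)) x) : ℝ :=
  mvfderiv (𝓡 (4 * n + 3)) f x v

/-- The exterior derivative of a one-form,
`dη(A, B) = A(η(B)) - B(η(A)) - η([A, B])`, on vector fields smooth near `x`. -/
def dForm (η : (x : M) → TangentSpace (𝓡 (4 * n + 3)) x →L[ℝ] ℝ)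
    (A B : (x : M) → TangentSpace (𝓡 (4 * n + 3)) x) (x : M) : ℝ :=
  dirDeriv (fun y => η y (B y)) x (A x) - dirDeriv (fun y => η y (A y)) x (B x)
    - η x (VectorField.mlieBracket (𝓡 (4 * n + 3)) A B x)

end Basics

/-- The signs `ε₁ = ε₂ = 1`, `ε₃ = -1`. The indices `1, 2, 3` are the elements `0, 1, 2` of
`Fin 3`; a cyclic permutation `(i, j, k)` of `(1, 2, 3)` is `(i, i + 1, i + 2)`. -/
def eps : Fin 3 → ℝ := ![1, 1, -1]

/-! ## Paraquaternionic contact structures -/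

/-- The tensors of a paraquaternionic contact structure with a chosen metric in the conformal
class: the distribution `H`, the metric `g` on `H`, and the bundle `PQ` of endomorphisms of `H`. -/
structure HorizontalData (n : ℕ) (M : Type*) [TopologicalSpace M]
    [ChartedSpace (EuclideanSpace ℝ (Fin (4 * n + 3))) M]
    [IsManifold (𝓡 (4 * n + 3)) ∞ M] where
  H : (x : M) → Submodule ℝ (TangentSpace (𝓡 (4 * n + 3)) x)
  g : (x : M) → H x →ₗ[ℝ] H x →ₗ[ℝ] ℝ
  PQ : (x : M) → Submodule ℝ (Module.End ℝ (H x))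

variable {n : ℕ} {M : Type*} [TopologicalSpace M]
  [ChartedSpace (EuclideanSpace ℝ (Fin (4 * n + 3))) M]
  [IsManifold (𝓡 (4 * n + 3)) ∞ M]

namespace HorizontalData

variable (P : HorizontalData n M)

/-- A horizontal vector field (a section of `H`) as a vector field. -/
def inc (X : (x : M) → P.H x) : (x : M) → TangentSpace (𝓡 (4 * n + 3)) x := fun x => X x

/-- The horizontal vector field `X` is smooth on `U`. -/
def SmoothH (U : Set M) (X : (x : M) → P.H x) : Prop := SmoothField U (P.inc X)

/-- The field `σ` of endomorphisms of `H` is smooth on the open set `U`. -/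
def SmoothEnd (U : Set M) (σ : (x : M) → Module.End ℝ (P.H x)) : Prop :=
  ∀ W : Set M, IsOpen W → W ⊆ U → ∀ X : (x : M) → P.H x,
    P.SmoothH W X → P.SmoothH W (fun x => σ x (X x))

/-- The `4n` horizontal vectors `e` at `x` are orthonormal: `g(e_a, e_b) = ± δ_ab`. As `H x` has
dimension `4n`, they form a basis. -/
def IsOrthonormalAt (x : M) (e : Fin (4 * n) → P.H x) : Prop :=
  (∀ a, P.g x (e a) (e a) = 1 ∨ P.g x (e a) (e a) = -1) ∧
    ∀ a b, a ≠ b → P.g x (e a) (e b) = 0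

/-- On the open set `U` the forms `η_s` and the endomorphisms `J_s` of `H` are a local contact form
and a local basis of `PQ` of the pqc structure, compatible with the metric `g`. -/
structure IsAdmissible (U : Set M)
    (η : Fin 3 → (x : M) → TangentSpace (𝓡 (4 * n + 3)) x →L[ℝ] ℝ)
    (J : Fin 3 → (x : M) → Module.End ℝ (P.H x)) : Prop where
  smooth_form : ∀ s, SmoothForm U (η s)
  ker : ∀ x ∈ U, ∀ v, v ∈ P.H x ↔ ∀ s, η s x v = 0
  smooth_end : ∀ s, P.SmoothEnd U (J s)
  span : ∀ x ∈ U, P.PQ x = Submodule.span ℝ (Set.range fun s => J s x)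
  sq : ∀ x ∈ U, ∀ s, J s x * J s x = eps s • 1
  mul : ∀ x ∈ U, ∀ i, J i x * J (i + 1) x = -eps (i + 2) • J (i + 2) x
  mul_swap : ∀ x ∈ U, ∀ i, J (i + 1) x * J i x = eps (i + 2) • J (i + 2) x
  compat : ∀ x ∈ U, ∀ s X Y, P.g x (J s x X) (J s x Y) = -eps s * P.g x X Y
  contact : ∀ W : Set M, IsOpen W → W ⊆ U → ∀ X Y : (x : M) → P.H x,
    P.SmoothH W X → P.SmoothH W Y → ∀ x ∈ W, ∀ s,
      dForm (η s) (P.inc X) (P.inc Y) x = -2 * eps s * P.g x (J s x (X x)) (Y x)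

/-- `P` is a paraquaternionic contact structure on `M` (with a chosen metric `g` of signature
`(2n, 2n)` in the conformal class). -/
structure IsPQC : Prop where
  finrank_H : ∀ x, Module.finrank ℝ (P.H x) = 4 * n
  symm : ∀ x X Y, P.g x X Y = P.g x Y X
  neutral : ∀ x, ∃ e : Fin (4 * n) → P.H x, P.IsOrthonormalAt x e ∧
    Set.ncard {a | P.g x (e a) (e a) = 1} = 2 * n
  smooth_g : ∀ W : Set M, IsOpen W → ∀ X Y : (x : M) → P.H x,
    P.SmoothH W X → P.SmoothH W Y → SmoothFun n W (fun x => P.g x (X x) (Y x))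
  exists_admissible : ∀ x, ∃ U : Set M, IsOpen U ∧ x ∈ U ∧ ∃ η J, P.IsAdmissible U η J

/-- The Reeb vector fields `ξ₁, ξ₂, ξ₃` of the local contact form `η` on the open set `U`:
`η_s(ξ_t) = δ_st` and `(ξ_s ⌟ dη_s)|_H = 0`. In dimension seven one requires moreover
`(ξ_j ⌟ dη_i)|_H = ε_k (ξ_i ⌟ dη_j)|_H`, which is not automatic there. -/
structure IsReeb (U : Set M)
    (η : Fin 3 → (x : M) → TangentSpace (𝓡 (4 * n + 3)) x →L[ℝ] ℝ)
    (ξ : Fin 3 → (x : M) → TangentSpace (𝓡 (4 * n + 3)) x) : Prop where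
  smooth : ∀ s, SmoothField U (ξ s)
  dual : ∀ x ∈ U, ∀ s t, η s x (ξ t x) = if s = t then 1 else 0
  contr : ∀ W : Set M, IsOpen W → W ⊆ U → ∀ X : (x : M) → P.H x, P.SmoothH W X →
    ∀ x ∈ W, ∀ s, dForm (η s) (ξ s) (P.inc X) x = 0
  dim_seven : n = 1 → ∀ W : Set M, IsOpen W → W ⊆ U → ∀ X : (x : M) → P.H x, P.SmoothH W X →
    ∀ x ∈ W, ∀ i, dForm (η i) (ξ (i + 1)) (P.inc X) x
      = eps (i + 2) * dForm (η (i + 1)) (ξ i) (P.inc X) x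

/-- `B` belongs to the Lie algebra `sp(n, ℝ) ⊕ sp(1, ℝ)` of endomorphisms of `H x`: it is the sum of
a skew-symmetric endomorphism commuting with `PQ` and of an element of `PQ`. -/
def InSpSp (x : M) (B : Module.End ℝ (P.H x)) : Prop :=
  ∃ B₀ σ : Module.End ℝ (P.H x), B = B₀ + σ ∧ σ ∈ P.PQ x ∧
    (∀ X Y, P.g x (B₀ X) Y = -P.g x X (B₀ Y)) ∧ ∀ ρ ∈ P.PQ x, B₀ * ρ = ρ * B₀

/-! ## The canonical connection -/

/-- A linear connection `cov` on `M` together with a complement `V` of `H`, `TM = H ⊕ V`. -/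
structure Connection where
  V : (x : M) → Submodule ℝ (TangentSpace (𝓡 (4 * n + 3)) x)
  isCompl : ∀ x, IsCompl (P.H x) (V x)
  cov : CovariantDerivative (𝓡 (4 * n + 3)) (EuclideanSpace ℝ (Fin (4 * n + 3)))
    (TangentSpace (𝓡 (4 * n + 3)) : M → Type)

/-- A local contact form `η`, a local basis `J` of `PQ`, vector fields `ξ` and horizontal vector
fields `e`. -/
structure LocalFrame where
  η : Fin 3 → (x : M) → TangentSpace (𝓡 (4 * n + 3)) x →L[ℝ] ℝ
  J : Fin 3 → (x : M) → Module.End ℝ (P.H x)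
  ξ : Fin 3 → (x : M) → TangentSpace (𝓡 (4 * n + 3)) x
  e : Fin (4 * n) → (x : M) → P.H x

variable {P}

/-- On `U`, `(η, J)` is admissible, `ξ` are the Reeb vector fields of `η`, and `e` is a smooth
orthonormal frame of `H`. -/
structure LocalFrame.IsAdapted (F : P.LocalFrame) (U : Set M) : Prop where
  admissible : P.IsAdmissible U F.η F.J
  reeb : P.IsReeb U F.η F.ξ
  smooth : ∀ a, P.SmoothH U (F.e a)
  orthonormal : ∀ x ∈ U, P.IsOrthonormalAt x (fun a => F.e a x)

/-- The horizontal vector field `I_s X`. -/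
def LocalFrame.app (F : P.LocalFrame) (s : Fin 3) (X : (x : M) → P.H x) : (x : M) → P.H x :=
  fun x => F.J s x (X x)

/-- The sign `g(e_a, e_a)`. -/
def LocalFrame.sgn (F : P.LocalFrame) (a : Fin (4 * n)) (x : M) : ℝ :=
  P.g x (F.e a x) (F.e a x)

namespace Connection

variable (C : P.Connection)

/-- The projection `TM → H` along `V`. -/
def hor (x : M) : TangentSpace (𝓡 (4 * n + 3)) x →ₗ[ℝ] P.H x :=
  (P.H x).projectionOnto (C.V x) (C.isCompl x)

/-- The projection `TM → V` along `H`. -/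
def ver (x : M) : TangentSpace (𝓡 (4 * n + 3)) x →ₗ[ℝ] C.V x :=
  (C.V x).projectionOnto (P.H x) (C.isCompl x).symm

/-- The vector field `∇_A B`. -/
def nabla (A B : (x : M) → TangentSpace (𝓡 (4 * n + 3)) x) :
    (x : M) → TangentSpace (𝓡 (4 * n + 3)) x := fun x => C.cov B x (A x)

/-- The horizontal vector `∇_v X` for a horizontal vector field `X` (the canonical connection
preserves `H`, so that the projection does nothing there). -/
def nablaAt (X : (x : M) → P.H x) (x : M) (v : TangentSpace (𝓡 (4 * n + 3)) x) : P.H x :=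
  C.hor x (C.cov (P.inc X) x v)

/-- The horizontal vector `T(v, X)_H`. -/
def torH (x : M) (v : TangentSpace (𝓡 (4 * n + 3)) x) : Module.End ℝ (P.H x) :=
  C.hor x ∘ₗ (C.cov.torsion x v).toLinearMap ∘ₗ (P.H x).subtype

/-- `C` is the canonical connection of the pqc structure `P`, and its complement is the canonical
one, generated by the Reeb vector fields. -/
structure IsCanonical : Prop where
  smooth : C.cov.ContMDiffCovariantDerivative ∞
  /-- `V` is locally generated by the Reeb vector fields of the local contact forms. -/
  vertical : ∀ U : Set M, IsOpen U → ∀ η J, P.IsAdmissible U η J →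
    ∃ ξ, P.IsReeb U η ξ ∧ ∀ x ∈ U, C.V x = Submodule.span ℝ (Set.range fun s => ξ s x)
  /-- `∇` preserves `H`. -/
  preserves_H : ∀ U : Set M, IsOpen U → ∀ X : (x : M) → P.H x, P.SmoothH U X →
    ∀ x ∈ U, ∀ v, C.cov (P.inc X) x v ∈ P.H x
  /-- `∇` preserves `V`. -/
  preserves_V : ∀ U : Set M, IsOpen U → ∀ ζ, SmoothField U ζ → (∀ x ∈ U, ζ x ∈ C.V x) →
    ∀ x ∈ U, ∀ v, C.cov ζ x v ∈ C.V x
  /-- `∇g = 0`. -/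
  metric : ∀ U : Set M, IsOpen U → ∀ X Y : (x : M) → P.H x, P.SmoothH U X → P.SmoothH U Y →
    ∀ x ∈ U, ∀ v, dirDeriv (fun y => P.g y (X y) (Y y)) x v
      = P.g x (C.nablaAt X x v) (Y x) + P.g x (X x) (C.nablaAt Y x v)
  /-- `∇σ` is a section of `PQ` for every section `σ` of `PQ`. -/
  preserves_PQ : ∀ U : Set M, IsOpen U → ∀ σ : (x : M) → Module.End ℝ (P.H x),
    P.SmoothEnd U σ → (∀ x ∈ U, σ x ∈ P.PQ x) → ∀ x ∈ U, ∀ v, ∃ ρ ∈ P.PQ x,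
      ∀ W : Set M, IsOpen W → W ⊆ U → x ∈ W → ∀ X : (x : M) → P.H x, P.SmoothH W X →
        C.nablaAt (fun y => σ y (X y)) x v - σ x (C.nablaAt X x v) = ρ (X x)
  /-- `T(X, Y) = -[X, Y]_V` for horizontal `X`, `Y`. -/
  torsion_H : ∀ U : Set M, IsOpen U → ∀ X Y : (x : M) → P.H x, P.SmoothH U X → P.SmoothH U Y →
    ∀ x ∈ U, C.cov.torsion x (X x) (Y x)
      = -(C.ver x (VectorField.mlieBracket (𝓡 (4 * n + 3)) (P.inc X) (P.inc Y) x) :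
          TangentSpace (𝓡 (4 * n + 3)) x)
  /-- For `v ∈ V` the endomorphism `T(v, ·)_H` of `H` is orthogonal to `sp(n, ℝ) ⊕ sp(1, ℝ)` with
  respect to `⟨A, B⟩ = ∑ₐ g(e_a, e_a) g(A e_a, B e_a)`. -/
  torsion_V : ∀ x, ∀ v ∈ C.V x, ∀ B, P.InSpSp x B → ∀ e, P.IsOrthonormalAt x e →
    ∑ a, P.g x (e a) (e a) * P.g x (C.torH x v (e a)) (B (e a)) = 0
  /-- The identification `ξ_s ↦ I_s` of `V` with `PQ` is parallel: `∇_v I_s` corresponds to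
  `∇_v ξ_s = ∑ₜ η_t(∇_v ξ_s) ξ_t`. -/
  parallel : ∀ U : Set M, IsOpen U → ∀ η J ξ, P.IsAdmissible U η J → P.IsReeb U η ξ →
    ∀ X : (x : M) → P.H x, P.SmoothH U X → ∀ x ∈ U, ∀ v s,
      C.nablaAt (fun y => J s y (X y)) x v - J s x (C.nablaAt X x v)
        = ∑ t, η t x (C.cov (ξ s) x v) • J t x (X x)

/-! ## Torsion endomorphism, curvature and their contractions -/

/-- `T(v, X, Y) = g(T(v, X), Y)`. -/
def T (x : M) (v : TangentSpace (𝓡 (4 * n + 3)) x) (X Y : P.H x) : ℝ :=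
  P.g x (C.torH x v X) Y

/-- The symmetric part of the torsion endomorphism. -/
def TSym (x : M) (v : TangentSpace (𝓡 (4 * n + 3)) x) (X Y : P.H x) : ℝ :=
  (C.T x v X Y + C.T x v Y X) / 2

/-- The skew-symmetric part of the torsion endomorphism. -/
def TAlt (x : M) (v : TangentSpace (𝓡 (4 * n + 3)) x) (X Y : P.H x) : ℝ :=
  (C.T x v X Y - C.T x v Y X) / 2

/-- `τ(X, Y) = -∑ₛ ε_s T^sym(ξ_s, I_s X, Y)`. -/
def tau (F : P.LocalFrame) (x : M) (X Y : P.H x) : ℝ :=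
  -∑ s, eps s * C.TSym x (F.ξ s x) (F.J s x X) Y

/-- `μ_s(X, Y) = ε_s T^alt(ξ_s, I_s X, Y)`. -/
def muS (F : P.LocalFrame) (s : Fin 3) (x : M) (X Y : P.H x) : ℝ :=
  eps s * C.TAlt x (F.ξ s x) (F.J s x X) Y

/-- `μ = μ₁` (the three tensors `μ_s` coincide). -/
def mu (F : P.LocalFrame) (x : M) (X Y : P.H x) : ℝ := C.muS F 0 x X Y

/-- The curvature `R(A, B) D = ∇_A ∇_B D - ∇_B ∇_A D - ∇_{[A, B]} D`. -/
def curv (A B D : (x : M) → TangentSpace (𝓡 (4 * n + 3)) x) (x : M) :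
    TangentSpace (𝓡 (4 * n + 3)) x :=
  C.nabla A (C.nabla B D) x - C.nabla B (C.nabla A D) x
    - C.nabla (VectorField.mlieBracket (𝓡 (4 * n + 3)) A B) D x

/-- `R(A, B, X, Y) = g(R(A, B) X, Y)` for horizontal `X`, `Y`. -/
def R (A B : (x : M) → TangentSpace (𝓡 (4 * n + 3)) x) (X Y : (x : M) → P.H x) (x : M) : ℝ :=
  P.g x (C.hor x (C.curv A B (P.inc X) x)) (Y x)

/-- The Ricci 2-forms `ρ_s(A, B) = (1/4n) ∑ₐ g(e_a, e_a) R(A, B, e_a, I_s e_a)`. -/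
def rho (F : P.LocalFrame) (s : Fin 3) (A B : (x : M) → TangentSpace (𝓡 (4 * n + 3)) x)
    (x : M) : ℝ :=
  1 / (4 * n) * ∑ a, F.sgn a x * C.R A B (F.e a) (F.app s (F.e a)) x

/-- The horizontal pqc-Ricci tensor `Ric(X, Y) = ∑ₐ g(e_a, e_a) R(e_a, X, Y, e_a)`. -/
def Ric (F : P.LocalFrame) (X Y : (x : M) → P.H x) (x : M) : ℝ :=
  ∑ a, F.sgn a x * C.R (P.inc (F.e a)) (P.inc X) Y (F.e a) x

/-- The pqc-scalar curvature `Scal = ∑ₐ g(e_a, e_a) Ric(e_a, e_a)`. -/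
def Scal (F : P.LocalFrame) (x : M) : ℝ :=
  ∑ a, F.sgn a x * C.Ric F (F.e a) (F.e a) x

/-- The covariant derivative `(∇_A S)(X, Y)` of a horizontal two-tensor `S`. -/
def nablaT (S : (x : M) → P.H x → P.H x → ℝ) (A : (x : M) → TangentSpace (𝓡 (4 * n + 3)) x)
    (X Y : (x : M) → P.H x) (x : M) : ℝ :=
  dirDeriv (fun y => S y (X y) (Y y)) x (A x)
    - S x (C.nablaAt X x (A x)) (Y x) - S x (X x) (C.nablaAt Y x (A x))

/-- The covariant derivative `(∇_A ρ_s)(B, D)` of the Ricci 2-form, that is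
`(1/4n) ∑ₐ g(e_a, e_a) (∇_A R)(B, D, e_a, I_s e_a)`. As `ρ_σ` is linear in the section `σ` of `PQ`
and `∇_A I_s = ∑ₜ η_t(∇_A ξ_s) I_t`, this is the derivative of the 2-form `ρ_s` corrected by
`∑ₜ η_t(∇_A ξ_s) ρ_t`. -/
def nablaRho (F : P.LocalFrame) (s : Fin 3) (A B D : (x : M) → TangentSpace (𝓡 (4 * n + 3)) x)
    (x : M) : ℝ :=
  dirDeriv (C.rho F s B D) x (A x) - C.rho F s (C.nabla A B) D x - C.rho F s B (C.nabla A D) x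
    - ∑ t, F.η t x (C.nabla A (F.ξ s) x) * C.rho F t B D x

/-- The divergence `(∇_{e_a} S)(e_a, X)`. -/
def div (F : P.LocalFrame) (S : (x : M) → P.H x → P.H x → ℝ) (X : (x : M) → P.H x)
    (x : M) : ℝ :=
  ∑ a, F.sgn a x * C.nablaT S (P.inc (F.e a)) (F.e a) X x

/-- The twisted divergence `(∇_{e_a} S)(I_s e_a, I_s X)`. -/
def divI (F : P.LocalFrame) (s : Fin 3) (S : (x : M) → P.H x → P.H x → ℝ)
    (X : (x : M) → P.H x) (x : M) : ℝ :=
  ∑ a, F.sgn a x * C.nablaT S (P.inc (F.e a)) (F.app s (F.e a)) (F.app s X) x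

end Connection

end HorizontalData

/-- The fundamental 2-forms `ω_s(X, Y) = g(I_s X, Y)`. -/
def HorizontalData.LocalFrame.ω {P : HorizontalData n M} (F : P.LocalFrame) (s : Fin 3)
    (X Y : (x : M) → P.H x) (x : M) : ℝ :=
  P.g x (F.J s x (X x)) (Y x)

end PQC

end

noncomputable section

namespace PQC

/-! ## Paraquaternionic linear algebra over a commutative algebra of functions -/

/-! The formulas all come from the first Bianchi identity of a connection with torsion, split into
horizontal and vertical parts and contracted, together with the rigid shape of the canonical
torsion. Nothing beyond the formal rules for functions, fields, bracket and connection is used, so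
the work is done in an algebraic model `Geo` over a commutative real algebra. `geoSec` shows that
the smooth sections over `U` form such a model, and the `Rep` lemmas carry the resulting identities
back to the manifold.

Because ξ_s ↦ I_s is parallel, the curvature rotates the ξ_s and the I_s by the same forms `kap`;
tracing its commutator with I_i against I_j identifies these forms with the Ricci 2-forms
(`kap_ij`). The vertical part of the Bianchi identity on three horizontal fields forces T(ξ_s, ·) to
be horizontal on H (`gam_cyc`); this is where dimension seven needs its extra condition on the Reeb
fields. On two horizontal fields and one Reeb field it expresses the horizontal Ricci 2-forms by the
torsion endomorphisms and a single scalar `sc` (`rho_inc`), and the skew-symmetry of `kap` gives the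
symmetries `TT_J_self` and `TT_cross`. Combined with orthogonality to sp(n, ℝ) ⊕ sp(1, ℝ), they
reduce the torsion to τ and μ (`TT_formula`). Contracting the horizontal Bianchi identity then
yields the Ricci tensor as a combination of τ, μ and g (`Ric_eq`), hence Scal = 8n(n+2) `sc` and the
inverse formulas for τ and μ.

For R(ξ_i, X, Y, Z) the horizontal Bianchi identity gives the skew part in X, Y, while the metric
gives skewness in Y, Z. As for the Koszul formula, these two facts determine the tensor
(`four_R_xi_inc`), up to the unknown vectors T(ξ_s, ξ_t)_H. The vertical Bianchi identity on two
Reeb fields and one horizontal field turns those vectors into mixed Ricci 2-forms (`rho_mixed`,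
`rho_diag_sum`). For R(ξ_i, ξ_j, X, Y) the horizontal Bianchi identity is already the answer
(`RH_xi_xi`), once the derivative of T(ξ_i, ξ_j) is rewritten as a derivative of ρ_k (`nbRho_eq`).

The mixed Ricci 2-forms themselves come from contracting R(ξ_i, X, Y, Z) in different slots. This
produces the linear relations `rho_diag_div` and `divS_mu_eq`; with `rho_diag_th` and `divJ_sum`
they can be solved for ρ_i(ξ_i, X) and for the components of T(ξ_s, ξ_t)_H, giving `rho_xi_self` and
`rho_J_xi_mixed`. -/

/-- The sign `ε_s` as an element of a real algebra. -/
def ep (A : Type*) [CommRing A] [Algebra ℝ A] (s : Fin 3) : A := algebraMap ℝ A (eps s)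

/-- `(i, j, k)` is a cyclic permutation of the three indices. -/
def Cyc (i j k : Fin 3) : Prop := j = i + 1 ∧ k = i + 2

lemma Cyc.rot {i j k : Fin 3} (h : Cyc i j k) : Cyc j k i := by
  obtain ⟨rfl, rfl⟩ := h
  constructor <;> fin_cases i <;> rfl

lemma Cyc.mk' (i : Fin 3) : Cyc i (i + 1) (i + 2) := ⟨rfl, rfl⟩

section Signs

variable {A : Type*} [CommRing A] [Algebra ℝ A]

lemma ep_zero : ep A 0 = 1 := by simp [ep, eps]
lemma ep_one : ep A 1 = 1 := by simp [ep, eps]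
lemma ep_two : ep A 2 = -1 := by simp [ep, eps]

/-- Exactly one of the three signs is -1. Sign bookkeeping below is done by evaluating an identity
in these three cases, which treats all cyclic triples at once. -/
lemma Cyc.ep_cases {i j k : Fin 3} (h : Cyc i j k) :
    (ep A i = 1 ∧ ep A j = 1 ∧ ep A k = -1) ∨ (ep A i = 1 ∧ ep A j = -1 ∧ ep A k = 1) ∨
      (ep A i = -1 ∧ ep A j = 1 ∧ ep A k = 1) := by
  obtain ⟨rfl, rfl⟩ := h
  fin_cases i <;> simp [ep_zero, ep_one, ep_two]

lemma ep_mul_self (s : Fin 3) : ep A s * ep A s = 1 := by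
  fin_cases s <;> simp [ep_zero, ep_one, ep_two]

lemma Cyc.sum {B : Type*} [AddCommMonoid B] {i j k : Fin 3} (h : Cyc i j k) (f : Fin 3 → B) :
    ∑ s, f s = f i + f j + f k := by
  obtain ⟨rfl, rfl⟩ := h
  fin_cases i
  · exact Fin.sum_univ_three f
  · rw [Fin.sum_univ_three]
    change f 0 + f 1 + f 2 = f 1 + f 2 + f 0
    rw [add_comm (f 1 + f 2), add_assoc]
  · rw [Fin.sum_univ_three]
    change f 0 + f 1 + f 2 = f 2 + f 0 + f 1
    rw [add_assoc (f 2), add_comm (f 2)]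

/-- The ring of smooth functions has zero divisors, so only nonzero real constants may be cancelled,
by multiplying with their inverse. -/
lemma algebraMap_cancel {r : ℝ} (hr : r ≠ 0) {x : A} (h : algebraMap ℝ A r * x = 0) : x = 0 := by
  have : algebraMap ℝ A (r⁻¹ * r) * x = 0 := by rw [map_mul, mul_assoc, h, mul_zero]
  simpa [inv_mul_cancel₀ hr] using this

lemma natCast_cancel {m : ℕ} (hm : m ≠ 0) {x : A} (h : (m : A) * x = 0) : x = 0 :=
  algebraMap_cancel (r := (m : ℝ)) (by exact_mod_cast hm) (by simpa using h)

lemma two_cancel {x : A} (h : 2 * x = 0) : x = 0 :=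
  natCast_cancel (m := 2) two_ne_zero (by simpa using h)

lemma two_inj {x y : A} (h : 2 * x = 2 * y) : x = y :=
  sub_eq_zero.1 (two_cancel (by linear_combination h))

end Signs

/-- A function of one variable is linear. -/
structure IsLin {A H : Type*} [CommRing A] [AddCommGroup H] [Module A H] (l : H → A) : Prop where
  add : ∀ X Y, l (X + Y) = l X + l Y
  smul : ∀ (f : A) X, l (f • X) = f * l X

/-- A function of two variables is bilinear. -/
structure IsBil {A H : Type*} [CommRing A] [AddCommGroup H] [Module A H] (φ : H → H → A) :
    Prop where
  left : ∀ Y, IsLin fun X => φ X Y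
  right : ∀ X, IsLin fun Y => φ X Y

lemma IsLin.sum {A H ι : Type*} [CommRing A] [AddCommGroup H] [Module A H] {l : H → A}
    (hl : IsLin l) (s : Finset ι) (c : ι → A) (X : ι → H) :
    l (∑ a ∈ s, c a • X a) = ∑ a ∈ s, c a * l (X a) := by
  classical
  have h0 : l 0 = 0 := by simpa using hl.smul 0 0
  induction s using Finset.induction_on with
  | empty => simpa using h0
  | insert a s ha ih => rw [Finset.sum_insert ha, Finset.sum_insert ha, hl.add, hl.smul, ih]

/-- A module with a metric, a compatible paraquaternionic structure and an orthonormal frame. -/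
structure PQModule (n : ℕ) (A H : Type*) [CommRing A] [Algebra ℝ A] [AddCommGroup H]
    [Module A H] where
  g : H →ₗ[A] H →ₗ[A] A
  J : Fin 3 → H →ₗ[A] H
  e : Fin (4 * n) → H
  g_symm : ∀ X Y, g X Y = g Y X
  J_sq : ∀ s X, J s (J s X) = ep A s • X
  J_mul : ∀ i X, J i (J (i + 1) X) = -ep A (i + 2) • J (i + 2) X
  J_mul_swap : ∀ i X, J (i + 1) (J i X) = ep A (i + 2) • J (i + 2) X
  g_J_J : ∀ s X Y, g (J s X) (J s Y) = -ep A s * g X Y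
  sgn_sq : ∀ a, g (e a) (e a) * g (e a) (e a) = 1
  expand : ∀ X, X = ∑ a, (g (e a) (e a) * g X (e a)) • e a

namespace PQModule

variable {n : ℕ} {A H : Type*} [CommRing A] [Algebra ℝ A] [AddCommGroup H] [Module A H]
  (L : PQModule n A H)

lemma J_ij {i j k : Fin 3} (h : Cyc i j k) (X : H) : L.J i (L.J j X) = -ep A k • L.J k X := by
  obtain ⟨rfl, rfl⟩ := h; exact L.J_mul i X

lemma J_ji {i j k : Fin 3} (h : Cyc i j k) (X : H) : L.J j (L.J i X) = ep A k • L.J k X := by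
  obtain ⟨rfl, rfl⟩ := h; exact L.J_mul_swap i X

lemma g_J (s : Fin 3) (X Y : H) : L.g (L.J s X) Y = -L.g X (L.J s Y) := by
  have h := L.g_J_J s X (L.J s Y)
  rw [L.J_sq] at h
  simp only [map_smul, smul_eq_mul] at h
  linear_combination (ep A s) * h - (L.g (L.J s X) Y + L.g X (L.J s Y)) * ep_mul_self (A := A) s

/-- The trace of a bilinear form with respect to the metric. -/
def tr (φ : H → H → A) : A := ∑ a, L.g (L.e a) (L.e a) * φ (L.e a) (L.e a)

lemma tr_add (φ ψ : H → H → A) : L.tr (fun Y Z => φ Y Z + ψ Y Z) = L.tr φ + L.tr ψ := by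
  simp [tr, mul_add, Finset.sum_add_distrib]

lemma tr_sub (φ ψ : H → H → A) : L.tr (fun Y Z => φ Y Z - ψ Y Z) = L.tr φ - L.tr ψ := by
  simp [tr, mul_sub, Finset.sum_sub_distrib]

lemma tr_neg (φ : H → H → A) : L.tr (fun Y Z => -φ Y Z) = -L.tr φ := by
  simp [tr]

lemma tr_mul (c : A) (φ : H → H → A) : L.tr (fun Y Z => c * φ Y Z) = c * L.tr φ := by
  simp [tr, Finset.mul_sum, mul_left_comm]

lemma tr_mul' (c : A) (φ : H → H → A) : L.tr (fun Y Z => φ Y Z * c) = L.tr φ * c := by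
  simp [tr, Finset.sum_mul, mul_assoc]

/-- Contracting with g(X, ·) is the orthonormal expansion of X placed inside l. Almost every
contraction below is evaluated by this rule. -/
lemma tr_g (l : H → A) (hl : IsLin l) (X : H) : L.tr (fun Y Z => L.g X Y * l Z) = l X := by
  conv_rhs => rw [L.expand X, hl.sum]
  simp [tr, mul_assoc]

lemma tr_g' (l : H → A) (hl : IsLin l) (X : H) : L.tr (fun Y Z => L.g Y X * l Z) = l X := by
  simpa [L.g_symm] using L.tr_g l hl X

lemma tr_swap (φ : H → H → A) : L.tr (fun Y Z => φ Z Y) = L.tr φ := rfl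

/-- Each J_s is skew for g: expanding J_s e_a in the frame on both sides gives the same double sum
with indices exchanged and the matrix negated. -/
lemma tr_J (φ : H → H → A) (hφ : IsBil φ) (s : Fin 3) :
    L.tr (fun Y Z => φ (L.J s Y) Z) = -L.tr (fun Y Z => φ Y (L.J s Z)) := by
  have h1 : ∀ a, φ (L.J s (L.e a)) (L.e a) = ∑ b, (L.g (L.e b) (L.e b) *
      L.g (L.J s (L.e a)) (L.e b)) * φ (L.e b) (L.e a) := fun a => by
    conv_lhs => rw [L.expand (L.J s (L.e a))]
    exact (hφ.left (L.e a)).sum _ _ _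
  have h2 : ∀ a, φ (L.e a) (L.J s (L.e a)) = ∑ b, (L.g (L.e b) (L.e b) *
      L.g (L.J s (L.e a)) (L.e b)) * φ (L.e a) (L.e b) := fun a => by
    conv_lhs => rw [L.expand (L.J s (L.e a))]
    exact (hφ.right (L.e a)).sum _ _ _
  simp only [tr, h1, h2, Finset.mul_sum, ← Finset.sum_neg_distrib]
  rw [Finset.sum_comm]
  refine Finset.sum_congr rfl fun a _ => Finset.sum_congr rfl fun b _ => ?_
  rw [L.g_J s (L.e b) (L.e a), L.g_symm (L.e b) (L.J s (L.e a))]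
  ring

lemma tr_J_J (φ : H → H → A) (hφ : IsBil φ) (s : Fin 3) :
    L.tr (fun Y Z => φ (L.J s Y) (L.J s Z)) = -ep A s * L.tr φ := by
  have h := L.tr_J (fun Y Z => φ Y (L.J s Z)) ⟨fun Y => hφ.left _, fun X =>
    ⟨fun Y Z => by simp [(hφ.right X).add], fun f Y => by simp [(hφ.right X).smul]⟩⟩ s
  rw [h]
  simp only [L.J_sq, (hφ.right _).smul, tr_mul]
  ring

lemma tr_metric : L.tr (fun Y Z => L.g Y Z) = 4 * n := by
  simp [tr, L.sgn_sq]

lemma tr_omega (s : Fin 3) : L.tr (fun Y Z => L.g (L.J s Y) Z) = 0 := by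
  have h : L.tr (fun Y Z => L.g (L.J s Y) Z) = -L.tr (fun Y Z => L.g (L.J s Y) Z) := by
    conv_lhs => simp only [L.g_J s]
    rw [tr_neg, ← tr_swap]
    simp only [L.g_symm]
  exact two_cancel (by linear_combination h)

/-- A bilinear form which is skew-symmetric has trace zero. -/
lemma tr_skew (φ : H → H → A) (h : ∀ X Y, φ X Y = -φ Y X) : L.tr φ = 0 := by
  have : L.tr φ = -L.tr φ := by
    conv_lhs => rw [← tr_swap]
    rw [← tr_neg]
    simp only [← h]
  exact two_cancel (by linear_combination this)

/-- A scalar is tested on one frame vector, whose norm squares to one; `1 ≤ n` guarantees that the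
frame is nonempty. -/
lemma eq_zero_of_smul (L : PQModule n A H) (hn : 1 ≤ n) {f : A} (h : ∀ X : H, f • X = 0) : f = 0 := by
  have h1 := congrArg (fun X => L.g X (L.e ⟨0, by omega⟩)) (h (L.e ⟨0, by omega⟩))
  simp only [map_smul, LinearMap.smul_apply, map_zero, LinearMap.zero_apply, smul_eq_mul] at h1
  have h2 := L.sgn_sq ⟨0, by omega⟩
  linear_combination L.g (L.e ⟨0, by omega⟩) (L.e ⟨0, by omega⟩) * h1 - f * h2

end PQModule

/-! ## Algebraic model of a pqc structure with its canonical connection -/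

/-- Smooth functions `A`, vector fields `V` and horizontal vector fields `H` with the operations of
a pqc structure, its Reeb vector fields and its canonical connection. -/
structure Geo (n : ℕ) (A V H : Type*) [CommRing A] [Algebra ℝ A] [AddCommGroup V] [Module A V]
    [AddCommGroup H] [Module A H] extends PQModule n A H where
  D : V → A → A
  lie : V → V → V
  nb : V → V → V
  inc : H →ₗ[A] V
  hor : V →ₗ[A] H
  eta : Fin 3 → V →ₗ[A] A
  xi : Fin 3 → V
  D_add_left : ∀ u v f, D (u + v) f = D u f + D v f
  D_smul_left : ∀ (h : A) u f, D (h • u) f = h * D u f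
  D_add : ∀ u f h, D u (f + h) = D u f + D u h
  D_mul : ∀ u f h, D u (f * h) = f * D u h + h * D u f
  D_const : ∀ u (r : ℝ), D u (algebraMap ℝ A r) = 0
  lie_swap : ∀ u v, lie u v = -lie v u
  lie_add : ∀ u v w, lie u (v + w) = lie u v + lie u w
  lie_smul : ∀ u (f : A) v, lie u (f • v) = f • lie u v + D u f • v
  jacobi : ∀ u v w, lie u (lie v w) = lie (lie u v) w + lie v (lie u w)
  nb_add_left : ∀ u v w, nb (u + v) w = nb u w + nb v w
  nb_smul_left : ∀ (f : A) u w, nb (f • u) w = f • nb u w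
  nb_add : ∀ u v w, nb u (v + w) = nb u v + nb u w
  nb_smul : ∀ u (f : A) v, nb u (f • v) = f • nb u v + D u f • v
  hor_inc : ∀ X, hor (inc X) = X
  hor_xi : ∀ s, hor (xi s) = 0
  eta_inc : ∀ s X, eta s (inc X) = 0
  eta_xi : ∀ s t, eta s (xi t) = if s = t then 1 else 0
  decomp : ∀ v, v = inc (hor v) + ∑ s, eta s v • xi s
  eta_nb_inc : ∀ s v Y, eta s (nb v (inc Y)) = 0
  hor_nb_xi : ∀ s v, hor (nb v (xi s)) = 0
  metric : ∀ v Y Z, D v (g Y Z) = g (hor (nb v (inc Y))) Z + g Y (hor (nb v (inc Z)))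
  parallel : ∀ v s Y, hor (nb v (inc (J s Y))) - J s (hor (nb v (inc Y)))
    = ∑ t, eta t (nb v (xi s)) • J t Y
  hor_tor : ∀ X Y, hor (nb (inc X) (inc Y) - nb (inc Y) (inc X) - lie (inc X) (inc Y)) = 0
  contact : ∀ s X Y, eta s (lie (inc X) (inc Y)) = 2 * ep A s * g (J s X) Y
  reeb : ∀ s Y, eta s (lie (xi s) (inc Y)) = 0
  dim_seven : n = 1 → ∀ i Y, eta i (lie (xi (i + 1)) (inc Y))
    = ep A (i + 2) * eta (i + 1) (lie (xi i) (inc Y))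
  tor_J : ∀ s u, ∑ a, g (e a) (e a) *
    g (hor (nb (xi s) (inc (e a)) - nb (inc (e a)) (xi s) - lie (xi s) (inc (e a))))
      (J u (e a)) = 0
  tor_sp : ∀ s X Y, ∑ a, g (e a) (e a) *
    g (hor (nb (xi s) (inc (e a)) - nb (inc (e a)) (xi s) - lie (xi s) (inc (e a))))
      (g X (e a) • Y - g Y (e a) • X
        - ∑ u, ep A u • (g (J u X) (e a) • J u Y - g (J u Y) (e a) • J u X)) = 0

namespace Geo

variable {n : ℕ} {A V H : Type*} [CommRing A] [Algebra ℝ A] [AddCommGroup V] [Module A V]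
  [AddCommGroup H] [Module A H] (G : Geo n A V H)

/-! ### Derivations, brackets, torsion and curvature -/

lemma D_zero (u : V) : G.D u 0 = 0 := by simpa using G.D_const u 0

lemma D_neg (u : V) (f : A) : G.D u (-f) = -G.D u f := by
  have h := G.D_add u f (-f)
  rw [add_neg_cancel, D_zero] at h
  linear_combination -h

lemma D_sub (u : V) (f h : A) : G.D u (f - h) = G.D u f - G.D u h := by
  rw [sub_eq_add_neg, D_add, D_neg, ← sub_eq_add_neg]

lemma D_const_mul (u : V) (r : ℝ) (f : A) :
    G.D u (algebraMap ℝ A r * f) = algebraMap ℝ A r * G.D u f := by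
  rw [D_mul, D_const, mul_zero, add_zero]

lemma D_ep_mul (u : V) (s : Fin 3) (f : A) : G.D u (ep A s * f) = ep A s * G.D u f :=
  G.D_const_mul u _ f

lemma D_natCast_mul (u : V) (m : ℕ) (f : A) : G.D u ((m : A) * f) = m * G.D u f := by
  simpa using G.D_const_mul u m f

lemma D_four_mul (u : V) (f : A) : G.D u (4 * f) = 4 * G.D u f := by
  simpa using G.D_natCast_mul u 4 f

lemma D_sum {ι : Type*} (u : V) (s : Finset ι) (f : ι → A) :
    G.D u (∑ a ∈ s, f a) = ∑ a ∈ s, G.D u (f a) := by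
  classical
  induction s using Finset.induction_on with
  | empty => simpa using G.D_zero u
  | insert a s ha ih => rw [Finset.sum_insert ha, Finset.sum_insert ha, G.D_add, ih]

lemma lie_add_left (u v w : V) : G.lie (u + v) w = G.lie u w + G.lie v w := by
  rw [G.lie_swap, G.lie_add, G.lie_swap u, G.lie_swap v]; abel

lemma lie_smul_left (f : A) (u v : V) : G.lie (f • u) v = f • G.lie u v - G.D v f • u := by
  rw [G.lie_swap, G.lie_smul, G.lie_swap v]; module

lemma nb_zero (u : V) : G.nb u 0 = 0 := by
  have h := G.nb_add u 0 0
  simpa using h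

lemma nb_neg (u v : V) : G.nb u (-v) = -G.nb u v := by
  have h := G.nb_add u v (-v)
  rw [add_neg_cancel, nb_zero] at h
  exact (neg_eq_of_add_eq_zero_right h.symm).symm

lemma nb_sub (u v w : V) : G.nb u (v - w) = G.nb u v - G.nb u w := by
  rw [sub_eq_add_neg, nb_add, nb_neg, ← sub_eq_add_neg]

lemma nb_zero_left (u : V) : G.nb 0 u = 0 := by
  have h := G.nb_add_left 0 0 u
  simpa using h

lemma nb_neg_left (u v : V) : G.nb (-u) v = -G.nb u v := by
  have h := G.nb_add_left u (-u) v
  rw [add_neg_cancel, nb_zero_left] at h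
  exact (neg_eq_of_add_eq_zero_right h.symm).symm

lemma nb_sum {ι : Type*} (u : V) (s : Finset ι) (f : ι → V) :
    G.nb u (∑ a ∈ s, f a) = ∑ a ∈ s, G.nb u (f a) := by
  classical
  induction s using Finset.induction_on with
  | empty => simpa using G.nb_zero u
  | insert a s ha ih => rw [Finset.sum_insert ha, Finset.sum_insert ha, G.nb_add, ih]

/-- The compatibility of the bracket with derivations need not be an axiom: it is the coefficient of
ξ_1 in the Jacobi identity for u, v and f ξ_1, compared with f times the one for u, v, ξ_1. -/
lemma D_lie (u v : V) (f : A) : G.D (G.lie u v) f = G.D u (G.D v f) - G.D v (G.D u f) := by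
  have h := congrArg (G.eta 0) (G.jacobi u v (f • G.xi 0))
  have h2 := congrArg (fun w => f * G.eta 0 w) (G.jacobi u v (G.xi 0))
  simp only [G.lie_smul, G.lie_add, map_add, map_smul, smul_eq_mul, G.eta_xi, if_true,
    mul_one] at h h2
  linear_combination h2 - h

/-- The torsion of the connection. -/
def tor : V →ₗ[A] V →ₗ[A] V :=
  LinearMap.mk₂ A (fun u v => G.nb u v - G.nb v u - G.lie u v)
    (fun u v w => by simp only [G.nb_add_left, G.nb_add, G.lie_add_left]; abel)
    (fun f u v => by simp only [G.nb_smul_left, G.nb_smul, G.lie_smul_left]; module)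
    (fun u v w => by simp only [G.nb_add_left, G.nb_add, G.lie_add]; abel)
    (fun f u v => by simp only [G.nb_smul_left, G.nb_smul, G.lie_smul]; module)

lemma tor_apply (u v : V) : G.tor u v = G.nb u v - G.nb v u - G.lie u v := rfl

lemma tor_swap (u v : V) : G.tor u v = -G.tor v u := by
  rw [tor_apply, tor_apply, G.lie_swap u v]; abel

lemma tor_self (u : V) : G.tor u u = 0 := by
  have h : G.lie u u = 0 := by
    have h1 : (2 : ℝ) ≠ 0 := two_ne_zero
    have h2 : G.lie u u + G.lie u u = 0 := by
      nth_rewrite 1 [G.lie_swap u u]; abel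
    have h3 : (algebraMap ℝ A 2) • G.lie u u = 0 := by
      rw [map_ofNat, ofNat_smul_eq_nsmul A 2, two_nsmul, h2]
    have h4 : (algebraMap ℝ A (2⁻¹ * 2)) • G.lie u u = 0 := by
      rw [map_mul, mul_smul, h3, smul_zero]
    simpa using h4
  rw [tor_apply, h]; abel

/-- The curvature of the connection. -/
def curv : V →ₗ[A] V →ₗ[A] V →ₗ[A] V :=
  LinearMap.mk₂ A (fun u v =>
    { toFun := fun w => G.nb u (G.nb v w) - G.nb v (G.nb u w) - G.nb (G.lie u v) w
      map_add' := fun w z => by simp only [G.nb_add]; abel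
      map_smul' := fun f w => by
        simp only [G.nb_smul, G.nb_add, G.D_lie, RingHom.id_apply]; module })
    (fun u u' v => by
      ext w
      simp only [LinearMap.coe_mk, AddHom.coe_mk, LinearMap.add_apply, G.nb_add_left, G.nb_add,
        G.lie_add_left]
      abel)
    (fun f u v => by
      ext w
      simp only [LinearMap.coe_mk, AddHom.coe_mk, LinearMap.smul_apply, G.nb_smul_left,
        G.nb_smul, G.lie_smul_left, sub_eq_add_neg, G.nb_add_left, ← neg_smul]
      module)
    (fun u v v' => by
      ext w
      simp only [LinearMap.coe_mk, AddHom.coe_mk, LinearMap.add_apply, G.nb_add_left, G.nb_add,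
        G.lie_add]
      abel)
    (fun f u v => by
      ext w
      simp only [LinearMap.coe_mk, AddHom.coe_mk, LinearMap.smul_apply, G.nb_smul_left,
        G.nb_smul, G.lie_smul, G.nb_add_left]
      module)

lemma curv_apply (u v w : V) :
    G.curv u v w = G.nb u (G.nb v w) - G.nb v (G.nb u w) - G.nb (G.lie u v) w := rfl

lemma curv_swap (u v w : V) : G.curv u v w = -G.curv v u w := by
  rw [curv_apply, curv_apply, G.lie_swap u v, nb_neg_left]; abel

/-- The covariant derivative of the torsion. -/
def nbTor (u v w : V) : V := G.nb u (G.tor v w) - G.tor (G.nb u v) w - G.tor v (G.nb u w)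

lemma nbTor_swap (u v w : V) : G.nbTor u v w = -G.nbTor u w v := by
  rw [nbTor, nbTor, G.tor_swap v w, G.tor_swap (G.nb u v) w, G.tor_swap v (G.nb u w), nb_neg]; abel

/-- The first Bianchi identity for a connection with torsion. -/
lemma bianchi (u v w : V) :
    G.curv u v w + G.curv v w u + G.curv w u v
      = G.nbTor u v w + G.nbTor v w u + G.nbTor w u v
        + G.tor (G.tor u v) w + G.tor (G.tor v w) u + G.tor (G.tor w u) v := by
  have hj := G.jacobi u v w
  rw [G.lie_swap (G.lie u v) w] at hj
  have e1 : G.lie v (G.lie u w) = -G.lie v (G.lie w u) := by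
    have : G.lie u w = (-1 : A) • G.lie w u := by rw [G.lie_swap]; module
    rw [this, G.lie_smul]
    have h1 : G.D v (-1) = 0 := by simpa using G.D_const v (-1)
    rw [h1]; module
  rw [e1] at hj
  -- The last four torsion terms cancel in the cyclic sum, and the double brackets cancel by the
  -- Jacobi identity; what is left is the curvature.
  have key : ∀ a b c : V, G.nbTor a b c + G.tor (G.tor b c) a
      = G.nb a (G.nb b c) - G.nb a (G.nb c b) - G.nb a (G.lie b c)
        + (G.nb a (G.lie b c) - G.nb (G.lie b c) a - G.lie a (G.lie b c))
        + G.tor c (G.nb a b) - G.tor b (G.nb a c) + G.tor a (G.nb c b) - G.tor a (G.nb b c) := by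
    intro a b c
    have h1 : G.tor (G.tor b c) a = -G.tor a (G.nb b c) + G.tor a (G.nb c b)
        + G.tor a (G.lie b c) := by
      rw [G.tor_swap _ a, G.tor_apply b c, map_sub, map_sub]; abel
    rw [h1, nbTor, G.tor_swap (G.nb a b) c, G.tor_apply b c, G.tor_apply a (G.lie b c)]
    simp only [nb_sub]
    abel
  have k1 := key u v w
  have k2 := key v w u
  have k3 := key w u v
  have e : G.nbTor u v w + G.nbTor v w u + G.nbTor w u v
        + G.tor (G.tor u v) w + G.tor (G.tor v w) u + G.tor (G.tor w u) v
      = (G.nbTor u v w + G.tor (G.tor v w) u) + (G.nbTor v w u + G.tor (G.tor w u) v)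
        + (G.nbTor w u v + G.tor (G.tor u v) w) := by abel
  rw [e, k1, k2, k3, hj]
  simp only [curv_apply]
  abel

end Geo

namespace Geo

variable {n : ℕ} {A V H : Type*} [CommRing A] [Algebra ℝ A] [AddCommGroup V] [Module A V]
  [AddCommGroup H] [Module A H] (G : Geo n A V H)

/-! ### The connection on `H` and on the Reeb vector fields -/

/-- The horizontal part of `∇_v Y`. -/
def nh (v : V) (Y : H) : H := G.hor (G.nb v (G.inc Y))

/-- The connection forms of the Reeb vector fields. -/
def cf (s t : Fin 3) (v : V) : A := G.eta t (G.nb v (G.xi s))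

lemma decomp_of_eta {v : V} (h : ∀ s, G.eta s v = 0) : v = G.inc (G.hor v) := by
  conv_lhs => rw [G.decomp v]
  simp [h]

lemma decomp_of_hor {v : V} (h : G.hor v = 0) : v = ∑ s, G.eta s v • G.xi s := by
  conv_lhs => rw [G.decomp v]
  simp [h]

lemma ext_V {v w : V} (h : G.hor v = G.hor w) (h' : ∀ s, G.eta s v = G.eta s w) : v = w := by
  rw [G.decomp v, G.decomp w, h]
  simp only [h']

lemma inc_nh (v : V) (Y : H) : G.inc (G.nh v Y) = G.nb v (G.inc Y) :=
  (G.decomp_of_eta fun s => G.eta_nb_inc s v Y).symm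

lemma nb_xi (v : V) (s : Fin 3) : G.nb v (G.xi s) = ∑ t, G.cf s t v • G.xi t :=
  G.decomp_of_hor (G.hor_nb_xi s v)

lemma hor_nb (u v : V) : G.hor (G.nb u v) = G.nh u (G.hor v) := by
  conv_lhs => rw [G.decomp v]
  simp only [G.nb_add, G.nb_sum, G.nb_smul, map_add, map_sum, map_smul, G.hor_nb_xi, G.hor_xi]
  simp [nh]

lemma eta_nb (u v : V) (s : Fin 3) :
    G.eta s (G.nb u v) = G.D u (G.eta s v) + ∑ t, G.eta t v * G.cf t s u := by
  conv_lhs => rw [G.decomp v]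
  simp only [G.nb_add, G.nb_sum, G.nb_smul, map_add, map_sum, map_smul, G.eta_nb_inc, G.eta_xi,
    smul_eq_mul]
  simp [cf, Finset.sum_add_distrib, add_comm]

lemma nh_add_left (u v : V) (Y : H) : G.nh (u + v) Y = G.nh u Y + G.nh v Y := by
  simp [nh, G.nb_add_left]

lemma nh_smul_left (f : A) (v : V) (Y : H) : G.nh (f • v) Y = f • G.nh v Y := by
  simp [nh, G.nb_smul_left]

lemma nh_add (v : V) (Y Z : H) : G.nh v (Y + Z) = G.nh v Y + G.nh v Z := by
  simp [nh, G.nb_add]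

lemma nh_smul (v : V) (f : A) (Y : H) : G.nh v (f • Y) = f • G.nh v Y + G.D v f • Y := by
  simp [nh, G.nb_smul, G.hor_inc]

lemma D_g (v : V) (Y Z : H) : G.D v (G.g Y Z) = G.g (G.nh v Y) Z + G.g Y (G.nh v Z) :=
  G.metric v Y Z

lemma nh_J (v : V) (s : Fin 3) (Y : H) :
    G.nh v (G.J s Y) = G.J s (G.nh v Y) + ∑ t, G.cf s t v • G.J t Y := by
  have h := G.parallel v s Y
  rw [sub_eq_iff_eq_add'] at h
  exact h

lemma D_ep (v : V) (s : Fin 3) : G.D v (ep A s) = 0 := G.D_const v _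

/-- A derivation `J_s ↦ ∑ₜ m_st J_t` of the paraquaternions is skew-symmetric: diagonal terms. -/
lemma diag_of_derivation (L : PQModule n A H) (hn : 1 ≤ n) (m : Fin 3 → Fin 3 → A)
    (B : H → H) (hsmul : ∀ s X, B (ep A s • X) = ep A s • B X)
    (hB : ∀ s X, B (L.J s X) = L.J s (B X) + ∑ t, m s t • L.J t X) (s : Fin 3) :
    m s s = 0 := by
  have hX : ∀ X : H, (2 * ep A s * m s s) • X = 0 := by
    intro X
    -- The derivation is applied twice to J_s² = ε_s. The off-diagonal terms drop out because
    -- different J's anticommute, leaving 2ε_s m_ss.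
    have h1 := hB s (L.J s X)
    have hc := Cyc.mk' s
    rw [hB s X, L.J_sq, hsmul] at h1
    simp only [hc.sum, map_add, map_smul, L.J_sq, L.J_ij hc, L.J_ji hc, L.J_ij hc.rot.rot,
      L.J_ji hc.rot.rot] at h1
    linear_combination (norm := module) (-1 : A) • h1
  have h2 := L.eq_zero_of_smul hn hX
  linear_combination ep A s * two_cancel (x := ep A s * m s s) (by linear_combination h2)
    - m s s * ep_mul_self (A := A) s

/-- A derivation `J_s ↦ ∑ₜ m_st J_t` of the paraquaternions is skew-symmetric: cyclic pairs. -/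
lemma skew_of_derivation (L : PQModule n A H) (hn : 1 ≤ n) (m : Fin 3 → Fin 3 → A)
    (B : H → H) (hadd : ∀ X Y, B (X + Y) = B X + B Y) 
    (hB : ∀ s X, B (L.J s X) = L.J s (B X) + ∑ t, m s t • L.J t X) {i j k : Fin 3}
    (hc : Cyc i j k) : ep A j * m i j + ep A i * m j i = 0 := by
  have hX : ∀ X : H, (2 * (ep A j * m i j + ep A i * m j i)) • X = 0 := by
    intro X
    have h0 : B 0 = 0 := by simpa using hadd 0 0
    -- The same idea applied to the relation J_iJ_j + J_jJ_i = 0.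
    have h1 := hB i (L.J j X)
    have h2 := hB j (L.J i X)
    have h3 : B (L.J i (L.J j X)) + B (L.J j (L.J i X)) = 0 := by
      rw [← hadd, L.J_ij hc, L.J_ji hc, neg_smul, neg_add_cancel, h0]
    rw [h1, h2, hB, hB] at h3
    simp only [hc.sum, map_add, map_smul, L.J_sq, L.J_ij hc, L.J_ji hc, L.J_ij hc.rot.rot,
      L.J_ji hc.rot.rot, L.J_ij hc.rot, L.J_ji hc.rot] at h3
    linear_combination (norm := module) (1 : A) • h3
  exact two_cancel (L.eq_zero_of_smul hn hX)

lemma nh_ep_smul (v : V) (s : Fin 3) (X : H) : G.nh v (ep A s • X) = ep A s • G.nh v X := by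
  rw [nh_smul, D_ep, zero_smul, add_zero]

lemma cf_diag (hn : 1 ≤ n) (s : Fin 3) (v : V) : G.cf s s v = 0 :=
  diag_of_derivation G.toPQModule hn (fun s t => G.cf s t v) (G.nh v) (fun s => G.nh_ep_smul v s)
    (G.nh_J v) s

lemma cf_skew (hn : 1 ≤ n) {i j k : Fin 3} (hc : Cyc i j k) (v : V) :
    ep A j * G.cf i j v + ep A i * G.cf j i v = 0 :=
  skew_of_derivation G.toPQModule hn (fun s t => G.cf s t v) (G.nh v) (G.nh_add v) (G.nh_J v) hc

/-! ### The curvature on `H` and on the Reeb vector fields -/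

/-- The curvature as an endomorphism of `H`. -/
def RH (u v : V) : H →ₗ[A] H := G.hor ∘ₗ G.curv u v ∘ₗ G.inc

lemma RH_apply (u v : V) (X : H) : G.RH u v X = G.hor (G.curv u v (G.inc X)) := rfl

lemma RH_eq (u v : V) (X : H) :
    G.RH u v X = G.nh u (G.nh v X) - G.nh v (G.nh u X) - G.nh (G.lie u v) X := by
  rw [RH_apply, curv_apply]
  simp only [map_sub, hor_nb, G.hor_inc]

lemma RH_swap (u v : V) (X : H) : G.RH u v X = -G.RH v u X := by
  rw [RH_apply, curv_swap, map_neg]; rfl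

lemma eta_curv_inc (s : Fin 3) (u v : V) (X : H) : G.eta s (G.curv u v (G.inc X)) = 0 := by
  rw [curv_apply]
  simp only [map_sub, ← inc_nh, G.eta_inc, sub_zero]

lemma hor_curv_xi (s : Fin 3) (u v : V) : G.hor (G.curv u v (G.xi s)) = 0 := by
  rw [curv_apply]
  simp only [map_sub, hor_nb, G.hor_xi]
  simp [nh, G.nb_zero]

/-- The curvature forms of the Reeb vector fields. -/
def kap (s t : Fin 3) (u v : V) : A := G.eta t (G.curv u v (G.xi s))

lemma kap_eq (s t : Fin 3) (u v : V) : G.kap s t u v =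
    G.D u (G.cf s t v) - G.D v (G.cf s t u) - G.cf s t (G.lie u v)
      + ∑ r, G.cf s r v * G.cf r t u - ∑ r, G.cf s r u * G.cf r t v := by
  rw [kap, curv_apply]
  have h : ∀ v r, G.eta r (G.nb v (G.xi s)) = G.cf s r v := fun _ _ => rfl
  rw [map_sub, map_sub, eta_nb G u (G.nb v (G.xi s)), eta_nb G v (G.nb u (G.xi s))]
  simp only [h]
  ring

lemma curv_xi (s : Fin 3) (u v : V) : G.curv u v (G.xi s) = ∑ t, G.kap s t u v • G.xi t :=
  G.decomp_of_hor (G.hor_curv_xi s u v)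

lemma nh_sum {ι : Type*} (v : V) (s : Finset ι) (f : ι → H) :
    G.nh v (∑ a ∈ s, f a) = ∑ a ∈ s, G.nh v (f a) := by
  simp [nh, G.nb_sum]

/-- The identification of ξ_s with I_s is parallel, so taking second covariant derivatives shows
that the curvature rotates the I_s by the very forms that rotate the ξ_s. -/
lemma RH_J (u v : V) (s : Fin 3) (X : H) :
    G.RH u v (G.J s X) = G.J s (G.RH u v X) + ∑ t, G.kap s t u v • G.J t X := by
  simp only [RH_eq, nh_J, nh_add, nh_sum, nh_smul, map_sub, kap_eq, add_smul, sub_smul,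
    Finset.sum_smul, smul_add, Finset.smul_sum, Finset.sum_add_distrib, Finset.sum_sub_distrib,
    smul_smul]
  rw [Finset.sum_comm (f := fun t r => (G.cf s r v * G.cf r t u) • G.J t X),
    Finset.sum_comm (f := fun t r => (G.cf s r u * G.cf r t v) • G.J t X)]
  abel

lemma g_RH (u v : V) (X Y : H) : G.g (G.RH u v X) Y = -G.g X (G.RH u v Y) := by
  have h := G.D_lie u v (G.g X Y)
  simp only [D_g, G.D_add] at h
  simp only [RH_eq, map_sub, LinearMap.sub_apply]
  linear_combination -h

lemma kap_diag (hn : 1 ≤ n) (s : Fin 3) (u v : V) : G.kap s s u v = 0 :=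
  diag_of_derivation G.toPQModule hn (fun s t => G.kap s t u v) (G.RH u v)
    (fun _ _ => map_smul _ _ _) (G.RH_J u v) s

lemma kap_skew (hn : 1 ≤ n) {i j k : Fin 3} (hc : Cyc i j k) (u v : V) :
    ep A j * G.kap i j u v + ep A i * G.kap j i u v = 0 :=
  skew_of_derivation G.toPQModule hn (fun s t => G.kap s t u v) (G.RH u v) (map_add _)
    (G.RH_J u v) hc

/-- The Ricci 2-forms. -/
def rho (s : Fin 3) (u v : V) : A :=
  algebraMap ℝ A (1 / (4 * n)) * G.tr (fun Y Z => G.g (G.RH u v Y) (G.J s Z))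

lemma four_n_rho (hn : 1 ≤ n) (s : Fin 3) (u v : V) :
    4 * n * G.rho s u v = G.tr (fun Y Z => G.g (G.RH u v Y) (G.J s Z)) := by
  have h : (4 * n : A) * algebraMap ℝ A (1 / (4 * n)) = 1 := by
    have h1 : (4 * n : A) = algebraMap ℝ A (4 * n) := by
      rw [map_mul, map_natCast, map_ofNat]
    have : (n : ℝ) ≠ 0 := by exact_mod_cast (by omega : n ≠ 0)
    rw [h1, ← map_mul, ← map_one (algebraMap ℝ A)]
    congr 1
    field_simp
  rw [rho, ← mul_assoc, h, one_mul]

lemma four_n_cancel (hn : 1 ≤ n) {x : A} (h : 4 * (n : A) * x = 0) : x = 0 :=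
  natCast_cancel (m := 4 * n) (by omega) (by push_cast; exact h)

/-- The commutator of the curvature with J_i is traced against J_j. The metric term contributes 4n
κ_ij, the κ_ik term has zero trace, and the two remaining traces involve J_jJ_i and J_iJ_j; these
are opposite multiples of J_k, so they add up to a multiple of ρ_k. -/
lemma kap_ij (hn : 1 ≤ n) {i j k : Fin 3} (hc : Cyc i j k) (u v : V) :
    G.kap i j u v = -2 * ep A i * G.rho k u v := by
  have hbil : ∀ s, IsBil (fun Y Z => G.g (G.RH u v Y) (G.J s Z)) := fun s =>
    ⟨fun Y => ⟨fun _ _ => by simp, fun _ _ => by simp⟩,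
      fun Y => ⟨fun _ _ => by simp, fun _ _ => by simp⟩⟩
  have h1 : ∀ X, G.g (G.RH u v (G.J i X)) (G.J j X)
      = G.g (G.J i (G.RH u v X)) (G.J j X) + G.kap i j u v * G.g (G.J j X) (G.J j X)
        + G.kap i k u v * G.g (G.J k X) (G.J j X) := by
    intro X
    rw [RH_J, hc.sum, kap_diag G hn]
    simp
    ring
  have h2 : G.tr (fun Y Z => G.g (G.RH u v (G.J i Y)) (G.J j Z))
      = G.tr (fun Y Z => G.g (G.J i (G.RH u v Y)) (G.J j Z)
        + G.kap i j u v * G.g (G.J j Y) (G.J j Z) + G.kap i k u v * G.g (G.J k Y) (G.J j Z)) := by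
    simp only [PQModule.tr, h1]
  rw [G.tr_J _ (hbil j) i, G.tr_add, G.tr_add, G.tr_mul, G.tr_mul] at h2
  simp only [G.g_J, G.J_ij hc, G.J_ji hc, G.J_sq, map_smul, smul_eq_mul, G.tr_neg, G.tr_mul,
    G.J_ji hc.rot, neg_mul] at h2
  have h3 : G.tr (fun Y Z => G.g Y (G.J i Z)) = 0 := by
    rw [← G.tr_swap]
    simpa only [G.g_symm] using G.tr_omega i
  rw [G.tr_metric, h3, ← four_n_rho G hn] at h2
  have h4 := four_n_cancel hn (x := G.kap i j u v + 2 * ep A i * G.rho k u v) (by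
    rcases hc.ep_cases (A := A) with ⟨e1, e2, e3⟩ | ⟨e1, e2, e3⟩ | ⟨e1, e2, e3⟩ <;>
      simp only [e1, e2, e3] at h2 ⊢ <;> first | linear_combination h2 | linear_combination -h2)
  linear_combination h4

lemma kap_ik (hn : 1 ≤ n) {i j k : Fin 3} (hc : Cyc i j k) (u v : V) :
    G.kap i k u v = 2 * ep A i * G.rho j u v := by
  have h := G.kap_skew hn hc.rot.rot u v
  rw [G.kap_ij hn hc.rot.rot] at h
  linear_combination ep A k * h + (2 * ep A i * G.rho j u v - G.kap i k u v) * ep_mul_self (A := A) k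

lemma rho_swap (s : Fin 3) (u v : V) : G.rho s u v = -G.rho s v u := by
  simp only [rho, G.RH_swap u v, map_neg, LinearMap.neg_apply, G.tr_neg]; ring

end Geo

lemma fin_three_cases (s t : Fin 3) : t = s ∨ (∃ k, Cyc s t k) ∨ ∃ k, Cyc t s k := by
  fin_cases s <;> fin_cases t <;> simp [Cyc]

lemma Cyc.of_ne {s t : Fin 3} (h : s ≠ t) : (∃ k, Cyc s t k) ∨ ∃ k, Cyc t s k :=
  (fin_three_cases s t).resolve_left (Ne.symm h)

lemma Cyc.ne {i j k : Fin 3} (h : Cyc i j k) : i ≠ j ∧ i ≠ k ∧ j ≠ k := by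
  obtain ⟨rfl, rfl⟩ := h
  fin_cases i <;> decide

namespace Geo

variable {n : ℕ} {A V H : Type*} [CommRing A] [Algebra ℝ A] [AddCommGroup V] [Module A V]
  [AddCommGroup H] [Module A H] (G : Geo n A V H)

/-! ### The torsion on `H` -/

lemma cf_skew' (hn : 1 ≤ n) (s t : Fin 3) (v : V) :
    ep A t * G.cf s t v + ep A s * G.cf t s v = 0 := by
  rcases fin_three_cases s t with rfl | ⟨k, hc⟩ | ⟨k, hc⟩
  · rw [G.cf_diag hn]; ring
  · exact G.cf_skew hn hc v
  · linear_combination G.cf_skew hn hc v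

lemma eta_tor_inc (s : Fin 3) (X Y : H) :
    G.eta s (G.tor (G.inc X) (G.inc Y)) = -2 * ep A s * G.g (G.J s X) Y := by
  rw [tor_apply, map_sub, map_sub, G.eta_nb_inc, G.eta_nb_inc, G.contact]; ring

lemma hor_tor_inc (X Y : H) : G.hor (G.tor (G.inc X) (G.inc Y)) = 0 := G.hor_tor X Y

lemma tor_inc (X Y : H) :
    G.tor (G.inc X) (G.inc Y) = ∑ s, (-2 * ep A s * G.g (G.J s X) Y) • G.xi s := by
  rw [G.decomp_of_hor (G.hor_tor_inc X Y)]
  simp only [eta_tor_inc]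

/-- On H the torsion is the invariant contraction -2 ∑ ε_s ω_s ⊗ ξ_s. As g is parallel and I_s, ξ_s
turn by the same connection forms, skew with respect to the ε_s, the sum is parallel. -/
lemma nbTor_inc (hn : 1 ≤ n) (u : V) (X Y : H) : G.nbTor u (G.inc X) (G.inc Y) = 0 := by
  apply G.ext_V
  · rw [nbTor, ← inc_nh, ← inc_nh]
    simp only [map_sub, hor_nb, hor_tor_inc, map_zero, sub_zero]
    simp [nh, G.nb_zero]
  · intro s
    rw [nbTor, ← inc_nh, ← inc_nh]
    simp only [map_sub, eta_nb, eta_tor_inc, map_zero]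
    have h1 : ∀ f, -2 * ep A s * f = algebraMap ℝ A (-2 * eps s) * f := fun f => by
      rw [map_mul, map_neg, map_ofNat]; rfl
    rw [h1, D_const_mul, ← h1, D_g, nh_J]
    simp only [map_add, map_sum, map_smul, LinearMap.add_apply, LinearMap.sum_apply,
      LinearMap.smul_apply, smul_eq_mul]
    have h2 : ∑ t, -2 * ep A t * G.g (G.J t X) Y * G.cf t s u
        = 2 * ep A s * ∑ t, G.cf s t u * G.g (G.J t X) Y := by
      rw [Finset.mul_sum]
      refine Finset.sum_congr rfl fun t _ => ?_
      linear_combination (-2 * G.g (G.J t X) Y * ep A s * ep A t) * G.cf_skew' hn s t u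
        + 2 * G.g (G.J t X) Y * ep A s * G.cf s t u * ep_mul_self (A := A) t
        + 2 * G.g (G.J t X) Y * ep A t * G.cf t s u * ep_mul_self (A := A) s
    rw [h2]
    ring

/-- The vertical part of `T(ξ_t, Z)` for horizontal `Z`. -/
def gam (t s : Fin 3) (Z : H) : A := G.eta s (G.tor (G.xi t) (G.inc Z))

lemma gam_eq (t s : Fin 3) (Z : H) :
    G.gam t s Z = -G.cf t s (G.inc Z) - G.eta s (G.lie (G.xi t) (G.inc Z)) := by
  rw [gam, tor_apply, map_sub, map_sub, G.eta_nb_inc]; simp [cf]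

lemma gam_diag (hn : 1 ≤ n) (s : Fin 3) (Z : H) : G.gam s s Z = 0 := by
  rw [gam_eq, G.cf_diag hn, G.reeb]; ring

lemma gam_lin (t s : Fin 3) : IsLin (G.gam t s) :=
  ⟨fun X Y => by simp [gam], fun f X => by simp [gam]⟩

lemma gam_smul (t s : Fin 3) (f : A) (X : H) : G.gam t s (f • X) = f * G.gam t s X :=
  (G.gam_lin t s).smul f X

/-- This is the vertical part of the Bianchi identity on H: the curvature preserves H and the
torsion on H is parallel, so only the terms T(T(X, Y), Z) survive. -/
lemma gam_cyclic (hn : 1 ≤ n) (s : Fin 3) (X Y Z : H) :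
    ∑ t, ep A t * (G.g (G.J t X) Y * G.gam t s Z + G.g (G.J t Y) Z * G.gam t s X
      + G.g (G.J t Z) X * G.gam t s Y) = 0 := by
  have h := congrArg (G.eta s) (G.bianchi (G.inc X) (G.inc Y) (G.inc Z))
  have h1 : ∀ X Y Z, G.eta s (G.tor (G.tor (G.inc X) (G.inc Y)) (G.inc Z))
      = -2 * ∑ t, ep A t * (G.g (G.J t X) Y * G.gam t s Z) := by
    intro X Y Z
    rw [tor_inc]
    simp only [map_sum, map_smul, LinearMap.sum_apply, LinearMap.smul_apply, smul_eq_mul,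
      Finset.mul_sum, gam]
    exact Finset.sum_congr rfl fun t _ => by ring
  simp only [map_add, eta_curv_inc, nbTor_inc G hn, map_zero, h1] at h
  have h2 : 2 * (∑ t, ep A t * (G.g (G.J t X) Y * G.gam t s Z + G.g (G.J t Y) Z * G.gam t s X
      + G.g (G.J t Z) X * G.gam t s Y)) = 0 := by
    simp only [mul_add, Finset.sum_add_distrib] at h ⊢
    linear_combination h
  exact two_cancel h2

/-- Contraction of the cyclic identity. -/
lemma gam_contract (hn : 1 ≤ n) {s t u : Fin 3} (hst : s ≠ t) (hsu : s ≠ u) (htu : t ≠ u)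
    (Z : H) : (2 * n - 1) * G.gam t s Z = ep A u * G.gam u s (G.J t (G.J u Z)) := by
  have hsum : ∀ f : Fin 3 → A, ∑ r, f r = f s + f t + f u := by
    intro f
    have : (Finset.univ : Finset (Fin 3)) = {s, t, u} := by
      revert hst hsu htu; revert s t u; decide
    rw [this, Finset.sum_insert (by simp [hst, hsu]), Finset.sum_insert (by simp [htu]),
      Finset.sum_singleton, add_assoc]
  -- The substitution Y = J_t X followed by a trace turns ω_t(X, Y) into a multiple of the dimension
  -- 4n and kills ω_u(X, Y). The index s is absent because γ_ss = 0.
  have h1 : G.tr (fun X Y => ep A t * (G.g (G.J t X) (G.J t Y) * G.gam t s Z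
      + G.g (G.J t (G.J t Y)) Z * G.gam t s X + G.g (G.J t Z) X * G.gam t s (G.J t Y))
      + ep A u * (G.g (G.J u X) (G.J t Y) * G.gam u s Z
      + G.g (G.J u (G.J t Y)) Z * G.gam u s X + G.g (G.J u Z) X * G.gam u s (G.J t Y))) = 0 := by
    simp only [PQModule.tr]
    refine Finset.sum_eq_zero fun a _ => ?_
    have h := G.gam_cyclic hn s (G.e a) (G.J t (G.e a)) Z
    rw [hsum] at h
    simp only [G.gam_diag hn s, mul_zero, add_zero, zero_add] at h
    rw [h, mul_zero]
  have hlin : ∀ s t r, IsLin (fun X => G.gam s t (G.J r X)) := fun s t r =>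
    ⟨fun X Y => by simp [(G.gam_lin _ _).add], fun f X => by simp [gam_smul]⟩
  have e3 : G.tr (fun X Y => G.g (G.J u X) (G.J t Y)) = 0 := by
    have h0 : ∀ r : Fin 3, G.tr (fun Y Z => G.g Y (G.J r Z)) = 0 := fun r => by
      rw [← G.tr_swap]; simpa only [G.g_symm] using G.tr_omega r
    rcases Cyc.of_ne htu with ⟨k, hc⟩ | ⟨k, hc⟩
    · simp only [G.g_J, G.J_ji hc, map_smul, smul_eq_mul, G.tr_neg, G.tr_mul, h0]; ring
    · simp only [G.g_J, G.J_ij hc, map_smul, smul_eq_mul, G.tr_neg, G.tr_mul, h0]; ring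
  have e1 : G.tr (fun X Y => G.g Y Z * G.gam t s X) = G.gam t s Z := G.tr_g' _ (G.gam_lin t s) Z
  have e4 : G.tr (fun X Y => G.g (G.J u (G.J t Y)) Z * G.gam u s X)
      = G.gam u s (G.J t (G.J u Z)) := by
    simp only [G.g_J, neg_neg]
    exact G.tr_g' _ (G.gam_lin u s) _
  have e5 : G.tr (fun X Y => G.g (G.J u Z) X * G.gam u s (G.J t Y))
      = G.gam u s (G.J t (G.J u Z)) := G.tr_g _ (hlin u s t) _
  have e2 : G.tr (fun X Y => G.g (G.J t Z) X * G.gam t s (G.J t Y)) = ep A t * G.gam t s Z := by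
    rw [G.tr_g _ (hlin t s t), G.J_sq, gam_smul]
  rw [G.tr_add, G.tr_mul, G.tr_mul, G.tr_add, G.tr_add, G.tr_add, G.tr_add, e2, e4, e5,
    G.tr_mul', G.tr_mul', e3] at h1
  simp only [G.J_sq, G.g_J_J, map_smul, LinearMap.smul_apply, smul_eq_mul, mul_assoc, G.tr_mul,
    e1, G.tr_metric] at h1
  have h2 := two_cancel (x := (2 * n - 1) * G.gam t s Z - ep A u * G.gam u s (G.J t (G.J u Z))) (by
    linear_combination -h1 + (2 - 4 * n) * G.gam t s Z * ep_mul_self (A := A) t)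
  linear_combination h2

/-- Two applications of `gam_contract` multiply γ_ts by (2n-1)² = 1 + 4n(n-1), which finishes the
case n ≥ 2. For n = 1 the factor is one and the contraction alone is inconclusive; the extra
requirement on the Reeb fields relates γ_ji to γ_ij and closes the argument. -/
lemma gam_cyc (hn : 1 ≤ n) {i j k : Fin 3} (hc : Cyc i j k) (Z : H) :
    G.gam i j Z = 0 ∧ G.gam j i Z = 0 := by
  rcases Nat.lt_or_ge 1 n with h2 | h1
  · have key : ∀ {s t u : Fin 3}, s ≠ t → s ≠ u → t ≠ u → G.gam t s Z = 0 := by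
      intro s t u hst hsu htu
      have h3 := G.gam_contract hn hst hsu htu Z
      have h4 := G.gam_contract hn hsu hst htu.symm (G.J t (G.J u Z))
      have h5 : G.J u (G.J t (G.J t (G.J u Z))) = (ep A t * ep A u) • Z := by
        rw [G.J_sq, map_smul, G.J_sq, smul_smul]
      rw [h5, gam_smul] at h4
      refine natCast_cancel (m := 4 * n * (n - 1)) (by positivity [Nat.sub_pos_of_lt h2]) ?_
      push_cast [hn]
      linear_combination (2 * (n : A) - 1) * h3 + ep A u * h4
        + G.gam t s Z * ep_mul_self (A := A) t
        + ep A t * ep A t * G.gam t s Z * ep_mul_self (A := A) u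
    exact ⟨key hc.ne.1.symm hc.rot.ne.1 hc.ne.2.1, key hc.ne.1 hc.ne.2.1 hc.rot.ne.1⟩
  · obtain rfl : n = 1 := le_antisymm h1 hn
    have hlie : ∀ {i j k : Fin 3}, Cyc i j k → ∀ Z, G.gam j i Z = ep A k * G.gam i j Z := by
      intro i j k hc Z
      have h2 := G.cf_skew hn hc (G.inc Z)
      have h3 := G.dim_seven rfl i Z
      rw [← hc.1, ← hc.2] at h3
      rw [gam_eq, gam_eq, h3]
      rcases hc.ep_cases (A := A) with ⟨e1, e2, e3⟩ | ⟨e1, e2, e3⟩ | ⟨e1, e2, e3⟩ <;>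
        simp only [e1, e2, e3] at h2 ⊢ <;> first | linear_combination h2 | linear_combination -h2
    have hJ : ∀ {s t u : Fin 3}, s ≠ t → s ≠ u → t ≠ u → ∀ Z,
        G.gam t s Z = ep A u * G.gam u s (G.J t (G.J u Z)) := by
      intro s t u hst hsu htu Z
      have := G.gam_contract hn hst hsu htu Z
      push_cast at this
      linear_combination this
    have n1 := hc.ne
    have c1 := hJ n1.1 n1.2.1 n1.2.2 Z
    -- Alternating the contraction with the exchange of the two indices leads once around all six
    -- pairs and returns to γ_ji(Z) with the opposite sign.
    have h0 : G.gam j i Z = 0 := by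
      have s1 := hlie hc
      have s2 := hlie hc.rot
      have s3 := hlie hc.rot.rot
      have c2 := hJ n1.2.2 n1.1.symm n1.2.1.symm
      have c3 := hJ n1.2.1.symm n1.2.2.symm n1.1
      simp only [G.J_ij hc, G.J_ij hc.rot, G.J_ij hc.rot.rot, gam_smul] at c1 c2 c3
      have c3' := c3 (G.J i Z)
      have s3' := s3 (G.J i Z)
      rw [G.J_ij hc.rot.rot, gam_smul] at c3'
      have s2' := s2 (G.J j Z)
      have c2' := c2 (G.J j Z)
      rw [G.J_sq, gam_smul] at c2'
      have s1' := s1 Z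
      rcases hc.ep_cases (A := A) with ⟨e1, e2, e3⟩ | ⟨e1, e2, e3⟩ | ⟨e1, e2, e3⟩ <;>
        simp only [e1, e2, e3] at * <;> refine two_cancel ?_ <;> grind
    refine ⟨?_, h0⟩
    have := hlie hc Z
    rw [h0] at this
    linear_combination (-ep A k) * this - G.gam i j Z * ep_mul_self (A := A) k

lemma eta_tor_xi_inc (hn : 1 ≤ n) (s t : Fin 3) (Z : H) :
    G.eta t (G.tor (G.xi s) (G.inc Z)) = 0 := by
  rcases fin_three_cases s t with rfl | ⟨k, hc⟩ | ⟨k, hc⟩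
  · exact G.gam_diag hn _ Z
  · exact (G.gam_cyc hn hc Z).1
  · exact (G.gam_cyc hn hc Z).2

/-- The torsion endomorphism `T(ξ_s, ·)` of `H`. -/
def tt (s : Fin 3) : H →ₗ[A] H := G.hor ∘ₗ G.tor (G.xi s) ∘ₗ G.inc

/-- The torsion endomorphism as a bilinear form. -/
def TT (s : Fin 3) (X Y : H) : A := G.g (G.tt s X) Y

lemma tor_xi_inc (hn : 1 ≤ n) (s : Fin 3) (X : H) :
    G.tor (G.xi s) (G.inc X) = G.inc (G.tt s X) :=
  G.decomp_of_eta fun t => G.eta_tor_xi_inc hn s t X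

end Geo

namespace Geo

variable {n : ℕ} {A V H : Type*} [CommRing A] [Algebra ℝ A] [AddCommGroup V] [Module A V]
  [AddCommGroup H] [Module A H] (G : Geo n A V H)

/-! ### Vertical part of the Bianchi identity for one Reeb and two horizontal fields -/

lemma eta_tor_inc_xi (hn : 1 ≤ n) (s t : Fin 3) (Z : H) :
    G.eta t (G.tor (G.inc Z) (G.xi s)) = 0 := by
  rw [tor_swap, map_neg, G.eta_tor_xi_inc hn, neg_zero]

lemma eta_nbTor_inc_xi (hn : 1 ≤ n) (m s : Fin 3) (u : V) (X : H) :
    G.eta m (G.nbTor u (G.inc X) (G.xi s)) = 0 := by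
  rw [nbTor, G.tor_swap (G.inc X) (G.xi s), G.tor_xi_inc hn, nb_neg, ← inc_nh, ← inc_nh, G.nb_xi u s]
  simp [G.eta_inc, G.eta_tor_inc_xi hn]

lemma eta_nbTor_xi_inc (hn : 1 ≤ n) (m s : Fin 3) (u : V) (X : H) :
    G.eta m (G.nbTor u (G.xi s) (G.inc X)) = 0 := by
  rw [nbTor_swap, map_neg, G.eta_nbTor_inc_xi hn, neg_zero]

/-- The components of the vertical part of `T(ξ_s, ξ_t)`. -/
def cc (s t m : Fin 3) : A := G.eta m (G.tor (G.xi s) (G.xi t))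

lemma cc_swap (s t m : Fin 3) : G.cc s t m = -G.cc t s m := by
  rw [cc, tor_swap, map_neg]; rfl

lemma cc_self (s m : Fin 3) : G.cc s s m = 0 := by
  rw [cc, tor_self, map_zero]

/-- The vertical part of the Bianchi identity for X, Y, ξ_i. The covariant derivatives of the
torsion have no vertical part here, because T(ξ_i, ·) maps H to H and torsion is parallel on H; only
quadratic torsion terms remain. -/
lemma kap_inc (hn : 1 ≤ n) (i m : Fin 3) (X Y : H) :
    G.kap i m (G.inc X) (G.inc Y) = 2 * ep A m * (G.TT i X (G.J m Y) - G.TT i Y (G.J m X))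
      - 2 * ∑ s, ep A s * (G.g (G.J s X) Y * G.cc s i m) := by
  have h := congrArg (G.eta m) (G.bianchi (G.inc X) (G.inc Y) (G.xi i))
  rw [G.tor_swap (G.inc Y) (G.xi i), G.tor_xi_inc hn, G.tor_xi_inc hn, ← map_neg G.inc] at h
  simp only [map_add, eta_curv_inc, G.eta_nbTor_inc_xi hn, G.eta_nbTor_xi_inc hn, G.nbTor_inc hn,
    eta_tor_inc, map_zero] at h
  rw [tor_inc] at h
  simp only [map_sum, map_smul, LinearMap.sum_apply, LinearMap.smul_apply, smul_eq_mul, map_neg,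
    LinearMap.neg_apply, G.g_J m (G.tt i X), G.g_J m (G.tt i Y)] at h
  have e : ∑ s, -2 * ep A s * G.g (G.J s X) Y * G.eta m (G.tor (G.xi s) (G.xi i))
      = -2 * ∑ s, ep A s * (G.g (G.J s X) Y * G.cc s i m) := by
    rw [Finset.mul_sum]
    exact Finset.sum_congr rfl fun s _ => by rw [cc]; ring
  rw [e] at h
  have e2 : G.eta m (G.curv (G.inc X) (G.inc Y) (G.xi i)) = G.kap i m (G.inc X) (G.inc Y) := rfl
  rw [e2] at h
  simp only [TT]
  linear_combination h

lemma TT_bil_right (s v : Fin 3) : IsBil (fun Y Z => G.TT s Y (G.J v Z)) :=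
  ⟨fun Y => ⟨fun _ _ => by simp [TT], fun _ _ => by simp [TT]⟩,
    fun Y => ⟨fun _ _ => by simp [TT], fun _ _ => by simp [TT]⟩⟩

lemma TT_bil' (s : Fin 3) : IsBil (G.TT s) :=
  ⟨fun Y => ⟨fun _ _ => by simp [TT], fun _ _ => by simp [TT]⟩,
    fun Y => ⟨fun _ _ => by simp [TT], fun _ _ => by simp [TT]⟩⟩

lemma tr_TT_J (s u : Fin 3) : G.tr (fun Y Z => G.TT s Y (G.J u Z)) = 0 := G.tor_J s u

lemma TT_add_left (s : Fin 3) (X Y Z : H) : G.TT s (X + Y) Z = G.TT s X Z + G.TT s Y Z := by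
  simp [TT]
lemma TT_add_right (s : Fin 3) (X Y Z : H) : G.TT s X (Y + Z) = G.TT s X Y + G.TT s X Z := by
  simp [TT]
lemma TT_smul_left (s : Fin 3) (f : A) (X Y : H) : G.TT s (f • X) Y = f * G.TT s X Y := by
  simp [TT]
lemma TT_smul_right (s : Fin 3) (f : A) (X Y : H) : G.TT s X (f • Y) = f * G.TT s X Y := by
  simp [TT]

/-- `J_u J_v` is a multiple of some `J_r` for `u ≠ v`. -/
lemma exists_J_J (L : PQModule n A H) {u v : Fin 3} (h : u ≠ v) :
    ∃ (r : Fin 3) (c : A), ∀ X, L.J u (L.J v X) = c • L.J r X := by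
  rcases Cyc.of_ne h with ⟨k, hc⟩ | ⟨k, hc⟩
  · exact ⟨k, _, L.J_ij hc⟩
  · exact ⟨k, _, L.J_ji hc⟩

/-- A product of two different J's is a multiple of the third, so orthogonality of T(ξ_s, ·) to `PQ`
applies. -/
lemma tr_TT_J_J (s : Fin 3) {u v : Fin 3} (h : u ≠ v) :
    G.tr (fun Y Z => G.TT s Y (G.J u (G.J v Z))) = 0 ∧
      G.tr (fun Y Z => G.TT s (G.J v Z) (G.J u Y)) = 0 := by
  obtain ⟨r, c, hr⟩ := exists_J_J G.toPQModule h
  have h1 : G.tr (fun Y Z => G.TT s Y (G.J u (G.J v Z))) = 0 := by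
    simp only [hr, TT_smul_right, G.tr_mul, tr_TT_J, mul_zero]
  refine ⟨h1, ?_⟩
  rw [← G.tr_swap]
  have h2 := G.tr_J _ (G.TT_bil_right s u) v
  rw [h1, neg_zero] at h2
  exact h2

lemma tr_omega_J (s u : Fin 3) :
    G.tr (fun Y Z => G.g (G.J s Y) (G.J u Z)) = if s = u then -ep A u * (4 * n) else 0 := by
  split_ifs with h
  · subst h
    simp only [G.g_J_J, G.tr_mul, G.tr_metric]
  · obtain ⟨r, c, hr⟩ := exists_J_J G.toPQModule h
    simp only [G.g_J s, hr, map_smul, smul_eq_mul, G.tr_neg, G.tr_mul]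
    have : G.tr (fun Y Z => G.g Y (G.J r Z)) = 0 := by
      rw [← G.tr_swap]; simpa only [G.g_symm] using G.tr_omega r
    rw [this]; ring

/-- For m ≠ u the torsion endomorphisms are invisible to this trace, and of the three forms only ω_u
survives; the trace isolates a single component of T(ξ_u, ξ_i). -/
lemma tr_kap_inc (hn : 1 ≤ n) {i m u : Fin 3} (hmu : m ≠ u) :
    G.tr (fun X Y => G.kap i m (G.inc X) (G.inc (G.J u Y))) = 8 * n * G.cc u i m := by
  simp only [G.kap_inc hn, G.tr_sub, G.tr_mul, (G.tr_TT_J_J i hmu).1, (G.tr_TT_J_J i hmu).2]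
  have : G.tr (fun X Y => ∑ s, ep A s * (G.g (G.J s X) (G.J u Y) * G.cc s i m))
      = -4 * n * G.cc u i m := by
    have hc := Cyc.mk' u
    simp only [hc.sum, G.tr_add, G.tr_mul, G.tr_mul', tr_omega_J, if_true, if_neg hc.ne.1.symm,
      if_neg hc.ne.2.1.symm]
    linear_combination (-4 * n * G.cc u i m) * ep_mul_self (A := A) u
  rw [this]; ring

lemma cc_right (hn : 1 ≤ n) {u i : Fin 3} (h : i ≠ u) : G.cc u i i = 0 := by
  have h1 := G.tr_kap_inc hn (i := i) h
  simp only [G.kap_diag hn] at h1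
  have h2 : G.tr (fun _ _ : H => (0 : A)) = 0 := by simp [PQModule.tr]
  rw [h2] at h1
  exact natCast_cancel (m := 8 * n) (by omega) (by push_cast; exact h1.symm)

/-- The vanishing of κ_ii is used a second time, now that the components of T(ξ_s, ξ_i) along ξ_i
are known to be zero. -/
lemma TT_J_self (hn : 1 ≤ n) (i : Fin 3) (X Y : H) : G.TT i X (G.J i Y) = G.TT i Y (G.J i X) := by
  have h := G.kap_inc hn i i X Y
  have hc := Cyc.mk' i
  rw [G.kap_diag hn, hc.sum, G.cc_self, G.cc_right hn hc.ne.1, G.cc_right hn hc.ne.2.1] at h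
  have h2 := two_cancel (x := ep A i * (G.TT i X (G.J i Y) - G.TT i Y (G.J i X))) (by
    linear_combination -h)
  linear_combination ep A i * h2
    - (G.TT i X (G.J i Y) - G.TT i Y (G.J i X)) * ep_mul_self (A := A) i

lemma kap_inc_ij (hn : 1 ≤ n) {i j k : Fin 3} (hc : Cyc i j k) (X Y : H) :
    G.kap i j (G.inc X) (G.inc Y) = 2 * ep A j * (G.TT i X (G.J j Y) - G.TT i Y (G.J j X))
      - 2 * ep A k * (G.g (G.J k X) Y * G.cc k i j) := by
  rw [G.kap_inc hn, hc.sum, cc_self, G.cc_swap j i, G.cc_right hn hc.ne.1.symm]; ring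

lemma kap_inc_ji (hn : 1 ≤ n) {i j k : Fin 3} (hc : Cyc i j k) (X Y : H) :
    G.kap j i (G.inc X) (G.inc Y) = 2 * ep A i * (G.TT j X (G.J i Y) - G.TT j Y (G.J i X))
      + 2 * ep A k * (G.g (G.J k X) Y * G.cc j k i) := by
  rw [G.kap_inc hn, hc.sum, cc_self, G.cc_swap i j, G.cc_right hn hc.ne.1, G.cc_swap k j]; ring

/-- The normalized scalar curvature: `T(ξ_i, ξ_j)_V = ε_k c ξ_k`. -/
def sc : A := ep A 0 * G.cc 1 2 0

lemma cc_cyc_aux (hn : 1 ≤ n) {i j k : Fin 3} (hc : Cyc i j k) :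
    ep A j * G.cc k i j = ep A i * G.cc j k i := by
  have h0 : G.tr (fun X Y => ep A j * G.kap i j (G.inc X) (G.inc (G.J k Y))
      + ep A i * G.kap j i (G.inc X) (G.inc (G.J k Y))) = 0 := by
    simp only [G.kap_skew hn hc, PQModule.tr, mul_zero, Finset.sum_const_zero]
  rw [G.tr_add, G.tr_mul, G.tr_mul, G.tr_kap_inc hn hc.ne.2.2, G.tr_kap_inc hn hc.ne.2.1,
    G.cc_swap k j i] at h0
  have h1 := natCast_cancel (m := 8 * n) (x := ep A j * G.cc k i j - ep A i * G.cc j k i)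
    (by omega) (by push_cast; linear_combination h0)
  linear_combination h1

/-- `cc_cyc_aux` equates the normalized components for neighbouring cyclic triples, so all of them
coincide with the one chosen to define `sc`. -/
lemma cc_cyc (hn : 1 ≤ n) {i j k : Fin 3} (hc : Cyc i j k) : G.cc i j k = ep A k * G.sc := by
  have h0 : ∀ {i j k : Fin 3}, Cyc i j k → ep A k * G.cc i j k = G.sc := by
    intro i j k hc
    have e1 := G.cc_cyc_aux hn (i := 0) (j := 1) (k := 2) ⟨rfl, rfl⟩
    have e2 := G.cc_cyc_aux hn (i := 1) (j := 2) (k := 0) ⟨rfl, rfl⟩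
    obtain ⟨rfl, rfl⟩ := hc
    fin_cases i
    · exact e2.trans e1
    · rfl
    · exact e1
  linear_combination ep A k * h0 hc - G.cc i j k * ep_mul_self (A := A) k

/-- The horizontal Ricci 2-forms in terms of the torsion endomorphism. -/
lemma rho_inc (hn : 1 ≤ n) {i j k : Fin 3} (hc : Cyc i j k) (X Y : H) :
    G.rho k (G.inc X) (G.inc Y) = ep A k * (G.TT i X (G.J j Y) - G.TT i Y (G.J j X))
      - G.sc * G.g (G.J k X) Y := by
  have h1 := G.kap_ij hn hc (G.inc X) (G.inc Y)
  rw [G.kap_inc_ij hn hc, G.cc_cyc hn hc.rot.rot] at h1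
  refine two_inj ?_
  rcases hc.ep_cases (A := A) with ⟨e1, e2, e3⟩ | ⟨e1, e2, e3⟩ | ⟨e1, e2, e3⟩ <;>
    simp only [e1, e2, e3] at h1 ⊢ <;> first | linear_combination h1 | linear_combination -h1

/-- The skew-symmetry of κ in its two indices, from which the scalar parts have cancelled by
`cc_cyc`. -/
lemma TT_cross (hn : 1 ≤ n) {i j k : Fin 3} (hc : Cyc i j k) (X Y : H) :
    G.TT i X (G.J j Y) - G.TT i Y (G.J j X) + (G.TT j X (G.J i Y) - G.TT j Y (G.J i X)) = 0 := by
  have h1 := G.kap_skew hn hc (G.inc X) (G.inc Y)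
  rw [G.kap_inc_ij hn hc, G.kap_inc_ji hn hc, G.cc_cyc hn hc.rot.rot, G.cc_cyc hn hc.rot] at h1
  refine two_cancel ?_
  rcases hc.ep_cases (A := A) with ⟨e1, e2, e3⟩ | ⟨e1, e2, e3⟩ | ⟨e1, e2, e3⟩ <;>
    simp only [e1, e2, e3] at h1 ⊢ <;> linear_combination h1

end Geo

namespace Geo

variable {n : ℕ} {A V H : Type*} [CommRing A] [Algebra ℝ A] [AddCommGroup V] [Module A V]
  [AddCommGroup H] [Module A H] (G : Geo n A V H)

/-! ### The torsion endomorphism in terms of `τ` and `μ` -/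

lemma two_half : 2 * algebraMap ℝ A (1 / 2) = 1 := by
  rw [← map_ofNat (algebraMap ℝ A) 2, ← map_mul]; norm_num

/-- The symmetric part of the torsion endomorphism. -/
def TS (s : Fin 3) (X Y : H) : A := algebraMap ℝ A (1 / 2) * (G.TT s X Y + G.TT s Y X)

/-- The skew-symmetric part of the torsion endomorphism. -/
def TA (s : Fin 3) (X Y : H) : A := algebraMap ℝ A (1 / 2) * (G.TT s X Y - G.TT s Y X)

/-- The tensor `τ`. -/
def tau (X Y : H) : A := -∑ s, ep A s * G.TS s (G.J s X) Y

/-- The tensors `μ_s`. -/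
def muS (s : Fin 3) (X Y : H) : A := ep A s * G.TA s (G.J s X) Y

/-- The tensor `μ`. -/
def mu (X Y : H) : A := G.muS 0 X Y

lemma TT_eq (s : Fin 3) (X Y : H) : G.TT s X Y = G.TS s X Y + G.TA s X Y := by
  rw [TS, TA]; linear_combination (-G.TT s X Y) * two_half (A := A)

lemma TS_symm (s : Fin 3) (X Y : H) : G.TS s X Y = G.TS s Y X := by
  rw [TS, TS, add_comm]

lemma TA_skew (s : Fin 3) (X Y : H) : G.TA s X Y = -G.TA s Y X := by
  rw [TA, TA]; ring

lemma TS_smul_left (s : Fin 3) (f : A) (X Y : H) : G.TS s (f • X) Y = f * G.TS s X Y := by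
  simp only [TS, TT_smul_left, TT_smul_right]; ring
lemma TS_smul_right (s : Fin 3) (f : A) (X Y : H) : G.TS s X (f • Y) = f * G.TS s X Y := by
  simp only [TS, TT_smul_left, TT_smul_right]; ring
lemma TA_smul_left (s : Fin 3) (f : A) (X Y : H) : G.TA s (f • X) Y = f * G.TA s X Y := by
  simp only [TA, TT_smul_left, TT_smul_right]; ring
lemma TA_smul_right (s : Fin 3) (f : A) (X Y : H) : G.TA s X (f • Y) = f * G.TA s X Y := by
  simp only [TA, TT_smul_left, TT_smul_right]; ring

lemma TT_J_self' (hn : 1 ≤ n) (i : Fin 3) (X Y : H) :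
    G.TT i (G.J i X) Y = G.TT i (G.J i Y) X := by
  have h := G.TT_J_self hn i (G.J i X) (G.J i Y)
  rw [G.J_sq, G.J_sq, TT_smul_right, TT_smul_right] at h
  linear_combination ep A i * h
    - (G.TT i (G.J i X) Y - G.TT i (G.J i Y) X) * ep_mul_self (A := A) i

lemma TS_J (hn : 1 ≤ n) (i : Fin 3) (X Y : H) : G.TS i (G.J i X) Y = G.TS i X (G.J i Y) := by
  rw [TS, TS, G.TT_J_self' hn i X Y, G.TT_J_self hn i X Y]; ring

lemma TA_J (hn : 1 ≤ n) (i : Fin 3) (X Y : H) : G.TA i (G.J i X) Y = -G.TA i X (G.J i Y) := by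
  rw [TA, TA, G.TT_J_self' hn i X Y, G.TT_J_self hn i X Y]; ring

/-- The axiom `tor_sp` tests T(ξ_s, ·) against averages of elementary skew endomorphisms over the
paraquaternions. It says that the component of the skew part commuting with `PQ` is zero. -/
lemma TA_average (s : Fin 3) (X Y : H) :
    G.TA s X Y = ∑ u, ep A u * G.TA s (G.J u X) (G.J u Y) := by
  have h1 : ∀ X Y, ∑ a, G.g (G.e a) (G.e a) * (G.g X (G.e a) * G.g (G.tt s (G.e a)) Y)
      = G.TT s X Y := fun X Y =>
    G.tr_g (fun Z => G.g (G.tt s Z) Y) ⟨fun _ _ => by simp, fun _ _ => by simp⟩ X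
  have h2 : ∑ a, G.g (G.e a) (G.e a) * G.g (G.tt s (G.e a)) (G.g X (G.e a) • Y - G.g Y (G.e a) • X
        - ∑ u, ep A u • (G.g (G.J u X) (G.e a) • G.J u Y - G.g (G.J u Y) (G.e a) • G.J u X)) = 0 :=
    G.tor_sp s X Y
  simp only [map_sub, map_sum, map_smul, smul_eq_mul, mul_sub, Finset.sum_sub_distrib,
    Finset.mul_sum, h1] at h2
  rw [Finset.sum_comm, Finset.sum_comm (s := Finset.univ (α := Fin (4 * n)))] at h2
  simp only [mul_left_comm _ (ep A _), ← Finset.mul_sum, h1, ← Finset.sum_sub_distrib,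
    ← mul_sub] at h2
  have h3 : ∀ X Y, G.TA s X Y = algebraMap ℝ A (1 / 2) * (G.TT s X Y - G.TT s Y X) :=
    fun _ _ => rfl
  simp only [h3, mul_left_comm (ep A _), ← Finset.mul_sum]
  linear_combination algebraMap ℝ A (1 / 2) * h2

lemma TA_J_J_self (hn : 1 ≤ n) (i : Fin 3) (X Y : H) :
    G.TA i (G.J i X) (G.J i Y) = -ep A i * G.TA i X Y := by
  rw [G.TA_J hn, G.J_sq, TA_smul_right]; ring

/-- Since J_iJ_j is a multiple of J_k, the behaviour under J_i ties the J_k-term of the average to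
its J_j-term. The average then fixes both. -/
lemma TA_J_J (hn : 1 ≤ n) {i j k : Fin 3} (hc : Cyc i j k) (X Y : H) :
    G.TA i (G.J j X) (G.J j Y) = ep A j * G.TA i X Y ∧
      G.TA i (G.J k X) (G.J k Y) = ep A k * G.TA i X Y := by
  have h := G.TA_average i X Y
  have h1 := G.TA_J_J_self hn i (G.J j X) (G.J j Y)
  rw [hc.sum, G.TA_J_J_self hn] at h
  simp only [G.J_ij hc, TA_smul_left, TA_smul_right] at h1
  have h2 : 2 * (G.TA i (G.J j X) (G.J j Y) - ep A j * G.TA i X Y) = 0 := by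
    rcases hc.ep_cases (A := A) with ⟨e1, e2, e3⟩ | ⟨e1, e2, e3⟩ | ⟨e1, e2, e3⟩ <;>
      simp only [e1, e2, e3] at h h1 ⊢ <;> grind
  have h3 := two_cancel h2
  refine ⟨by linear_combination h3, ?_⟩
  rcases hc.ep_cases (A := A) with ⟨e1, e2, e3⟩ | ⟨e1, e2, e3⟩ | ⟨e1, e2, e3⟩ <;>
      simp only [e1, e2, e3] at h1 h3 ⊢ <;> grind

lemma TA_eq_muS (s : Fin 3) (X Y : H) : G.TA s X Y = G.muS s (G.J s X) Y := by
  rw [muS, G.J_sq, TA_smul_left]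
  linear_combination (-G.TA s X Y) * ep_mul_self (A := A) s

lemma muS_smul_left (s : Fin 3) (f : A) (X Y : H) : G.muS s (f • X) Y = f * G.muS s X Y := by
  simp only [muS, map_smul, TA_smul_left]; ring
lemma muS_smul_right (s : Fin 3) (f : A) (X Y : H) : G.muS s X (f • Y) = f * G.muS s X Y := by
  simp only [muS, TA_smul_right]; ring

lemma muS_symm (hn : 1 ≤ n) (s : Fin 3) (X Y : H) : G.muS s X Y = G.muS s Y X := by
  rw [muS, muS, G.TA_J hn, G.TA_skew s (G.J s Y)]

lemma muS_J_J (hn : 1 ≤ n) (s u : Fin 3) (X Y : H) :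
    G.muS s (G.J u X) (G.J u Y) = -ep A u * G.muS s X Y := by
  have key : ∀ (c : A), (G.J s (G.J u X) = c • G.J u (G.J s X)) →
      G.TA s (G.J u (G.J s X)) (G.J u Y) = -(c * ep A u) * G.TA s (G.J s X) Y →
      c * c = 1 → G.muS s (G.J u X) (G.J u Y) = -ep A u * G.muS s X Y := by
    intro c h1 h2 h3
    rw [muS, muS, h1, TA_smul_left, h2]
    linear_combination (-ep A s * ep A u * G.TA s (G.J s X) Y) * h3
  rcases fin_three_cases s u with rfl | ⟨k, hc⟩ | ⟨k, hc⟩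
  · exact key 1 (by simp) (by rw [G.TA_J_J_self hn]; ring) (by ring)
  · exact key (-1) (by rw [G.J_ij hc, G.J_ji hc]; module)
      (by rw [(G.TA_J_J hn hc _ _).1]; ring) (by ring)
  · exact key (-1) (by rw [G.J_ij hc, G.J_ji hc]; module)
      (by rw [(G.TA_J_J hn hc.rot _ _).2]; ring) (by ring)

lemma muS_J (hn : 1 ≤ n) (s u : Fin 3) (X Y : H) :
    G.muS s (G.J u X) Y = -G.muS s X (G.J u Y) := by
  have h := G.muS_J_J hn s u X (G.J u Y)
  rw [G.J_sq, muS_smul_right] at h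
  linear_combination ep A u * h
    - (G.muS s (G.J u X) Y + G.muS s X (G.J u Y)) * ep_mul_self (A := A) u

/-- Replacing X, Y by J_iX, J_iY multiplies the symmetric part of `TT_cross` by -ε_i and the skew
part by ε_i, so both vanish separately. -/
lemma TT_cross_parts (hn : 1 ≤ n) {i j k : Fin 3} (hc : Cyc i j k) (X Y : H) :
    G.TS i X (G.J j Y) - G.TS i (G.J j X) Y + (G.TS j X (G.J i Y) - G.TS j (G.J i X) Y) = 0 ∧
      G.TA i X (G.J j Y) + G.TA j X (G.J i Y) = 0 := by
  have hA : ∀ {s u : Fin 3} (X Y : H), G.TA s (G.J u X) (G.J u (G.J u Y))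
      = ep A u * G.TA s X (G.J u Y) → G.TA s (G.J u X) Y = G.TA s X (G.J u Y) := by
    intro s u X Y h
    rw [G.J_sq, TA_smul_right] at h
    linear_combination ep A u * h
      - (G.TA s (G.J u X) Y - G.TA s X (G.J u Y)) * ep_mul_self (A := A) u
  have h0 : ∀ X Y, G.TS i X (G.J j Y) - G.TS i (G.J j X) Y
      + (G.TS j X (G.J i Y) - G.TS j (G.J i X) Y)
      + 2 * (G.TA i X (G.J j Y) + G.TA j X (G.J i Y)) = 0 := by
    intro X Y
    have h := G.TT_cross hn hc X Y
    simp only [TT_eq] at h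
    rw [G.TS_symm i Y, G.TS_symm j Y, G.TA_skew i Y, G.TA_skew j Y,
      hA X Y (G.TA_J_J hn hc X _).1, hA X Y (G.TA_J_J hn hc.rot X _).2] at h
    linear_combination h
  have h1 := h0 X Y
  have h2 := h0 (G.J i X) (G.J i Y)
  have a1 := G.TA_J_J_self hn i X (G.J j Y)
  have a2 := (G.TA_J_J hn hc.rot X (G.J i Y)).2
  have s1 := G.TS_J hn i X (G.J k Y)
  have s2 := G.TS_J hn i (G.J k X) Y
  have s3 := G.TS_J hn i (G.J j X) Y
  have s4 := G.TS_J hn i X (G.J j Y)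
  simp only [G.J_sq, G.J_ij hc, G.J_ji hc, TA_smul_right, TS_smul_left,
    TS_smul_right, G.J_ji hc.rot.rot] at h2 a1 a2 s1 s2 s3 s4
  have h4 : 4 * (G.TA i X (G.J j Y) + G.TA j X (G.J i Y)) = 0 := by
    rcases hc.ep_cases (A := A) with ⟨e1, e2, e3⟩ | ⟨e1, e2, e3⟩ | ⟨e1, e2, e3⟩ <;>
      simp only [e1, e2, e3] at h1 h2 a1 a2 s1 s2 s3 s4 ⊢ <;> grind
  have h5 := natCast_cancel (A := A) (m := 4) (by norm_num) (by exact_mod_cast h4)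
  exact ⟨by linear_combination h1 - 2 * h5, h5⟩

/-- Composing the skew half of the cross relation with J_k makes both terms multiples of μ_i and μ_j
in the same arguments. -/
lemma muS_cyc (hn : 1 ≤ n) {i j k : Fin 3} (hc : Cyc i j k) (X Y : H) :
    G.muS i X Y = G.muS j X Y := by
  have h := (G.TT_cross_parts hn hc (G.J k X) Y).2
  rw [TA_eq_muS, TA_eq_muS] at h
  have h1 := G.muS_J hn i j (G.J i (G.J k X)) Y
  have h2 := G.muS_J hn j i (G.J j (G.J k X)) Y
  simp only [G.J_sq, G.J_ij hc.rot, G.J_ji hc.rot.rot, muS_smul_left,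
    map_smul] at h h1 h2
  rcases hc.ep_cases (A := A) with ⟨e1, e2, e3⟩ | ⟨e1, e2, e3⟩ | ⟨e1, e2, e3⟩ <;>
      simp only [e1, e2, e3] at h h1 h2 ⊢ <;> grind

lemma muS_eq_mu (hn : 1 ≤ n) (s : Fin 3) (X Y : H) : G.muS s X Y = G.mu X Y := by
  have h1 := G.muS_cyc hn (i := 0) (j := 1) (k := 2) ⟨rfl, rfl⟩ X Y
  have h2 := G.muS_cyc hn (i := 1) (j := 2) (k := 0) ⟨rfl, rfl⟩ X Y
  fin_cases s
  · rfl
  · exact h1.symm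
  · exact (h1.trans h2).symm

lemma mu_symm (hn : 1 ≤ n) (X Y : H) : G.mu X Y = G.mu Y X := G.muS_symm hn 0 X Y

lemma mu_J (hn : 1 ≤ n) (u : Fin 3) (X Y : H) : G.mu (G.J u X) Y = -G.mu X (G.J u Y) :=
  G.muS_J hn 0 u X Y

lemma mu_J_J (hn : 1 ≤ n) (u : Fin 3) (X Y : H) :
    G.mu (G.J u X) (G.J u Y) = -ep A u * G.mu X Y := G.muS_J_J hn 0 u X Y

lemma mu_smul_left (f : A) (X Y : H) : G.mu (f • X) Y = f * G.mu X Y := G.muS_smul_left 0 f X Y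
lemma mu_smul_right (f : A) (X Y : H) : G.mu X (f • Y) = f * G.mu X Y := G.muS_smul_right 0 f X Y

lemma mu_bil : IsBil G.mu := by
  refine ⟨fun Y => ⟨fun X Z => ?_, fun f X => G.mu_smul_left f X Y⟩,
    fun X => ⟨fun Y Z => ?_, fun f Y => G.mu_smul_right f X Y⟩⟩ <;>
  · simp only [mu, muS, TA, map_add, TT_add_left, TT_add_right]; ring

lemma tau_smul_left (f : A) (X Y : H) : G.tau (f • X) Y = f * G.tau X Y := by
  simp only [tau, map_smul, TS_smul_left, Fin.sum_univ_three]; ring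
lemma tau_smul_right (f : A) (X Y : H) : G.tau X (f • Y) = f * G.tau X Y := by
  simp only [tau, TS_smul_right, Fin.sum_univ_three]; ring

lemma tau_bil : IsBil G.tau := by
  refine ⟨fun Y => ⟨fun X Z => ?_, fun f X => G.tau_smul_left f X Y⟩,
    fun X => ⟨fun Y Z => ?_, fun f Y => G.tau_smul_right f X Y⟩⟩ <;>
  · simp only [tau, TS, map_add, TT_add_left, TT_add_right, Fin.sum_univ_three]; ring

lemma tau_symm (hn : 1 ≤ n) (X Y : H) : G.tau X Y = G.tau Y X := by
  rw [tau, tau, neg_inj]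
  exact Finset.sum_congr rfl fun s _ => by rw [G.TS_J hn, G.TS_symm]

/-- The term u = s reproduces the left side, since T^sym(ξ_s, ·, ·) is compatible with J_s; the
other two terms cancel each other. -/
lemma TS_J_average (hn : 1 ≤ n) (s : Fin 3) (X Y : H) :
    G.TS s (G.J s X) Y = ∑ u, ep A u * G.TS s (G.J s (G.J u X)) (G.J u Y) := by
  have hc := Cyc.mk' s
  have s1 := G.TS_J hn s X Y
  have s2 := G.TS_J hn s (G.J (s + 1) X) (G.J (s + 1) Y)
  rw [hc.sum]
  simp only [G.J_sq, G.J_ij hc, G.J_ji hc.rot.rot, TS_smul_left, TS_smul_right] at s1 s2 ⊢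
  rcases hc.ep_cases (A := A) with ⟨e1, e2, e3⟩ | ⟨e1, e2, e3⟩ | ⟨e1, e2, e3⟩ <;>
      simp only [e1, e2, e3] at s1 s2 ⊢ <;> grind

lemma tau_average (hn : 1 ≤ n) (X Y : H) :
    G.tau X Y = ∑ u, ep A u * G.tau (G.J u X) (G.J u Y) := by
  simp only [tau, mul_neg, Finset.mul_sum, Finset.sum_neg_distrib]
  rw [Finset.sum_comm, neg_inj]
  refine Finset.sum_congr rfl fun s _ => ?_
  rw [G.TS_J_average hn s X Y, Finset.mul_sum]
  exact Finset.sum_congr rfl fun u _ => by ring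

/-- The torsion endomorphism in terms of `τ` and `μ`. -/
lemma TT_formula (hn : 1 ≤ n) (s : Fin 3) (X Y : H) : 4 * G.TT s X Y
    = 4 * G.mu (G.J s X) Y - (G.tau (G.J s X) Y + G.tau X (G.J s Y)) := by
  have hc := Cyc.mk' s
  have h2 : G.tau (G.J s X) Y + G.tau X (G.J s Y) = -4 * G.TS s X Y := by
    rw [tau, tau, hc.sum, hc.sum]
    set j := s + 1
    set k := s + 2
    -- The sum of τ-terms contains the symmetric torsion of all three Reeb fields. The cross
    -- relations between s and each of the two other indices trade the foreign contributions for
    -- T^sym(ξ_s, ·, ·).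
    have c1 := (G.TT_cross_parts hn hc (G.J j X) Y).1
    have c2 := (G.TT_cross_parts hn hc.rot.rot (G.J k X) Y).1
    have s1 := G.TS_J hn s X Y
    have s2 := G.TS_J hn s X (G.J s Y)
    have s3 := G.TS_J hn s (G.J j X) (G.J k Y)
    simp only [G.J_sq, G.J_ij hc, G.J_ji hc, G.J_ij hc.rot.rot, G.J_ji hc.rot.rot, TS_smul_left,
      TS_smul_right] at c1 c2 s1 s2 s3 ⊢
    rcases hc.ep_cases (A := A) with ⟨e1, e2, e3⟩ | ⟨e1, e2, e3⟩ | ⟨e1, e2, e3⟩ <;>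
      simp only [j, k, e1, e2, e3] at c1 c2 s1 s2 s3 ⊢ <;> grind
  rw [h2, ← G.muS_eq_mu hn s, ← TA_eq_muS, TT_eq]; ring

lemma tr_mu : G.tr G.mu = 0 := by
  have h : G.tr G.mu = ep A 0 * algebraMap ℝ A (1 / 2) * (G.tr (fun Y Z => G.TT 0 (G.J 0 Y) Z)
      - G.tr (fun Y Z => G.TT 0 Z (G.J 0 Y))) := by
    rw [← G.tr_sub, ← G.tr_mul]
    congr 1
    funext Y Z
    rw [mu, muS, TA]; ring
  have h1 := G.tr_TT_J 0 0
  have h2 : G.tr (fun Y Z => G.TT 0 Z (G.J 0 Y)) = 0 := by rw [← G.tr_swap]; exact h1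
  rw [h, G.tr_J _ (G.TT_bil' 0), h1, h2]; ring

lemma tr_tau : G.tr G.tau = 0 := by
  have h : ∀ s : Fin 3, G.tr (fun Y Z => G.TS s (G.J s Y) Z) = 0 := by
    intro s
    have : G.tr (fun Y Z => G.TS s (G.J s Y) Z) = algebraMap ℝ A (1 / 2) *
        (G.tr (fun Y Z => G.TT s (G.J s Y) Z) + G.tr (fun Y Z => G.TT s Z (G.J s Y))) := by
      rw [← G.tr_add, ← G.tr_mul]; rfl
    have h1 := G.tr_TT_J s s
    have h2 : G.tr (fun Y Z => G.TT s Z (G.J s Y)) = 0 := by rw [← G.tr_swap]; exact h1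
    rw [this, G.tr_J _ (G.TT_bil' s), h1, h2]; ring
  have h3 : G.tr G.tau = -(ep A 0 * G.tr (fun Y Z => G.TS 0 (G.J 0 Y) Z)
      + ep A 1 * G.tr (fun Y Z => G.TS 1 (G.J 1 Y) Z)
      + ep A 2 * G.tr (fun Y Z => G.TS 2 (G.J 2 Y) Z)) := by
    rw [← G.tr_mul, ← G.tr_mul, ← G.tr_mul, ← G.tr_add, ← G.tr_add, ← G.tr_neg]
    congr 1
    funext Y Z
    rw [tau, Fin.sum_univ_three]
  rw [h3, h, h, h]; ring

end Geo

namespace Geo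

variable {n : ℕ} {A V H : Type*} [CommRing A] [Algebra ℝ A] [AddCommGroup V] [Module A V]
  [AddCommGroup H] [Module A H] (G : Geo n A V H)

/-! ### The horizontal Ricci tensor -/

lemma natCast_cancel_eq {m : ℕ} (hm : m ≠ 0) {x y : A} (h : (m : A) * x = m * y) : x = y :=
  sub_eq_zero.1 (natCast_cancel hm (by linear_combination h))

/-- The horizontal Ricci tensor. -/
def Ric (X Y : H) : A := G.tr fun Z W => G.g (G.RH (G.inc Z) (G.inc X) Y) W

/-- The scalar curvature. -/
def Scal : A := G.tr G.Ric

/-- `TT_formula` is inserted into `rho_inc` and the mixed τ-terms are collected by `tau_average`;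
the right side no longer refers to a choice of the other two indices. -/
lemma rho_tau (hn : 1 ≤ n) (k : Fin 3) (X Y : H) : 2 * G.rho k (G.inc X) (G.inc Y)
    = G.tau X (G.J k Y) - G.tau (G.J k X) Y - 4 * G.mu (G.J k X) Y
      - 2 * G.sc * G.g (G.J k X) Y := by
  have hc : Cyc (k + 1) (k + 2) k := (Cyc.mk' k).rot
  set i := k + 1
  set j := k + 2
  have h := G.rho_inc hn hc X Y
  have t1 := G.TT_formula hn i X (G.J j Y)
  have t2 := G.TT_formula hn i Y (G.J j X)
  have m1 := G.mu_J hn j (G.J i X) Y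
  have m2 := G.mu_J hn i (G.J j X) Y
  have m3 := G.mu_symm hn (G.J i Y) (G.J j X)
  have a := G.tau_average hn X (G.J k Y)
  rw [hc.sum] at a
  have y1 := G.tau_symm hn Y (G.J k X)
  have y2 := G.tau_symm hn (G.J i Y) (G.J j X)
  simp only [G.J_sq, G.J_ij hc, G.J_ji hc, G.J_ij hc.rot, G.J_ji hc.rot.rot, mu_smul_left,
    tau_smul_right] at t1 t2 m1 m2 a
  refine two_inj ?_
  rcases hc.ep_cases (A := A) with ⟨e1, e2, e3⟩ | ⟨e1, e2, e3⟩ | ⟨e1, e2, e3⟩ <;>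
    simp only [e1, e2, e3] at h t1 t2 m1 m2 a ⊢ <;> grind

/-- The horizontal Bianchi identity. -/
lemma bianchi_H (hn : 1 ≤ n) (X Y Z : H) :
    G.RH (G.inc X) (G.inc Y) Z + G.RH (G.inc Y) (G.inc Z) X + G.RH (G.inc Z) (G.inc X) Y
      = ∑ s, (-2 * ep A s) • (G.g (G.J s X) Y • G.tt s Z + G.g (G.J s Y) Z • G.tt s X
        + G.g (G.J s Z) X • G.tt s Y) := by
  have h := congrArg G.hor (G.bianchi (G.inc X) (G.inc Y) (G.inc Z))
  have h1 : ∀ X Y Z, G.hor (G.tor (G.tor (G.inc X) (G.inc Y)) (G.inc Z))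
      = ∑ s, (-2 * ep A s) • (G.g (G.J s X) Y • G.tt s Z) := by
    intro X Y Z
    rw [tor_inc]
    simp only [map_sum, map_smul, LinearMap.sum_apply, LinearMap.smul_apply, mul_smul]
    rfl
  simp only [map_add, nbTor_inc G hn, map_zero, h1] at h
  simp only [RH_apply, h, smul_add, Finset.sum_add_distrib]
  abel

/-- J_k is moved across the metric and then through the curvature; the commutator contributes the
forms κ. -/
lemma tr_RH_J (k : Fin 3) (X Y : H) :
    G.tr (fun Z W => G.g (G.RH (G.inc Z) (G.inc X) Y) (G.J k W))
      = -G.Ric X (G.J k Y) + ∑ t, G.kap k t (G.inc (G.J t Y)) (G.inc X) := by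
  have hlin : ∀ t, IsLin fun W => G.kap k t (G.inc W) (G.inc X) := fun t =>
    ⟨fun _ _ => by simp [kap], fun _ _ => by simp [kap]⟩
  have h : ∀ Z W, G.g (G.RH (G.inc Z) (G.inc X) Y) (G.J k W)
      = -G.g (G.RH (G.inc Z) (G.inc X) (G.J k Y)) W
        + (G.g (G.J 0 Y) W * G.kap k 0 (G.inc Z) (G.inc X)
          + G.g (G.J 1 Y) W * G.kap k 1 (G.inc Z) (G.inc X)
          + G.g (G.J 2 Y) W * G.kap k 2 (G.inc Z) (G.inc X)) := by
    intro Z W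
    rw [RH_J, ← neg_neg (G.g (G.RH (G.inc Z) (G.inc X) Y) (G.J k W)), ← G.g_J, Fin.sum_univ_three]
    simp only [map_add, map_smul, LinearMap.add_apply, LinearMap.smul_apply, smul_eq_mul]
    ring
  simp only [h, G.tr_add, G.tr_neg, Ric, Fin.sum_univ_three]
  rw [← G.tr_swap (fun Y_1 Z => G.g (G.J 0 Y) Z * _), ← G.tr_swap (fun Y_1 Z => G.g (G.J 1 Y) Z * _),
    ← G.tr_swap (fun Y_1 Z => G.g (G.J 2 Y) Z * _), G.tr_g _ (hlin 0), G.tr_g _ (hlin 1),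
    G.tr_g _ (hlin 2)]

lemma bianchi_H_four (hn : 1 ≤ n) (X Y Z W : H) :
    G.g (G.RH (G.inc X) (G.inc Y) Z) W - G.g (G.RH (G.inc Z) (G.inc Y) X) W
        + G.g (G.RH (G.inc Z) (G.inc X) Y) W
      = -2 * ∑ s, ep A s * (G.g (G.J s X) Y * G.TT s Z W + G.g (G.J s Y) Z * G.TT s X W
        - G.g (G.J s X) Z * G.TT s Y W) := by
  have h := congrArg (fun P => G.g P W) (G.bianchi_H hn X Y Z)
  rw [G.RH_swap (G.inc Y) (G.inc Z)] at h
  simp only [map_add, map_neg, LinearMap.add_apply, LinearMap.neg_apply, map_sum,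
    LinearMap.sum_apply, map_smul, LinearMap.smul_apply, smul_eq_mul] at h
  rw [sub_eq_add_neg, h, Finset.mul_sum]
  refine Finset.sum_congr rfl fun s _ => ?_
  rw [G.g_J s Z X, G.g_symm Z]
  simp only [TT]
  ring

lemma TT_lin_right (s : Fin 3) (X : H) : IsLin (G.TT s X) := (G.TT_bil' s).right X

lemma tr_TT (hn : 1 ≤ n) (s : Fin 3) : G.tr (G.TT s) = 0 := by
  have h := G.tr_J _ (G.TT_bil_right s s) s
  simp only [G.J_sq, TT_smul_right, G.tr_mul] at h
  have h2 : G.tr (fun Y Z => G.TT s (G.J s Y) (G.J s Z)) = ep A s * G.tr (G.TT s) := by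
    rw [← G.tr_mul, ← G.tr_swap]
    congr 1
    funext Y Z
    rw [G.TT_J_self' hn s Z, G.J_sq, TT_smul_left]
  have h3 := two_cancel (x := ep A s * G.tr (G.TT s)) (by linear_combination h - h2)
  linear_combination ep A s * h3 - G.tr (G.TT s) * ep_mul_self (A := A) s

lemma tr_sum (φ : Fin 3 → H → H → A) :
    G.tr (fun Y Z => ∑ s, φ s Y Z) = ∑ s, G.tr (φ s) := by
  simp only [Fin.sum_univ_three, G.tr_add]

/-- Ricci is symmetric despite the torsion: in the contracted Bianchi identity the torsion terms
vanish, because T_s(X, J_sY) is symmetric and T_s is trace-free. -/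
lemma Ric_symm (hn : 1 ≤ n) (X Y : H) : G.Ric X Y = G.Ric Y X := by
  have h : G.tr (fun Z W => G.g (G.RH (G.inc X) (G.inc Y) Z) W
        - G.g (G.RH (G.inc Z) (G.inc Y) X) W + G.g (G.RH (G.inc Z) (G.inc X) Y) W) = 0 := by
    simp only [G.bianchi_H_four hn, G.tr_mul, G.tr_sum, G.tr_add, G.tr_sub,
      G.tr_g _ (G.TT_lin_right _ _)]
    have : ∀ s, G.tr (fun Z W => G.TT s Z W) = 0 := G.tr_TT hn
    simp only [this, G.TT_J_self hn _ X Y]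
    simp
  have h1 : G.tr (fun Z W => G.g (G.RH (G.inc X) (G.inc Y) Z) W) = 0 :=
    G.tr_skew _ fun Z W => by rw [G.g_RH, G.g_symm]
  rw [G.tr_add, G.tr_sub, h1] at h
  simp only [Ric]
  linear_combination h

lemma TT_J_lin (s k : Fin 3) (X : H) : IsLin (fun W => G.TT s X (G.J k W)) :=
  (G.TT_bil_right s k).right X

lemma Ric_contract (hn : 1 ≤ n) (k : Fin 3) (X Y : H) :
    4 * n * G.rho k (G.inc X) (G.inc Y) + G.Ric Y (G.J k X) - G.Ric X (G.J k Y)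
      - ∑ t, G.kap k t (G.inc (G.J t X)) (G.inc Y) + ∑ t, G.kap k t (G.inc (G.J t Y)) (G.inc X)
      = -2 * ∑ s, ep A s * (G.TT s X (G.J k (G.J s Y)) - G.TT s Y (G.J k (G.J s X))) := by
  have h : G.tr (fun Z W => G.g (G.RH (G.inc X) (G.inc Y) Z) (G.J k W)
        - G.g (G.RH (G.inc Z) (G.inc Y) X) (G.J k W) + G.g (G.RH (G.inc Z) (G.inc X) Y) (G.J k W))
      = -2 * ∑ s, ep A s * (G.TT s X (G.J k (G.J s Y)) - G.TT s Y (G.J k (G.J s X))) := by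
    simp only [G.bianchi_H_four hn, G.tr_mul, G.tr_sum, G.tr_add, G.tr_sub,
      G.tr_g _ (G.TT_J_lin _ _ _), tr_TT_J]
    simp
  rw [G.tr_add, G.tr_sub, tr_RH_J, tr_RH_J, ← G.four_n_rho hn] at h
  linear_combination h

/-- The right-hand side of the formula for the Ricci tensor. -/
def ricModel (X Y : H) : A :=
  (2 * n + 2) * G.tau X Y + (4 * n + 10) * G.mu X Y + 2 * (n + 2) * G.sc * G.g X Y

/-- The contraction with J_k only detects this combination of Ricci values. Expressing the forms κ
through ρ, and ρ and the torsion through τ, μ and `sc`, evaluates it explicitly. -/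
lemma Ric_J (hn : 1 ≤ n) (k : Fin 3) (X Y : H) : G.Ric Y (G.J k X) - G.Ric X (G.J k Y)
    = G.ricModel Y (G.J k X) - G.ricModel X (G.J k Y) := by
  have hc : Cyc (k + 1) (k + 2) k := (Cyc.mk' k).rot
  set i := k + 1
  set j := k + 2
  have h := G.Ric_contract hn k X Y
  simp only [hc.sum, G.kap_diag hn, G.kap_ij hn hc.rot.rot, G.kap_ik hn hc.rot.rot] at h
  have r0 := G.rho_tau hn k X Y
  have r1 := G.rho_tau hn j (G.J i X) Y
  have r2 := G.rho_tau hn i (G.J j X) Y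
  have r3 := G.rho_tau hn j (G.J i Y) X
  have r4 := G.rho_tau hn i (G.J j Y) X
  have t1 := G.TT_formula hn i X (G.J j Y)
  have t2 := G.TT_formula hn i Y (G.J j X)
  have t3 := G.TT_formula hn j X (G.J i Y)
  have t4 := G.TT_formula hn j Y (G.J i X)
  have t5 := G.TT_formula hn k X Y
  have t6 := G.TT_formula hn k Y X
  have m1 := G.mu_J hn j (G.J i X) Y
  have m2 := G.mu_J hn i (G.J j X) Y
  have m3 := G.mu_symm hn (G.J i Y) (G.J j X)
  have m4 := G.mu_symm hn (G.J j Y) (G.J i X)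
  have m5 := G.mu_J hn k X Y
  have m6 := G.mu_symm hn Y (G.J k X)
  have m7 := G.mu_symm hn X (G.J k Y)
  have a := G.tau_average hn X (G.J k Y)
  rw [hc.sum] at a
  have y1 := G.tau_symm hn Y (G.J k X)
  have y2 := G.tau_symm hn (G.J i Y) (G.J j X)
  have y3 := G.tau_symm hn (G.J j Y) (G.J i X)
  have y4 := G.tau_symm hn X (G.J k Y)
  have g1 := G.g_J k X Y
  have g2 := G.g_symm Y (G.J k X)
  have g3 := G.g_symm X (G.J k Y)
  simp only [ricModel]
  simp only [G.J_sq, G.J_ij hc, G.J_ji hc, G.J_ij hc.rot, G.J_ji hc.rot.rot, mu_smul_left,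
    tau_smul_right, tau_smul_left, TT_smul_right, map_smul, LinearMap.smul_apply, smul_eq_mul,
    G.J_ij hc.rot.rot, G.J_ji hc.rot] at h t1 t2 t3 t4 t5 t6 m1 m2 a r1 r2 r3 r4 g1 g2 g3
  -- What remains is polynomial in `n`, so `n` can be replaced by an arbitrary ring element.
  generalize (n : A) = N at *
  rcases hc.ep_cases (A := A) with ⟨e1, e2, e3⟩ | ⟨e1, e2, e3⟩ | ⟨e1, e2, e3⟩ <;>
    simp only [e1, e2, e3] at h t1 t2 t3 t4 t5 t6 m1 m2 a r1 r2 r3 r4 <;>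
    refine natCast_cancel_eq (m := 2) (by norm_num) ?_ <;> grind

lemma Ric_bil : IsBil G.Ric := by
  refine ⟨fun Y => ⟨fun X Z => ?_, fun f X => ?_⟩, fun X => ⟨fun Y Z => ?_, fun f Y => ?_⟩⟩
  · simp only [Ric, RH_apply, map_add, LinearMap.add_apply, G.tr_add]
  · simp only [Ric, RH_apply, map_smul, LinearMap.smul_apply, smul_eq_mul, G.tr_mul]
  · simp only [Ric, map_add, LinearMap.add_apply, G.tr_add]
  · simp only [Ric, map_smul, LinearMap.smul_apply, smul_eq_mul, G.tr_mul]

lemma ricModel_bil : IsBil G.ricModel := by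
  refine ⟨fun Y => ⟨fun X Z => ?_, fun f X => ?_⟩, fun X => ⟨fun Y Z => ?_, fun f Y => ?_⟩⟩
  · simp only [ricModel, (G.tau_bil.left Y).add, (G.mu_bil.left Y).add, map_add,
      LinearMap.add_apply]; ring
  · simp only [ricModel, (G.tau_bil.left Y).smul, (G.mu_bil.left Y).smul, map_smul,
      LinearMap.smul_apply, smul_eq_mul]; ring
  · simp only [ricModel, (G.tau_bil.right X).add, (G.mu_bil.right X).add, map_add]; ring
  · simp only [ricModel, (G.tau_bil.right X).smul, (G.mu_bil.right X).smul, map_smul,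
      smul_eq_mul]; ring

/-- The difference D of the two sides is symmetric and, by `Ric_J`, every J_k is self-adjoint for D.
The adjoint of J_iJ_j is then J_jJ_i = -J_iJ_j, although J_iJ_j is a multiple of the self-adjoint
J_k. Hence 2D = 0. -/
lemma Ric_eq (hn : 1 ≤ n) (X Y : H) : G.Ric X Y = G.ricModel X Y := by
  have hsymm : ∀ X Y, G.ricModel X Y = G.ricModel Y X := fun X Y => by
    simp only [ricModel, G.tau_symm hn X, G.mu_symm hn X, G.g_symm X]
  have hc : Cyc (0 : Fin 3) 1 2 := ⟨rfl, rfl⟩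
  have r1 := G.Ric_J hn 0 (G.J 0 X) Y
  have r2 := G.Ric_J hn 1 (G.J 2 X) (G.J 0 Y)
  have r3 := G.Ric_J hn 2 (G.J 2 X) Y
  have q1 := G.Ric_symm hn (G.J 0 X) (G.J 0 Y)
  have q2 := hsymm (G.J 0 X) (G.J 0 Y)
  have q3 := G.Ric_symm hn Y X
  have q4 := hsymm Y X
  simp only [G.J_sq, G.J_ji hc, G.J_ij hc.rot, (G.Ric_bil.right _).smul,
    (G.ricModel_bil.right _).smul, ep_zero, ep_two] at r1 r2 r3
  exact two_inj (by grind)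

lemma Scal_eq (hn : 1 ≤ n) : G.Scal = 8 * n * (n + 2) * G.sc := by
  have h : G.Scal = G.tr G.ricModel := by
    simp only [Scal, PQModule.tr, G.Ric_eq hn]
  have h1 : G.tr G.ricModel = (2 * n + 2) * G.tr G.tau + (4 * n + 10) * G.tr G.mu
      + 2 * (n + 2) * G.sc * G.tr (fun Y Z => G.g Y Z) := by
    rw [← G.tr_mul, ← G.tr_mul, ← G.tr_mul, ← G.tr_add, ← G.tr_add]; rfl
  rw [h, h1, tr_tau, tr_mu, G.tr_metric]; ring

/-- The operator S ↦ ∑ ε_s S(J_s·, J_s·) fixes τ and multiplies μ and g by -3. Applied to `Ric_eq`,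
it separates τ from the other two terms; `mu_Ric` uses the complementary combination. -/
lemma tau_Ric (hn : 1 ≤ n) (X Y : H) : 4 * (2 * n + 2) * G.tau X Y
    = 3 * G.Ric X Y + ∑ s, ep A s * G.Ric (G.J s X) (G.J s Y) := by
  have a := G.tau_average hn X Y
  simp only [Fin.sum_univ_three, G.Ric_eq hn, ricModel, G.mu_J_J hn, G.g_J_J, ep_zero, ep_one,
    ep_two] at a ⊢
  linear_combination (2 * n + 2) * a

lemma mu_Ric (hn : 1 ≤ n) (X Y : H) : 4 * (4 * n + 10) * G.mu X Y
    = G.Ric X Y - (∑ s, ep A s * G.Ric (G.J s X) (G.J s Y)) - 8 * (n + 2) * G.sc * G.g X Y := by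
  have a := G.tau_average hn X Y
  simp only [Fin.sum_univ_three, G.Ric_eq hn, ricModel, G.mu_J_J hn, G.g_J_J, ep_zero, ep_one,
    ep_two] at a ⊢
  linear_combination (-(2 * n + 2)) * a

end Geo

namespace Geo

variable {n : ℕ} {A V H : Type*} [CommRing A] [Algebra ℝ A] [AddCommGroup V] [Module A V]
  [AddCommGroup H] [Module A H] (G : Geo n A V H)

/-! ### Bianchi identities with Reeb vector fields -/

/-- The horizontal part of `T(ξ_i, ξ_j)` as a linear form on `H`. -/
def th (i j : Fin 3) (X : H) : A := G.g (G.hor (G.tor (G.xi i) (G.xi j))) X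

lemma th_swap (i j : Fin 3) (X : H) : G.th i j X = -G.th j i X := by
  rw [th, tor_swap]; simp [th]

lemma th_self (i : Fin 3) (X : H) : G.th i i X = 0 := by
  rw [th, tor_self]; simp

lemma th_smul (i j : Fin 3) (f : A) (X : H) : G.th i j (f • X) = f * G.th i j X := by
  simp [th]

lemma th_add (i j : Fin 3) (X Y : H) : G.th i j (X + Y) = G.th i j X + G.th i j Y := by
  simp [th]

lemma th_lin (i j : Fin 3) : IsLin (G.th i j) := ⟨G.th_add i j, G.th_smul i j⟩

/-- The covariant derivative of the torsion endomorphism. -/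
def nbtt (u : V) (s : Fin 3) (X : H) : H :=
  G.nh u (G.tt s X) - (∑ t, G.cf s t u • G.tt t X) - G.tt s (G.nh u X)

lemma hor_tor_xi_inc (s : Fin 3) (X : H) : G.hor (G.tor (G.xi s) (G.inc X)) = G.tt s X := rfl

lemma hor_nbTor_xi_inc (u : V) (s : Fin 3) (X : H) :
    G.hor (G.nbTor u (G.xi s) (G.inc X)) = G.nbtt u s X := by
  rw [nbTor, ← inc_nh, G.nb_xi u s]
  simp only [map_sub, hor_nb, hor_tor_xi_inc, map_sum, map_smul, LinearMap.sum_apply,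
    LinearMap.smul_apply, nbtt]

lemma hor_nbTor_inc_xi (u : V) (s : Fin 3) (X : H) :
    G.hor (G.nbTor u (G.inc X) (G.xi s)) = -G.nbtt u s X := by
  rw [nbTor_swap, map_neg, hor_nbTor_xi_inc]

/-- The covariant derivative of a horizontal two-tensor. -/
def nbS (S : H → H → A) (u : V) (X Y : H) : A :=
  G.D u (S X Y) - S (G.nh u X) Y - S X (G.nh u Y)

/-- `TT_formula` is differentiated. The connection forms enter on the left through ξ_s and on the
right through J_s, and they match because both turn alike. -/
lemma g_nbtt (hn : 1 ≤ n) (u : V) (s : Fin 3) (X Y : H) : 4 * G.g (G.nbtt u s X) Y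
    = 4 * G.nbS G.mu u (G.J s X) Y
      - (G.nbS G.tau u (G.J s X) Y + G.nbS G.tau u X (G.J s Y)) := by
  have h0 := congrArg (G.D u) (G.TT_formula hn s X Y)
  rw [G.D_sub, G.D_add, G.D_four_mul, G.D_four_mul] at h0
  have h1 := G.D_g u (G.tt s X) Y
  have h2 := G.TT_formula hn s X (G.nh u Y)
  have h3 := G.TT_formula hn s (G.nh u X) Y
  have h4 : G.g (G.nbtt u s X) Y = G.g (G.nh u (G.tt s X)) Y
      - (∑ t, G.cf s t u * G.TT t X Y) - G.TT s (G.nh u X) Y := by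
    simp only [nbtt, map_sub, LinearMap.sub_apply, map_sum, LinearMap.sum_apply, map_smul,
      LinearMap.smul_apply, smul_eq_mul, TT]
  have h5 := G.TT_formula hn
  have h6 : 4 * ∑ t, G.cf s t u * G.TT t X Y = 4 * ∑ t, G.cf s t u * G.mu (G.J t X) Y
      - ((∑ t, G.cf s t u * G.tau (G.J t X) Y) + ∑ t, G.cf s t u * G.tau X (G.J t Y)) := by
    simp only [Fin.sum_univ_three]
    linear_combination G.cf s 0 u * h5 0 X Y + G.cf s 1 u * h5 1 X Y + G.cf s 2 u * h5 2 X Y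
  have e1 : G.mu (∑ t, G.cf s t u • G.J t X) Y = ∑ t, G.cf s t u * G.mu (G.J t X) Y :=
    (G.mu_bil.left Y).sum _ _ _
  have e2 : G.tau (∑ t, G.cf s t u • G.J t X) Y = ∑ t, G.cf s t u * G.tau (G.J t X) Y :=
    (G.tau_bil.left Y).sum _ _ _
  have e3 : G.tau X (∑ t, G.cf s t u • G.J t Y) = ∑ t, G.cf s t u * G.tau X (G.J t Y) :=
    (G.tau_bil.right X).sum _ _ _
  rw [h4]
  simp only [nbS, nh_J, (G.mu_bil.left _).add, (G.tau_bil.left _).add, (G.tau_bil.right _).add,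
    e1, e2, e3]
  simp only [TT] at h0 h2 h3 h1 h6 ⊢
  linear_combination h0 - 4 * h1 - h2 - h3 - h6

lemma eta_tor_eq (m : Fin 3) (hn : 1 ≤ n) (v : V) (X : H) :
    G.eta m (G.tor v (G.inc X)) = -2 * ep A m * G.g (G.J m (G.hor v)) X := by
  conv_lhs => rw [G.decomp v]
  simp only [map_add, LinearMap.add_apply, map_sum, LinearMap.sum_apply, map_smul,
    LinearMap.smul_apply, eta_tor_inc, G.eta_tor_xi_inc hn, smul_zero, Finset.sum_const_zero,
    add_zero]

lemma hor_tor_eq (v : V) (X : H) :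
    G.hor (G.tor v (G.inc X)) = ∑ s, G.eta s v • G.tt s X := by
  conv_lhs => rw [G.decomp v]
  simp only [map_add, LinearMap.add_apply, map_sum, LinearMap.sum_apply, map_smul,
    LinearMap.smul_apply, hor_tor_inc, zero_add]
  rfl

/-- The vertical part of the Bianchi identity for two Reeb fields and one horizontal field; it is
the source of all relations between mixed Ricci 2-forms and T(ξ_i, ξ_j)_H. -/
lemma kap_xi (hn : 1 ≤ n) (i j m : Fin 3) (X : H) :
    G.kap i m (G.xi j) (G.inc X) + G.kap j m (G.inc X) (G.xi i)
      = G.D (G.inc X) (G.cc i j m) + (∑ t, G.cc i j t * G.cf t m (G.inc X))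
        - (∑ t, G.cf i t (G.inc X) * G.cc t j m) - (∑ t, G.cf j t (G.inc X) * G.cc i t m)
        + 2 * ep A m * G.th i j (G.J m X) := by
  have h := congrArg (G.eta m) (G.bianchi (G.xi i) (G.xi j) (G.inc X))
  have h1 : G.eta m (G.nbTor (G.inc X) (G.xi i) (G.xi j)) =
      G.D (G.inc X) (G.cc i j m) + (∑ t, G.cc i j t * G.cf t m (G.inc X))
        - (∑ t, G.cf i t (G.inc X) * G.cc t j m) - (∑ t, G.cf j t (G.inc X) * G.cc i t m) := by
    rw [nbTor, G.nb_xi _ i, G.nb_xi _ j]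
    simp only [map_sub, eta_nb, map_sum, map_smul, LinearMap.sum_apply, LinearMap.smul_apply,
      smul_eq_mul, cc]
  rw [G.tor_swap (G.inc X) (G.xi i), G.tor_xi_inc hn, G.tor_xi_inc hn, ← map_neg G.inc] at h
  simp only [map_add, eta_curv_inc, G.eta_nbTor_inc_xi hn, G.eta_nbTor_xi_inc hn, h1,
    G.eta_tor_inc_xi hn, G.eta_tor_eq m hn, G.g_J] at h
  have h2 : G.eta m (G.curv (G.xi j) (G.inc X) (G.xi i)) = G.kap i m (G.xi j) (G.inc X) := rfl
  have h3 : G.eta m (G.curv (G.inc X) (G.xi i) (G.xi j)) = G.kap j m (G.inc X) (G.xi i) := rfl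
  rw [h2, h3] at h
  rw [th]
  linear_combination h

lemma cc_left (hn : 1 ≤ n) {u i : Fin 3} (h : i ≠ u) : G.cc i u i = 0 := by
  rw [cc_swap, G.cc_right hn h, neg_zero]

/-- The mixed Ricci 2-forms with different indices in terms of `T(ξ_i, ξ_j)_H`. -/
lemma rho_mixed (hn : 1 ≤ n) {i j k : Fin 3} (hc : Cyc i j k) (X : H) :
    G.rho k (G.inc X) (G.xi i) = -ep A k * G.th i j (G.J i X) ∧
      G.rho k (G.inc X) (G.xi j) = -ep A k * G.th i j (G.J j X) := by
  have n1 := hc.ne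
  constructor
  -- In the component along ξ_i the form κ_ii vanishes, so κ_ji, a multiple of ρ_k, stands alone;
  -- the connection-form terms cancel by skewness. The second half uses the component along ξ_j.
  · have h := G.kap_xi hn i j i X
    have hs := G.cf_skew hn hc.rot.rot (G.inc X)
    rw [G.kap_diag hn, G.kap_ik hn hc.rot, hc.sum, hc.sum, hc.sum] at h
    simp only [G.cc_self, G.cc_left hn n1.1, G.cc_left hn n1.2.1, G.cc_right hn n1.1.symm,
      G.cc_cyc hn hc, G.cc_swap k j, G.cc_cyc hn hc.rot, G.cf_diag hn, G.D_zero] at h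
    refine two_inj ?_
    rcases hc.ep_cases (A := A) with ⟨e1, e2, e3⟩ | ⟨e1, e2, e3⟩ | ⟨e1, e2, e3⟩ <;>
      simp only [e1, e2, e3] at h hs ⊢ <;> grind
  · have h := G.kap_xi hn i j j X
    have hs := G.cf_skew hn hc.rot (G.inc X)
    rw [G.kap_diag hn, G.kap_ij hn hc, hc.sum, hc.sum, hc.sum, G.rho_swap] at h
    simp only [G.cc_self, G.cc_left hn n1.1, G.cc_right hn n1.1.symm, G.cc_right hn n1.2.2, G.cc_swap i k,
      G.cc_cyc hn hc, G.cc_cyc hn hc.rot.rot, G.cf_diag hn, G.D_zero] at h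
    refine two_inj ?_
    rcases hc.ep_cases (A := A) with ⟨e1, e2, e3⟩ | ⟨e1, e2, e3⟩ | ⟨e1, e2, e3⟩ <;>
      simp only [e1, e2, e3] at h hs ⊢ <;> grind

/-- The third vertical component. -/
lemma rho_diag_sum (hn : 1 ≤ n) {i j k : Fin 3} (hc : Cyc i j k) (X : H) :
    2 * (ep A i * G.rho i (G.xi i) (G.inc X) + ep A j * G.rho j (G.xi j) (G.inc X))
      = -G.D (G.inc X) G.sc - 2 * G.th i j (G.J k X) := by
  have n1 := hc.ne
  have h := G.kap_xi hn i j k X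
  rw [G.kap_ik hn hc, G.kap_ij hn hc.rot, G.rho_swap i (G.inc X), hc.sum, hc.sum, hc.sum] at h
  simp only [G.cc_self, G.cc_left hn n1.2.2.symm,
    G.cc_right hn n1.2.1.symm, G.cc_left hn n1.1, G.cc_right hn n1.1.symm,
    G.cc_cyc hn hc, G.cf_diag hn, G.D_ep_mul] at h
  rcases hc.ep_cases (A := A) with ⟨e1, e2, e3⟩ | ⟨e1, e2, e3⟩ | ⟨e1, e2, e3⟩ <;>
      simp only [e1, e2, e3] at h ⊢ <;> grind

/-- The horizontal part of the Bianchi identity for two Reeb vector fields. -/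
lemma RH_xi_xi (hn : 1 ≤ n) {i j k : Fin 3} (hc : Cyc i j k) (X : H) :
    G.RH (G.xi i) (G.xi j) X = G.nbtt (G.xi i) j X - G.nbtt (G.xi j) i X
      + G.hor (G.nbTor (G.inc X) (G.xi i) (G.xi j)) + (ep A k * G.sc) • G.tt k X
      - G.tt i (G.tt j X) + G.tt j (G.tt i X) := by
  have h := congrArg G.hor (G.bianchi (G.xi i) (G.xi j) (G.inc X))
  rw [G.tor_swap (G.inc X) (G.xi i), G.tor_xi_inc hn, G.tor_xi_inc hn, ← map_neg G.inc,
    G.tor_swap (G.inc _) (G.xi i), G.tor_swap (G.inc _) (G.xi j)] at h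
  simp only [map_add, hor_curv_xi, hor_nbTor_xi_inc, hor_nbTor_inc_xi, map_neg,
    hor_tor_eq, add_zero] at h
  have n1 := hc.ne
  have h2 : ∑ s, G.eta s (G.tor (G.xi i) (G.xi j)) • G.tt s X = (ep A k * G.sc) • G.tt k X := by
    have h3 : ∀ s, G.eta s (G.tor (G.xi i) (G.xi j)) = G.cc i j s := fun _ => rfl
    simp only [h3, hc.sum, G.cc_left hn n1.1, G.cc_right hn n1.1.symm, G.cc_cyc hn hc, zero_smul,
      zero_add]
  simp only [h2, G.eta_xi, ite_smul, one_smul, zero_smul, Finset.sum_ite_eq',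
    Finset.mem_univ, if_true] at h
  rw [RH_apply, h]
  abel

/-- The horizontal part of the Bianchi identity for one Reeb vector field. -/
lemma RH_xi_inc_cyclic (hn : 1 ≤ n) (i : Fin 3) (X Y : H) :
    G.RH (G.xi i) (G.inc X) Y - G.RH (G.xi i) (G.inc Y) X
      = G.nbtt (G.inc Y) i X - G.nbtt (G.inc X) i Y
        - ∑ s, (2 * ep A s * G.g (G.J s X) Y) • G.hor (G.tor (G.xi s) (G.xi i)) := by
  have h := congrArg G.hor (G.bianchi (G.inc X) (G.inc Y) (G.xi i))
  rw [G.tor_swap (G.inc Y) (G.xi i), G.tor_xi_inc hn, G.tor_xi_inc hn, ← map_neg G.inc,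
    G.curv_swap (G.inc Y) (G.xi i), tor_inc] at h
  simp only [map_add, hor_curv_xi, hor_nbTor_xi_inc, hor_nbTor_inc_xi, map_neg, nbTor_inc G hn,
    map_sum, map_smul, LinearMap.sum_apply, LinearMap.smul_apply,
    LinearMap.neg_apply, hor_tor_inc, add_zero, zero_add, neg_zero] at h
  simp only [RH_apply]
  have e : ∑ s, (2 * ep A s * G.g (G.J s X) Y) • G.hor (G.tor (G.xi s) (G.xi i))
      = -∑ s, (-2 * ep A s * G.g (G.J s X) Y) • G.hor (G.tor (G.xi s) (G.xi i)) := by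
    rw [← Finset.sum_neg_distrib]
    exact Finset.sum_congr rfl fun s _ => by rw [← neg_smul]; congr 1; ring
  rw [e, sub_neg_eq_add, ← sub_eq_zero]
  rw [← sub_eq_zero] at h
  rw [← h]
  abel

end Geo

namespace Geo

variable {n : ℕ} {A V H : Type*} [CommRing A] [Algebra ℝ A] [AddCommGroup V] [Module A V]
  [AddCommGroup H] [Module A H] (G : Geo n A V H)

/-! ### Covariant derivatives of horizontal two-tensors -/

lemma nbS_bil {S : H → H → A} (hS : IsBil S) (u : V) : IsBil (G.nbS S u) := by
  refine ⟨fun Y => ⟨fun X Z => ?_, fun f X => ?_⟩, fun X => ⟨fun Y Z => ?_, fun f Y => ?_⟩⟩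
  · simp only [nbS, nh_add, (hS.left _).add, G.D_add]; ring
  · simp only [nbS, nh_smul, (hS.left _).add, (hS.left _).smul, G.D_mul]; ring
  · simp only [nbS, nh_add, (hS.right _).add, G.D_add]; ring
  · simp only [nbS, nh_smul, (hS.right _).add, (hS.right _).smul, G.D_mul]; ring

lemma nbS_lin {S : H → H → A} (hS : IsBil S) (X Y : H) : IsLin (fun U => G.nbS S (G.inc U) X Y) := by
  refine ⟨fun u v => ?_, fun f u => ?_⟩
  · simp only [nbS, map_add, nh_add_left, (hS.left _).add, (hS.right _).add, G.D_add_left]; ring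
  · simp only [nbS, map_smul, nh_smul_left, (hS.left _).smul, (hS.right _).smul, G.D_smul_left]; ring

lemma nbS_symm {S : H → H → A} (hS : ∀ X Y, S X Y = S Y X) (u : V) (X Y : H) :
    G.nbS S u X Y = G.nbS S u Y X := by
  simp only [nbS, hS X Y, hS (G.nh u X) Y, hS X (G.nh u Y)]; ring

lemma nbS_mu_symm (hn : 1 ≤ n) (u : V) (X Y : H) : G.nbS G.mu u X Y = G.nbS G.mu u Y X :=
  G.nbS_symm (G.mu_symm hn) u X Y

lemma nbS_tau_symm (hn : 1 ≤ n) (u : V) (X Y : H) : G.nbS G.tau u X Y = G.nbS G.tau u Y X :=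
  G.nbS_symm (G.tau_symm hn) u X Y

lemma nbS_mu_J (hn : 1 ≤ n) (u : V) (s : Fin 3) (X Y : H) :
    G.nbS G.mu u (G.J s X) Y = -G.nbS G.mu u X (G.J s Y) := by
  have e1 : G.mu (∑ t, G.cf s t u • G.J t X) Y = ∑ t, G.cf s t u * G.mu (G.J t X) Y :=
    (G.mu_bil.left Y).sum _ _ _
  have e2 : G.mu X (∑ t, G.cf s t u • G.J t Y) = ∑ t, G.cf s t u * G.mu X (G.J t Y) :=
    (G.mu_bil.right X).sum _ _ _
  simp only [nbS, nh_J, (G.mu_bil.left _).add, (G.mu_bil.right _).add, e1, e2, G.mu_J hn,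
    G.D_neg, mul_neg, Finset.sum_neg_distrib]
  ring

lemma nbS_tau_average (hn : 1 ≤ n) (u : V) (X Y : H) :
    G.nbS G.tau u X Y = ∑ s, ep A s * G.nbS G.tau u (G.J s X) (G.J s Y) := by
  have h0 := congrArg (G.D u) (G.tau_average hn X Y)
  have h1 := G.tau_average hn (G.nh u X) Y
  have h2 := G.tau_average hn X (G.nh u Y)
  have e1 : ∀ s Z, G.tau (∑ t, G.cf s t u • G.J t X) Z = ∑ t, G.cf s t u * G.tau (G.J t X) Z :=
    fun s Z => (G.tau_bil.left Z).sum _ _ _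
  have e2 : ∀ s Z, G.tau Z (∑ t, G.cf s t u • G.J t Y) = ∑ t, G.cf s t u * G.tau Z (G.J t Y) :=
    fun s Z => (G.tau_bil.right Z).sum _ _ _
  have c0 := G.cf_skew hn (i := 0) (j := 1) (k := 2) ⟨rfl, rfl⟩ u
  have c1 := G.cf_skew hn (i := 1) (j := 2) (k := 0) ⟨rfl, rfl⟩ u
  have c2 := G.cf_skew hn (i := 2) (j := 0) (k := 1) ⟨rfl, rfl⟩ u
  simp only [D_sum, D_ep_mul] at h0
  simp only [nbS, nh_J, (G.tau_bil.left _).add, (G.tau_bil.right _).add, e1, e2]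
  simp only [Fin.sum_univ_three, G.cf_diag hn, ep_zero, ep_one, ep_two] at *
  linear_combination h0 - h1 - h2
    + (G.tau (G.J 1 X) (G.J 0 Y) + G.tau (G.J 0 X) (G.J 1 Y)) * c0
    - (G.tau (G.J 2 X) (G.J 1 Y) + G.tau (G.J 1 X) (G.J 2 Y)) * c1
    - (G.tau (G.J 2 X) (G.J 0 Y) + G.tau (G.J 0 X) (G.J 2 Y)) * (c2)

/-- Metric contraction commutes with covariant differentiation although the frame is not parallel.
-/
lemma tr_nbS {S : H → H → A} (hS : IsBil S) (u : V) : G.tr (G.nbS S u) = G.D u (G.tr S) := by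
  -- The norms of the frame square to one, so their derivatives vanish.
  have hD : ∀ a, G.D u (G.g (G.e a) (G.e a)) = 0 := by
    intro a
    have h := congrArg (G.D u) (G.sgn_sq a)
    rw [← map_one (algebraMap ℝ A), G.D_const, G.D_mul] at h
    refine two_cancel ?_
    linear_combination G.g (G.e a) (G.e a) * h - 2 * G.D u (G.g (G.e a) (G.e a)) * G.sgn_sq a
  have hex : ∀ X Y, ∑ a, G.g (G.e a) (G.e a) * (G.g X (G.e a) * G.g (G.e a) Y) = G.g X Y := by
    intro X Y
    conv_rhs => rw [G.expand X]
    simp [mul_assoc]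
  -- Differentiating the expansion of g in the frame shows that the inverse metric ∑ g(e_a, e_a) e_a
  -- ⊗ e_a is parallel.
  have hdel : ∀ X Y, ∑ a, G.g (G.e a) (G.e a) * (G.g X (G.nh u (G.e a)) * G.g (G.e a) Y
      + G.g X (G.e a) * G.g (G.nh u (G.e a)) Y) = 0 := by
    intro X Y
    have h := congrArg (G.D u) (hex X Y)
    simp only [D_sum, G.D_mul, hD, D_g] at h
    rw [← hex (G.nh u X) Y, ← hex X (G.nh u Y), ← Finset.sum_add_distrib, ← sub_eq_zero,
      ← Finset.sum_sub_distrib] at h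
    rw [← h]
    exact Finset.sum_congr rfl fun a _ => by ring
  have hSS : ∀ X Y, S X Y = ∑ b, ∑ c, (G.g (G.e b) (G.e b) * G.g (G.e c) (G.e c) * S (G.e b) (G.e c))
      * (G.g X (G.e b) * G.g Y (G.e c)) := by
    intro X Y
    conv_lhs => rw [G.expand X, (hS.left Y).sum]
    refine Finset.sum_congr rfl fun b _ => ?_
    conv_lhs => rw [G.expand Y, (hS.right _).sum]
    rw [Finset.mul_sum]
    exact Finset.sum_congr rfl fun c _ => by ring
  have key : ∑ a, G.g (G.e a) (G.e a) * (S (G.nh u (G.e a)) (G.e a) + S (G.e a) (G.nh u (G.e a))) = 0 := by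
    have h3 : ∀ a, G.g (G.e a) (G.e a) * (S (G.nh u (G.e a)) (G.e a) + S (G.e a) (G.nh u (G.e a)))
        = ∑ b, ∑ c, (G.g (G.e b) (G.e b) * G.g (G.e c) (G.e c) * S (G.e b) (G.e c))
          * (G.g (G.e a) (G.e a) * (G.g (G.e b) (G.nh u (G.e a)) * G.g (G.e a) (G.e c)
            + G.g (G.e b) (G.e a) * G.g (G.nh u (G.e a)) (G.e c))) := by
      intro a
      rw [hSS (G.nh u (G.e a)), hSS (G.e a), ← Finset.sum_add_distrib, Finset.mul_sum]
      refine Finset.sum_congr rfl fun b _ => ?_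
      rw [← Finset.sum_add_distrib, Finset.mul_sum]
      refine Finset.sum_congr rfl fun c _ => ?_
      rw [G.g_symm (G.e b) (G.nh u (G.e a)), G.g_symm (G.e b) (G.e a)]; ring
    rw [Finset.sum_congr rfl fun a _ => h3 a, Finset.sum_comm]
    refine Finset.sum_eq_zero fun b _ => ?_
    rw [Finset.sum_comm]
    refine Finset.sum_eq_zero fun c _ => ?_
    rw [← Finset.mul_sum, hdel, mul_zero]
  simp only [PQModule.tr, nbS, D_sum, G.D_mul, hD] at key ⊢
  rw [← sub_eq_zero, ← Finset.sum_sub_distrib, ← neg_eq_zero, ← Finset.sum_neg_distrib]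
  refine Eq.trans ?_ key
  exact Finset.sum_congr rfl fun a _ => by ring

/-! ### The curvature of a Reeb and a horizontal vector field -/

lemma g_hor_tor_sum (i : Fin 3) (f : Fin 3 → A) (Z : H) :
    G.g (∑ s, f s • G.hor (G.tor (G.xi s) (G.xi i))) Z = ∑ s, f s * G.th s i Z := by
  simp only [map_sum, LinearMap.sum_apply, map_smul, LinearMap.smul_apply, smul_eq_mul, th]

/-- The Koszul argument: the tensor R(ξ_i, X, Y, Z) is skew in Y, Z, and `RH_xi_inc_cyclic` gives
its skew part in X, Y. The combination of three permuted copies with signs +, +, - isolates it. The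
derivatives of τ along X cancel by symmetry. -/
lemma four_R_xi_inc (hn : 1 ≤ n) {i j k : Fin 3} (hc : Cyc i j k) (X Y Z : H) :
    4 * G.g (G.RH (G.xi i) (G.inc X) Y) Z
      = -4 * G.nbS G.mu (G.inc X) (G.J i Y) Z
        - (G.nbS G.tau (G.inc Y) (G.J i Z) X + G.nbS G.tau (G.inc Y) Z (G.J i X))
        + (G.nbS G.tau (G.inc Z) (G.J i Y) X + G.nbS G.tau (G.inc Z) Y (G.J i X))
        + 4 * (ep A j * G.g (G.J j X) Y * G.th i j Z - ep A k * G.g (G.J k X) Y * G.th k i Z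
          - ep A j * G.g (G.J j X) Z * G.th i j Y + ep A k * G.g (G.J k X) Z * G.th k i Y
          - ep A j * G.g (G.J j Y) Z * G.th i j X + ep A k * G.g (G.J k Y) Z * G.th k i X) := by
  have C : ∀ X Y Z, 4 * (G.g (G.RH (G.xi i) (G.inc X) Y) Z - G.g (G.RH (G.xi i) (G.inc Y) X) Z)
      = 4 * G.g (G.nbtt (G.inc Y) i X) Z - 4 * G.g (G.nbtt (G.inc X) i Y) Z
        + 8 * (ep A j * G.g (G.J j X) Y * G.th i j Z - ep A k * G.g (G.J k X) Y * G.th k i Z) := by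
    intro X Y Z
    have h := congrArg (fun W => G.g W Z) (G.RH_xi_inc_cyclic hn i X Y)
    simp only [map_sub, LinearMap.sub_apply, g_hor_tor_sum] at h
    simp only [hc.sum, th_self] at h
    rw [G.th_swap j i] at h
    linear_combination 4 * h
  have c1 := C X Y Z
  have c2 := C Y Z X
  have c3 := C Z X Y
  simp only [G.g_nbtt hn] at c1 c2 c3
  have s := fun X Y Z => G.g_RH (G.xi i) (G.inc X) Y Z
  have s1 := s X Z Y
  have s2 := s Y X Z
  have s3 := s Z X Y
  rw [G.g_symm Z] at s1
  rw [G.g_symm X] at s2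
  rw [G.g_symm X] at s3
  have m := G.nbS_mu_symm hn
  have mJ := G.nbS_mu_J hn
  have t := G.nbS_tau_symm hn
  have w : ∀ s X Y, G.g (G.J s X) Y = -G.g (G.J s Y) X := fun s X Y => by
    rw [G.g_J, G.g_symm]
  have m1 := mJ (G.inc X) i Z Y
  rw [m _ Z] at m1
  have m2 := mJ (G.inc Y) i X Z
  rw [m _ X] at m2
  have m3 := mJ (G.inc Z) i X Y
  rw [m _ X] at m3
  have t1 := t (G.inc X) (G.J i Y) Z
  have t2 := t (G.inc X) Y (G.J i Z)
  have t3 := t (G.inc Y) (G.J i X) Z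
  have t4 := t (G.inc Y) X (G.J i Z)
  have t5 := t (G.inc Z) (G.J i X) Y
  have t6 := t (G.inc Z) X (G.J i Y)
  have w1 := w j Z X
  have w2 := w k Z X
  rw [w1, w2] at c3
  refine two_inj ?_
  linear_combination c1 + c3 - c2 + 4 * s1 + 4 * s2 - 4 * s3 + 4 * m1 + 4 * m2 - 4 * m3
    + t1 + t2 - t3 - t4 + t5 + t6

lemma rho_J_xi (hn : 1 ≤ n) {i j k : Fin 3} (hc : Cyc i j k) (Z : H) :
    G.rho k (G.inc (G.J i Z)) (G.xi i) = ep A j * G.th i j Z ∧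
      G.rho j (G.inc (G.J i Z)) (G.xi i) = ep A k * G.th k i Z := by
  have h1 := (G.rho_mixed hn hc (G.J i Z)).1
  have h2 := (G.rho_mixed hn hc.rot.rot (G.J i Z)).2
  rw [G.J_sq, th_smul] at h1 h2
  rw [h1, h2]
  rcases hc.ep_cases (A := A) with ⟨e1, e2, e3⟩ | ⟨e1, e2, e3⟩ | ⟨e1, e2, e3⟩ <;>
      simp only [e1, e2, e3] <;> constructor <;> ring

/-- The curvature `R(ξ_i, X, Y, Z)`. -/
theorem R_xi_inc (hn : 1 ≤ n) {i j k : Fin 3} (hc : Cyc i j k) (X Y Z : H) :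
    4 * G.g (G.RH (G.xi i) (G.inc X) Y) Z
      = -4 * G.nbS G.mu (G.inc X) (G.J i Y) Z
        - (G.nbS G.tau (G.inc Y) (G.J i Z) X + G.nbS G.tau (G.inc Y) Z (G.J i X))
        + (G.nbS G.tau (G.inc Z) (G.J i Y) X + G.nbS G.tau (G.inc Z) Y (G.J i X))
        + 4 * (G.g (G.J j X) Y * G.rho k (G.inc (G.J i Z)) (G.xi i)
          - G.g (G.J k X) Y * G.rho j (G.inc (G.J i Z)) (G.xi i)
          - G.g (G.J j X) Z * G.rho k (G.inc (G.J i Y)) (G.xi i)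
          + G.g (G.J k X) Z * G.rho j (G.inc (G.J i Y)) (G.xi i)
          - G.g (G.J j Y) Z * G.rho k (G.inc (G.J i X)) (G.xi i)
          + G.g (G.J k Y) Z * G.rho j (G.inc (G.J i X)) (G.xi i)) := by
  rw [G.four_R_xi_inc hn hc]
  simp only [(G.rho_J_xi hn hc _).1, (G.rho_J_xi hn hc _).2]
  ring

/-! ### The curvature of two Reeb vector fields -/

lemma rho_add_left (s : Fin 3) (u v w : V) : G.rho s (u + v) w = G.rho s u w + G.rho s v w := by
  simp only [rho, RH_apply, map_add, LinearMap.add_apply, G.tr_add, mul_add]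

lemma rho_smul_left (s : Fin 3) (f : A) (u w : V) : G.rho s (f • u) w = f * G.rho s u w := by
  simp only [rho, RH_apply, map_smul, LinearMap.smul_apply, smul_eq_mul, G.tr_mul]; ring

lemma rho_add_right (s : Fin 3) (u v w : V) : G.rho s w (u + v) = G.rho s w u + G.rho s w v := by
  rw [rho_swap, rho_add_left, G.rho_swap s u, G.rho_swap s v]; ring

lemma rho_smul_right (s : Fin 3) (f : A) (u w : V) : G.rho s w (f • u) = f * G.rho s w u := by
  rw [rho_swap, rho_smul_left, G.rho_swap s u]; ring

/-- The covariant derivative of the Ricci two-forms. -/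
def nbRho (s : Fin 3) (u v w : V) : A :=
  G.D u (G.rho s v w) - G.rho s (G.nb u v) w - G.rho s v (G.nb u w) - ∑ t, G.cf s t u * G.rho t v w

/-- The value ρ_k(I_iZ, ξ_i) is ε_j times the Z-component of T(ξ_i, ξ_j). Differentiating this
relation creates further values of ρ through the rotation of I_i, ξ_i and I_k; they match the
rotation terms of ∇T. -/
lemma nbRho_eq (hn : 1 ≤ n) {i j k : Fin 3} (hc : Cyc i j k) (X Y : H) :
    ep A j * G.nbRho k (G.inc X) (G.inc (G.J i Y)) (G.xi i)
      = G.g (G.hor (G.nbTor (G.inc X) (G.xi i) (G.xi j))) Y := by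
  have h1 : G.g (G.hor (G.nbTor (G.inc X) (G.xi i) (G.xi j))) Y
      = G.D (G.inc X) (G.th i j Y) - G.th i j (G.nh (G.inc X) Y)
        - (∑ t, G.cf i t (G.inc X) * G.th t j Y) - ∑ t, G.cf j t (G.inc X) * G.th i t Y := by
    have h := G.D_g (G.inc X) (G.hor (G.tor (G.xi i) (G.xi j))) Y
    rw [nbTor, G.nb_xi _ i, G.nb_xi _ j]
    simp only [map_sub, hor_nb, map_sum, map_smul, LinearMap.sub_apply, LinearMap.sum_apply,
      LinearMap.smul_apply, smul_eq_mul, th] at h ⊢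
    linear_combination -h
  have r := fun Z => (G.rho_J_xi hn hc Z).1
  have rj := G.rho_mixed hn hc (G.J j Y)
  have rk := G.rho_mixed hn hc (G.J k Y)
  have ri := G.rho_mixed hn hc (G.J i Y)
  have rr := (G.rho_J_xi hn hc Y).2
  have d1 := G.rho_diag_sum hn hc (G.J i Y)
  have d2 := G.rho_diag_sum hn hc.rot (G.J i Y)
  rw [G.rho_swap i, G.rho_swap j] at d1
  rw [G.rho_swap k, G.rho_swap j] at d2
  rw [G.J_ij hc, G.J_sq, th_smul, th_smul] at rj
  rw [G.J_ji hc.rot.rot, G.J_ij hc.rot, th_smul, th_smul] at rk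
  rw [G.J_sq, G.J_ji hc, th_smul, th_smul] at ri
  rw [G.J_ij hc.rot.rot, th_smul] at d1
  rw [G.J_sq, th_smul] at d2
  have a1 := G.cf_skew hn hc (G.inc X)
  have a2 := G.cf_skew hn hc.rot (G.inc X)
  have a3 := G.cf_skew hn hc.rot.rot (G.inc X)
  have t1 := G.th_swap k j Y
  have t2 := G.th_swap i k Y
  rw [h1, nbRho, r, G.nb_xi, ← inc_nh, nh_J]
  simp only [hc.sum, map_add, map_smul, rho_add_left, rho_add_right, rho_smul_left, rho_smul_right, r,
    G.cf_diag hn, th_self, D_ep_mul, rr, rj, ri, rk]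
  -- Values of ρ with repeated index are not single torsion components. Only the difference of two
  -- instances of `rho_diag_sum` is needed, and in it the derivative of `sc` cancels.
  have dd : G.cf i k (G.inc X) * (2 * (ep A i * -G.rho i (G.inc (G.J i Y)) (G.xi i)
      + ep A j * -G.rho j (G.inc (G.J i Y)) (G.xi j)) - 2 * (ep A j * -G.rho j (G.inc (G.J i Y)) (G.xi j)
      + ep A k * -G.rho k (G.inc (G.J i Y)) (G.xi k))) = G.cf i k (G.inc X) *
      (2 * (ep A i * G.th j k Y) + 2 * (ep A j * G.th i j (G.J j Y))) := by
    rw [d1, d2]; ring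
  refine two_inj ?_
  rcases hc.ep_cases (A := A) with ⟨e1, e2, e3⟩ | ⟨e1, e2, e3⟩ | ⟨e1, e2, e3⟩ <;>
    simp only [e1, e2, e3, t1, t2] at dd a1 a2 a3 rr ri rj rk ⊢ <;> grind

/-- The curvature `R(ξ_i, ξ_j, X, Y)`. -/
theorem R_xi_xi (hn : 1 ≤ n) {i j k : Fin 3} (hc : Cyc i j k) (X Y : H) :
    4 * G.g (G.RH (G.xi i) (G.xi j) X) Y
      = 4 * G.nbS G.mu (G.xi i) (G.J j X) Y - 4 * G.nbS G.mu (G.xi j) (G.J i X) Y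
        + 4 * ep A j * G.nbRho k (G.inc X) (G.inc (G.J i Y)) (G.xi i)
        - (G.nbS G.tau (G.xi i) (G.J j X) Y + G.nbS G.tau (G.xi i) X (G.J j Y))
        + (G.nbS G.tau (G.xi j) (G.J i X) Y + G.nbS G.tau (G.xi j) X (G.J i Y))
        + 4 * ep A k * G.sc * G.TT k X Y
        - 4 * G.tr (fun Z W => G.TT j X Z * G.TT i W Y)
        + 4 * G.tr (fun Z W => G.TT j Z Y * G.TT i X W) := by
  have h := congrArg (fun Z => G.g Z Y) (G.RH_xi_xi hn hc X)
  simp only [map_add, map_sub, map_smul, LinearMap.add_apply, LinearMap.sub_apply,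
    LinearMap.smul_apply, smul_eq_mul, ← G.nbRho_eq hn hc] at h
  have t1 : G.tr (fun Z W => G.TT j X Z * G.TT i W Y) = G.g (G.tt i (G.tt j X)) Y :=
    G.tr_g (fun W => G.TT i W Y) ((G.TT_bil' i).left Y) (G.tt j X)
  have t2 : G.tr (fun Z W => G.TT j Z Y * G.TT i X W) = G.g (G.tt j (G.tt i X)) Y := by
    refine Eq.trans ?_ (G.tr_g (fun W => G.TT j W Y) ((G.TT_bil' j).left Y) (G.tt i X))
    simp only [PQModule.tr, TT, mul_comm]
  have h1 := G.g_nbtt hn (G.xi i) j X Y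
  have h2 := G.g_nbtt hn (G.xi j) i X Y
  rw [t1, t2, TT]
  linear_combination 4 * h + h1 - h2

end Geo

lemma IsLin.comp {A H : Type*} [CommRing A] [AddCommGroup H] [Module A H] {l : H → A}
    (hl : IsLin l) (f : H →ₗ[A] H) : IsLin fun X => l (f X) :=
  ⟨fun X Y => by rw [map_add, hl.add], fun c X => by rw [map_smul, hl.smul]⟩

namespace Geo

variable {n : ℕ} {A V H : Type*} [CommRing A] [Algebra ℝ A] [AddCommGroup V] [Module A V]
  [AddCommGroup H] [Module A H] (G : Geo n A V H)

/-! ### Divergences and the mixed Ricci two-forms -/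

/-- The divergence of a horizontal two-tensor. -/
def divS (S : H → H → A) (X : H) : A := G.tr fun Y Z => G.nbS S (G.inc Y) Z X

/-- The twisted divergence of a horizontal two-tensor. -/
def divJ (s : Fin 3) (S : H → H → A) (X : H) : A :=
  G.tr fun Y Z => G.nbS S (G.inc Y) (G.J s Z) (G.J s X)

lemma nbS_bil_left {S : H → H → A} (hS : IsBil S) (W : H) :
    IsBil (fun Y Z => G.nbS S (G.inc Y) Z W) :=
  ⟨fun Z => G.nbS_lin hS Z W, fun Y => (G.nbS_bil hS (G.inc Y)).left W⟩

lemma tr_nbS_tau_J (hn : 1 ≤ n) (u : V) (s : Fin 3) :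
    G.tr (fun Y Z => G.nbS G.tau u (G.J s Y) Z) = 0 := by
  have h := G.tr_J _ (G.nbS_bil G.tau_bil u) s
  have h2 : G.tr (fun Y Z => G.nbS G.tau u Y (G.J s Z)) = G.tr (fun Y Z => G.nbS G.tau u (G.J s Y) Z) := by
    rw [← G.tr_swap (fun Y Z => G.nbS G.tau u (G.J s Y) Z)]
    exact congrArg G.tr (by funext Y Z; exact G.nbS_tau_symm hn u _ _)
  rw [h2] at h
  exact two_cancel (by linear_combination h)

lemma divJ_sum (hn : 1 ≤ n) (X : H) : ∑ s, ep A s * G.divJ s G.tau X = G.divS G.tau X := by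
  have h : ∀ Y Z, G.nbS G.tau (G.inc Y) Z X = ep A 0 * G.nbS G.tau (G.inc Y) (G.J 0 Z) (G.J 0 X)
      + ep A 1 * G.nbS G.tau (G.inc Y) (G.J 1 Z) (G.J 1 X)
      + ep A 2 * G.nbS G.tau (G.inc Y) (G.J 2 Z) (G.J 2 X) := fun Y Z => by
    rw [G.nbS_tau_average hn, Fin.sum_univ_three]
  simp only [divS, h, G.tr_add, G.tr_mul, Fin.sum_univ_three]
  rfl

lemma tr_g_J (s : Fin 3) (l : H → A) (hl : IsLin l) (X : H) :
    G.tr (fun Y Z => G.g (G.J s Y) X * l Z) = -l (G.J s X) := by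
  simp only [G.g_J, neg_mul, G.tr_neg, G.tr_g' l hl]

lemma th_J_lin (i j s : Fin 3) : IsLin (fun Z => G.th i j (G.J s Z)) :=
  ⟨fun X Y => by simp only [map_add, th_add], fun f X => by simp only [map_smul, th_smul]⟩

lemma tr_g_J_J {i j k : Fin 3} (hc : Cyc i j k) :
    G.tr (fun Y Z => G.g (G.J j Y) (G.J i Z)) = 0 ∧ G.tr (fun Y Z => G.g (G.J i Y) (G.J j Z)) = 0 := by
  have h : ∀ Y Z, G.g (G.J j Y) (G.J i Z) = ep A k * G.g (G.J k Y) Z := fun Y Z => by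
    have := G.g_J i (G.J j Y) Z
    rw [G.J_ij hc] at this
    simp only [map_smul, LinearMap.smul_apply, smul_eq_mul] at this
    linear_combination this
  have h1 : G.tr (fun Y Z => G.g (G.J j Y) (G.J i Z)) = 0 := by
    simp only [h, G.tr_mul, G.tr_omega, mul_zero]
  refine ⟨h1, ?_⟩
  rw [← h1, ← G.tr_swap]
  simp only [G.g_symm]

/-- Contracting the last two slots of `four_R_xi_inc` with J_i recovers ρ_i on the left. The μ-term
drops out because μ is trace-free. -/
lemma rho_diag_trace (hn : 1 ≤ n) {i j k : Fin 3} (hc : Cyc i j k) (X : H) :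
    16 * n * G.rho i (G.xi i) (G.inc X) = -2 * (ep A i * G.divS G.tau X + G.divJ i G.tau X)
      + 8 * ep A i * (G.th k i (G.J j X) + G.th i j (G.J k X)) := by
  have h : ∀ Y Z, 4 * G.g (G.RH (G.xi i) (G.inc X) Y) (G.J i Z)
      = -4 * G.nbS G.mu (G.inc X) (G.J i Y) (G.J i Z)
        - (ep A i * G.nbS G.tau (G.inc Y) Z X + G.nbS G.tau (G.inc Y) (G.J i Z) (G.J i X))
        + (G.nbS G.tau (G.inc (G.J i Z)) (G.J i Y) X + G.nbS G.tau (G.inc (G.J i Z)) Y (G.J i X))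
        + 4 * (ep A j * (G.g (G.J j X) Y * G.th i j (G.J i Z))
          - ep A k * (G.g (G.J k X) Y * G.th k i (G.J i Z))
          + ep A j * (G.g (G.J i (G.J j X)) Z * G.th i j Y)
          - ep A k * (G.g (G.J i (G.J k X)) Z * G.th k i Y)
          - ep A j * (G.g (G.J j Y) (G.J i Z) * G.th i j X)
          + ep A k * (G.g (G.J k Y) (G.J i Z) * G.th k i X)) := by
    intro Y Z
    rw [G.four_R_xi_inc hn hc, G.g_J i (G.J j X), G.g_J i (G.J k X), G.J_sq,
      ((G.nbS_bil G.tau_bil _).left _).smul]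
    ring
  have h' := congrArg G.tr (funext fun Y => funext fun Z => h Y Z)
  have b := G.nbS_bil_left G.tau_bil
  have m1 : G.tr (fun Y Z => G.nbS G.mu (G.inc X) (G.J i Y) (G.J i Z)) = 0 := by
    rw [G.tr_J_J _ (G.nbS_bil G.mu_bil _), G.tr_nbS G.mu_bil, tr_mu, D_zero, mul_zero]
  have t1 : G.tr (fun Y Z => G.nbS G.tau (G.inc (G.J i Z)) (G.J i Y) X) = -ep A i * G.divS G.tau X :=
    G.tr_J_J _ (b X) i
  have t2 : G.tr (fun Y Z => G.nbS G.tau (G.inc (G.J i Z)) Y (G.J i X)) = -G.divJ i G.tau X :=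
    G.tr_J _ (b (G.J i X)) i
  have s : ∀ (l : H → A) (hl : IsLin l) (W : H), G.tr (fun Y Z => G.g W Z * l Y) = l W :=
    fun l hl W => G.tr_g l hl W
  simp only [G.tr_add, G.tr_sub, G.tr_mul, G.tr_mul', ← G.four_n_rho hn, m1, t1, t2,
    G.tr_g _ (G.th_J_lin _ _ _), s _ (G.th_lin _ _), (G.tr_g_J_J hc).1, (G.tr_g_J_J hc.rot.rot).2,
    G.J_ij hc, G.J_ji hc.rot.rot, th_smul] at h'
  simp only [divS, divJ] at h' ⊢
  rcases hc.ep_cases (A := A) with ⟨e1, e2, e3⟩ | ⟨e1, e2, e3⟩ | ⟨e1, e2, e3⟩ <;>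
    simp only [e1, e2, e3] at h' ⊢ <;> linear_combination h'

/-- The contraction of `R(ξ_i, X, Y, Z)` in `X` and `Y`. -/
lemma tr_R_xi (hn : 1 ≤ n) {i j k : Fin 3} (hc : Cyc i j k) (W : H) :
    4 * G.tr (fun Y Z => G.g (G.RH (G.xi i) (G.inc Y) Z) (G.J i W))
      = 4 * ep A i * G.divS G.mu W - (ep A i * G.divS G.tau W + G.divJ i G.tau W)
        - 8 * ep A i * (G.th k i (G.J j W) + G.th i j (G.J k W)) := by
  have h : ∀ Y Z, 4 * G.g (G.RH (G.xi i) (G.inc Y) Z) (G.J i W)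
      = 4 * (ep A i * G.nbS G.mu (G.inc Y) Z W)
        - (ep A i * G.nbS G.tau (G.inc Z) W Y + G.nbS G.tau (G.inc Z) (G.J i W) (G.J i Y))
        + (G.nbS G.tau (G.inc (G.J i W)) (G.J i Z) Y + G.nbS G.tau (G.inc (G.J i W)) Z (G.J i Y))
        + 4 * (ep A j * (G.g (G.J j Y) Z * G.th i j (G.J i W))
          - ep A k * (G.g (G.J k Y) Z * G.th k i (G.J i W))
          - ep A j * (G.g (G.J j Y) (G.J i W) * G.th i j Z)
          + ep A k * (G.g (G.J k Y) (G.J i W) * G.th k i Z)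
          - ep A j * (G.g (G.J j Z) (G.J i W) * G.th i j Y)
          + ep A k * (G.g (G.J k Z) (G.J i W) * G.th k i Y)) := by
    intro Y Z
    rw [G.four_R_xi_inc hn hc, G.nbS_mu_J hn, G.J_sq, ((G.nbS_bil G.tau_bil _).left _).smul,
      ((G.nbS_bil G.mu_bil _).right _).smul]
    ring
  have h' := congrArg G.tr (funext fun Y => funext fun Z => h Y Z)
  have t1 : G.tr (fun Y Z => G.nbS G.tau (G.inc Z) W Y) = G.divS G.tau W := by
    simp only [G.nbS_tau_symm hn _ W]; rfl
  have t2 : G.tr (fun Y Z => G.nbS G.tau (G.inc Z) (G.J i W) (G.J i Y)) = G.divJ i G.tau W := by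
    simp only [G.nbS_tau_symm hn _ (G.J i W)]; rfl
  have t3 : G.tr (fun Y Z => G.nbS G.tau (G.inc (G.J i W)) (G.J i Z) Y) = 0 :=
    G.tr_nbS_tau_J hn _ i
  have t4 : G.tr (fun Y Z => G.nbS G.tau (G.inc (G.J i W)) Z (G.J i Y)) = 0 := by
    simp only [G.nbS_tau_symm hn _ _ (G.J i _)]; exact t3
  have s : ∀ (s : Fin 3) (l : H → A) (hl : IsLin l) (W : H),
      G.tr (fun Y Z => G.g (G.J s Z) W * l Y) = -l (G.J s W) :=
    fun s l hl W => G.tr_g_J s l hl W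
  simp only [G.tr_add, G.tr_sub, G.tr_mul, G.tr_mul', t1, t2, t3, t4, G.tr_omega,
    G.tr_g_J _ _ (G.th_lin _ _), s _ _ (G.th_lin _ _),
    G.J_ij hc.rot.rot, G.J_ji hc, th_smul] at h'
  simp only [divS, divJ] at h' ⊢
  rcases hc.ep_cases (A := A) with ⟨e1, e2, e3⟩ | ⟨e1, e2, e3⟩ | ⟨e1, e2, e3⟩ <;>
    simp only [e1, e2, e3] at h' ⊢ <;> linear_combination h'

/-- The trace of R(ξ_i, e_a, J_j e_a, J_jJ_iW) is computed twice: from `four_R_xi_inc`, and by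
pulling J_j out of the curvature so that `tr_R_xi` applies. Comparing the results gives a relation
independent of the direct contraction. -/
lemma divS_mu_eq (hn : 1 ≤ n) {i j k : Fin 3} (hc : Cyc i j k) (W : H) :
    8 * G.divS G.mu W = ep A j * G.divJ j G.tau W - ep A k * G.divJ k G.tau W + G.divS G.tau W
      + ep A i * G.divJ i G.tau W - 16 * n * G.th i j (G.J k W) + 8 * G.th k i (G.J j W)
      + 8 * ep A i * G.rho i (G.xi i) (G.inc W) := by
  have hJ : G.J i (G.J j (G.J i W)) = -ep A i • G.J j W := by
    rw [G.J_ji hc, map_smul, G.J_ji hc.rot.rot, smul_smul]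
    rcases hc.ep_cases (A := A) with ⟨e1, e2, e3⟩ | ⟨e1, e2, e3⟩ | ⟨e1, e2, e3⟩ <;>
      simp only [e1, e2, e3] <;> congr 1 <;> ring
  have hJ2 : G.J j (G.J i W) = ep A k • G.J k W := G.J_ji hc W
  have b := G.nbS_bil_left G.tau_bil
  have h : ∀ Y Z, 4 * G.g (G.RH (G.xi i) (G.inc Y) (G.J j Z)) (G.J j (G.J i W))
      = -4 * (ep A k * G.nbS G.mu (G.inc Y) Z W)
        - (-ep A i * G.nbS G.tau (G.inc (G.J j Z)) Y (G.J j W)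
          + ep A k * G.nbS G.tau (G.inc (G.J j Z)) (G.J i Y) (G.J k W))
        + (-G.nbS G.tau (G.inc (G.J k W)) (G.J k Z) Y
          + ep A k * G.nbS G.tau (G.inc (G.J k W)) (G.J j Z) (G.J i Y))
        + 4 * (-(G.g Y Z * (ep A k * G.th i j (G.J k W)))
          - G.g (G.J k Y) (G.J j Z) * G.th k i (G.J k W)
          - ep A j * ep A k * (G.g (G.J j Y) (G.J k W) * G.th i j (G.J j Z))
          - ep A k * (G.g Y W * G.th k i (G.J j Z))
          - ep A k * (G.g (G.J k W) Z * G.th i j Y)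
          + ep A k * (G.g (G.J j W) Z * G.th k i Y)) := by
    intro Y Z
    have e1 : G.g (G.J j Z) W = -G.g (G.J j W) Z := by
      rw [G.g_J, G.g_symm Z]
    have e2 : ∀ (f : A) P Q, G.nbS G.tau (f • G.inc (G.J k W)) P Q
        = f * G.nbS G.tau (G.inc (G.J k W)) P Q := fun f P Q => by
      rw [← map_smul, (G.nbS_lin G.tau_bil P Q).smul]
    rw [G.four_R_xi_inc hn hc, hJ, hJ2, G.J_ij hc Z, G.J_sq,
      G.nbS_tau_symm hn (G.inc (G.J j Z)) Y, G.nbS_tau_symm hn (G.inc (G.J j Z)) (G.J i Y)]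
    simp only [map_smul, LinearMap.smul_apply, smul_eq_mul, G.g_J_J, th_smul, e1, e2, ((G.nbS_bil G.tau_bil _).left _).smul,
      ((G.nbS_bil G.mu_bil _).left _).smul,
      ((G.nbS_bil G.mu_bil _).right _).smul, G.nbS_mu_J hn, G.J_sq, G.g_symm Z]
    rcases hc.ep_cases (A := A) with ⟨e1, e2, e3⟩ | ⟨e1, e2, e3⟩ | ⟨e1, e2, e3⟩ <;>
      simp only [e1, e2, e3] <;> ring
  have h' := congrArg G.tr (funext fun Y => funext fun Z => h Y Z)
  have t1 : G.tr (fun Y Z => G.nbS G.tau (G.inc (G.J j Z)) Y (G.J j W)) = -G.divJ j G.tau W :=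
    G.tr_J _ (b (G.J j W)) j
  have t2 : G.tr (fun Y Z => G.nbS G.tau (G.inc (G.J j Z)) (G.J i Y) (G.J k W)) = ep A k * G.divJ k G.tau W := by
    have hb : IsBil (fun Y Z => G.nbS G.tau (G.inc Y) (G.J i Z) (G.J k W)) :=
      ⟨fun Z => G.nbS_lin G.tau_bil _ _, fun Y => ((b (G.J k W)).right Y).comp (G.J i)⟩
    refine (G.tr_J _ hb j).trans ?_
    simp only [G.J_ij hc, ((G.nbS_bil G.tau_bil _).left _).smul, G.tr_mul, divJ]
    ring
  have t3 : G.tr (fun Y Z => G.nbS G.tau (G.inc (G.J k W)) (G.J k Z) Y) = 0 :=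
    G.tr_nbS_tau_J hn _ k
  have t4 : G.tr (fun Y Z => G.nbS G.tau (G.inc (G.J k W)) (G.J j Z) (G.J i Y)) = 0 := by
    have hb : IsBil (fun Y Z => G.nbS G.tau (G.inc (G.J k W)) Y (G.J i Z)) :=
      ⟨fun Z => (G.nbS_bil G.tau_bil _).left _, fun Y => ((G.nbS_bil G.tau_bil _).right Y).comp (G.J i)⟩
    refine (G.tr_J _ hb j).trans ?_
    simp only [G.J_ij hc, ((G.nbS_bil G.tau_bil _).right _).smul, G.tr_mul,
      G.nbS_tau_symm hn _ _ (G.J k _)]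
    rw [G.tr_swap (fun Y Z => G.nbS G.tau (G.inc (G.J k W)) (G.J k Y) Z), G.tr_nbS_tau_J hn]
    ring
  have s : ∀ (l : H → A) (hl : IsLin l) (W : H), G.tr (fun Y Z => G.g W Z * l Y) = l W :=
    fun l hl W => G.tr_g l hl W
  -- The second computation: commuting J_j past the curvature costs κ_jk and κ_ji, which are
  -- converted into ρ_i and a component of T(ξ_i, ξ_j).
  have hL : 4 * G.tr (fun Y Z => G.g (G.RH (G.xi i) (G.inc Y) (G.J j Z)) (G.J j (G.J i W)))
      = -ep A j * (4 * G.tr (fun Y Z => G.g (G.RH (G.xi i) (G.inc Y) Z) (G.J i W)))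
        + 8 * ep A k * G.th i j (G.J k W) - 8 * ep A k * (ep A i * G.rho i (G.xi i) (G.inc W)) := by
    have h1 : ∀ Y Z, G.g (G.RH (G.xi i) (G.inc Y) (G.J j Z)) (G.J j (G.J i W))
        = -ep A j * G.g (G.RH (G.xi i) (G.inc Y) Z) (G.J i W)
          - G.g Z W * G.kap j k (G.xi i) (G.inc Y)
          + ep A i * (G.g Z (G.J j W) * G.kap j i (G.xi i) (G.inc Y)) := by
      intro Y Z
      rw [G.RH_J, hc.rot.sum, G.kap_diag hn]
      have f1 := G.g_J_J j (G.RH (G.xi i) (G.inc Y) Z) (G.J i W)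
      have f2 := G.g_J i Z (G.J k W)
      rw [hJ2, map_smul, smul_eq_mul] at f1
      rw [G.J_ji hc.rot.rot, map_smul, smul_eq_mul] at f2
      simp only [map_add, map_smul, LinearMap.add_apply, LinearMap.smul_apply, smul_eq_mul, G.g_J_J,
        hJ2, f2]
      rcases hc.ep_cases (A := A) with ⟨e1, e2, e3⟩ | ⟨e1, e2, e3⟩ | ⟨e1, e2, e3⟩ <;>
        simp only [e1, e2, e3] at f1 ⊢ <;> linear_combination f1
    have hl : ∀ s t, IsLin (fun Y => G.kap s t (G.xi i) (G.inc Y)) := fun s t =>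
      ⟨fun X Y => by simp [kap], fun f X => by simp [kap]⟩
    have s : ∀ (l : H → A) (hl : IsLin l) (W : H), G.tr (fun Y Z => G.g Z W * l Y) = l W :=
      fun l hl W => G.tr_g' l hl W
    have r := (G.rho_mixed hn hc (G.J j W)).1
    rw [rho_swap, G.J_ij hc, th_smul] at r
    simp only [h1, G.tr_add, G.tr_sub, G.tr_mul, s _ (hl _ _)]
    rw [G.kap_ij hn hc.rot, G.kap_ik hn hc.rot]
    rcases hc.ep_cases (A := A) with ⟨e1, e2, e3⟩ | ⟨e1, e2, e3⟩ | ⟨e1, e2, e3⟩ <;>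
      simp only [e1, e2, e3] at r ⊢ <;> first | linear_combination 8 * r | linear_combination -8 * r
  rw [G.tr_mul, hL, G.tr_R_xi hn hc] at h'
  simp only [G.tr_add, G.tr_sub, G.tr_neg, G.tr_mul, G.tr_mul', t1, t2, t3, t4, G.tr_metric,
    G.tr_g_J _ _ (G.th_J_lin _ _ _), G.tr_g' _ (G.th_J_lin _ _ _), s _ (G.th_lin _ _),
    (G.tr_g_J_J hc.rot).1,
    G.J_ij hc.rot, hJ2, th_smul, map_smul] at h'
  simp only [divS, divJ] at h' ⊢
  rcases hc.ep_cases (A := A) with ⟨e1, e2, e3⟩ | ⟨e1, e2, e3⟩ | ⟨e1, e2, e3⟩ <;>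
    simp only [e1, e2, e3] at h' ⊢ <;>
      first | linear_combination h' | linear_combination -h'

lemma rho_J_mixed (hn : 1 ≤ n) {i j k : Fin 3} (hc : Cyc i j k) (X : H) :
    G.rho i (G.inc (G.J k X)) (G.xi j) = G.th j k (G.J i X) ∧
      G.rho i (G.inc (G.J j X)) (G.xi k) = -G.th j k (G.J i X) := by
  have h1 := (G.rho_mixed hn hc.rot (G.J k X)).1
  have h2 := (G.rho_mixed hn hc.rot (G.J j X)).2
  rw [G.J_ij hc.rot, th_smul] at h1
  rw [G.J_ji hc.rot, th_smul] at h2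
  rw [h1, h2]
  rcases hc.ep_cases (A := A) with ⟨e1, e2, e3⟩ | ⟨e1, e2, e3⟩ | ⟨e1, e2, e3⟩ <;>
    simp only [e1, e2, e3] <;> constructor <;> ring

/-- The components of `T(ξ_s, ξ_t)` in terms of the two-form `ρ_i(ξ_i, X)`. -/
lemma rho_diag_th (hn : 1 ≤ n) {i j k : Fin 3} (hc : Cyc i j k) (X : H) :
    4 * (ep A i * G.rho i (G.xi i) (G.inc X)) = -G.D (G.inc X) G.sc - 2 * G.th k i (G.J j X)
      - 2 * G.th i j (G.J k X) + 2 * G.th j k (G.J i X) := by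
  linear_combination G.rho_diag_sum hn hc X + G.rho_diag_sum hn hc.rot.rot X
    - G.rho_diag_sum hn hc.rot X

lemma rho_diag_div (hn : 1 ≤ n) {i j k : Fin 3} (hc : Cyc i j k) (X : H) :
    16 * n * (ep A i * G.rho i (G.xi i) (G.inc X))
      = -2 * (G.divS G.tau X + ep A i * G.divJ i G.tau X)
        + 8 * (G.th k i (G.J j X) + G.th i j (G.J k X)) := by
  linear_combination ep A i * G.rho_diag_trace hn hc X + (-2 * G.divS G.tau X
    + 8 * (G.th k i (G.J j X) + G.th i j (G.J k X))) * ep_mul_self (A := A) i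

/-- Summation over the cyclic triples makes the twisted divergences collapse by `divJ_sum`. The
weight 8n - 2 is chosen so that the values of ρ disappear, leaving the sum of the three torsion
components. -/
lemma th_sum (hn : 1 ≤ n) {i j k : Fin 3} (hc : Cyc i j k) (X : H) :
    6 * (G.th j k (G.J i X) + G.th k i (G.J j X) + G.th i j (G.J k X))
      = 2 * G.divS G.tau X + 4 * G.divS G.mu X - (4 * n - 1) * G.D (G.inc X) G.sc := by
  have s := G.divJ_sum hn X
  rw [hc.sum] at s
  refine natCast_cancel_eq (m := 6) (by norm_num) ?_
  push_cast
  linear_combination -2 * (G.rho_diag_div hn hc X + G.rho_diag_div hn hc.rot X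
      + G.rho_diag_div hn hc.rot.rot X)
    - (G.divS_mu_eq hn hc X + G.divS_mu_eq hn hc.rot X + G.divS_mu_eq hn hc.rot.rot X)
    + (8 * n - 2) * (G.rho_diag_th hn hc X + G.rho_diag_th hn hc.rot X
      + G.rho_diag_th hn hc.rot.rot X) + 3 * s

/-- The mixed Ricci two-form `ρ_i(ξ_i, X)`. -/
theorem rho_xi_self (hn : 1 ≤ n) (i : Fin 3) (X : H) :
    12 * (2 * n + 1) * G.rho i (G.xi i) (G.inc X) = -ep A i * G.divS G.tau X - 3 * G.divJ i G.tau X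
      + 4 * ep A i * G.divS G.mu X - 2 * ep A i * (2 * n + 1) * G.D (G.inc X) G.sc := by
  have hc := Cyc.mk' i
  have h : 2 * (12 * (2 * n + 1) * (ep A i * G.rho i (G.xi i) (G.inc X)))
      = 2 * (-G.divS G.tau X - 3 * (ep A i * G.divJ i G.tau X) + 4 * G.divS G.mu X
        - 2 * (2 * n + 1) * G.D (G.inc X) G.sc) := by
    -- The weights 3 and 6 make the three torsion components occur with equal coefficient, so
    -- `th_sum` removes them together; they also produce 48n + 24 = 24(2n + 1) on the left.
    linear_combination 3 * G.rho_diag_div hn hc X + 6 * G.rho_diag_th hn hc X + 2 * G.th_sum hn hc X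
  have e := ep_mul_self (A := A) i
  linear_combination ep A i * two_inj h - 12 * (2 * n + 1) * G.rho i (G.xi i) (G.inc X) * e
    - 3 * G.divJ i G.tau X * e

/-- The mixed Ricci two-form `ρ_i(I_k X, ξ_j)`. -/
theorem rho_J_xi_mixed (hn : 1 ≤ n) {i j k : Fin 3} (hc : Cyc i j k) (X : H) :
    12 * (2 * n + 1) * G.rho i (G.inc (G.J k X)) (G.xi j)
      = -2 * (2 * n + 1) * (2 * n - 1) * G.D (G.inc X) G.sc + 8 * (n + 1) * G.divS G.mu X
        + (4 * n + 1) * G.divS G.tau X - 3 * ep A i * G.divJ i G.tau X := by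
  rw [(G.rho_J_mixed hn hc X).1]
  refine two_inj ?_
  -- Here the weights -12n and 3 eliminate ρ_i(ξ_i, X), and `th_sum` eliminates the other two
  -- torsion components.
  linear_combination -12 * n * G.rho_diag_th hn hc X + 3 * G.rho_diag_div hn hc X
    + 4 * (n + 1) * G.th_sum hn hc X

end Geo

set_option linter.unusedSectionVars false

/-! ## Calculus of smooth local vector fields -/

section Calculus

variable {n : ℕ} {M : Type*} [TopologicalSpace M]
  [ChartedSpace (EuclideanSpace ℝ (Fin (4 * n + 3))) M]
  [IsManifold (𝓡 (4 * n + 3)) ∞ M] {U : Set M}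
  {A B D : (x : M) → TangentSpace (𝓡 (4 * n + 3)) x} {f h : M → ℝ} {x : M}

lemma SmoothField.congr (h : SmoothField U A) (hAB : ∀ x ∈ U, B x = A x) : SmoothField U B :=
  ContMDiffOn.congr h fun x hx => by rw [hAB x hx]

lemma SmoothField.contMDiffAt (h : SmoothField U A) (hU : IsOpen U) (hx : x ∈ U) :
    ContMDiffAt (𝓡 (4 * n + 3)) (𝓡 (4 * n + 3)).tangent ∞
      (fun x => (⟨x, A x⟩ : TangentBundle (𝓡 (4 * n + 3)) M)) x :=
  ContMDiffOn.contMDiffAt h (hU.mem_nhds hx)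

lemma SmoothField.mdifferentiableAt (h : SmoothField U A) (hU : IsOpen U) (hx : x ∈ U) :
    MDifferentiableAt (𝓡 (4 * n + 3)) (𝓡 (4 * n + 3)).tangent
      (fun x => (⟨x, A x⟩ : TangentBundle (𝓡 (4 * n + 3)) M)) x :=
  (h.contMDiffAt hU hx).mdifferentiableAt (by simp)

lemma SmoothFun.mdifferentiableAt (h : SmoothFun n U f) (hU : IsOpen U) (hx : x ∈ U) :
    MDifferentiableAt (𝓡 (4 * n + 3)) 𝓘(ℝ, ℝ) f x :=
  (ContMDiffOn.contMDiffAt h (hU.mem_nhds hx)).mdifferentiableAt (by simp)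

lemma SmoothFun.congr (hf : SmoothFun n U f) (hfh : ∀ x ∈ U, h x = f x) : SmoothFun n U h :=
  ContMDiffOn.congr hf hfh

lemma SmoothField.add (hA : SmoothField U A) (hB : SmoothField U B) :
    SmoothField U (fun x => A x + B x) := ContMDiffOn.add_section hA hB

lemma SmoothField.sub (hA : SmoothField U A) (hB : SmoothField U B) :
    SmoothField U (fun x => A x - B x) := ContMDiffOn.sub_section hA hB

lemma SmoothField.smul (hf : SmoothFun n U f) (hA : SmoothField U A) :
    SmoothField U (fun x => f x • A x) := ContMDiffOn.smul_section hf hA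

lemma SmoothField.sum {ι : Type*} (s : Finset ι) {A : ι → (x : M) → TangentSpace (𝓡 (4 * n + 3)) x}
    (hA : ∀ a ∈ s, SmoothField U (A a)) : SmoothField U (fun x => ∑ a ∈ s, A a x) :=
  ContMDiffOn.sum_section hA

lemma SmoothField.zero : SmoothField U (fun x : M => (0 : TangentSpace (𝓡 (4 * n + 3)) x)) := by
  simpa using SmoothField.sum (U := U) (n := n) (M := M) (∅ : Finset ℕ) (A := fun _ _ => 0) (by simp)

lemma SmoothFun.const (c : ℝ) : SmoothFun n U (fun _ : M => c) := contMDiffOn_const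

lemma SmoothFun.add (hf : SmoothFun n U f) (hh : SmoothFun n U h) :
    SmoothFun n U (fun x => f x + h x) := ContMDiffOn.add hf hh

lemma SmoothFun.sub (hf : SmoothFun n U f) (hh : SmoothFun n U h) :
    SmoothFun n U (fun x => f x - h x) := ContMDiffOn.sub hf hh

lemma SmoothFun.mul (hf : SmoothFun n U f) (hh : SmoothFun n U h) :
    SmoothFun n U (fun x => f x * h x) := ContMDiffOn.mul hf hh

lemma SmoothField.mlieBracket (hU : IsOpen U) (hA : SmoothField U A) (hB : SmoothField U B) :
    SmoothField U (VectorField.mlieBracket (𝓡 (4 * n + 3)) A B) := by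
  intro x hx
  have : IsManifold (𝓡 (4 * n + 3)) (((⊤ : ℕ∞) : WithTop ℕ∞) + 1) M := inferInstanceAs (IsManifold _ ∞ M)
  have : IsManifold (𝓡 (4 * n + 3)) (minSmoothness ℝ 2) M := by
    simp only [minSmoothness_of_isRCLikeNormedField]; infer_instance
  exact (ContMDiffAt.mlieBracket_vectorField (m := ⊤) (n := ⊤) (hA.contMDiffAt hU hx) (hB.contMDiffAt hU hx)
    (by simp)).contMDiffWithinAt

lemma dirDeriv_congr {v : TangentSpace (𝓡 (4 * n + 3)) x} (hfh : f =ᶠ[𝓝 x] h) :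
    dirDeriv f x v = dirDeriv h x v := by
  have h1 := hfh.mfderiv_eq (I := 𝓡 (4 * n + 3)) (I' := 𝓘(ℝ, ℝ))
  exact congrArg (fun l => l v) h1

lemma dirDeriv_add {v : TangentSpace (𝓡 (4 * n + 3)) x} (hU : IsOpen U) (hf : SmoothFun n U f)
    (hh : SmoothFun n U h) (hx : x ∈ U) :
    dirDeriv (fun x => f x + h x) x v = dirDeriv f x v + dirDeriv h x v := by
  have := mvfderiv_add (hf.mdifferentiableAt hU hx) (hh.mdifferentiableAt hU hx)
  exact congrArg (fun l => l v) this

lemma dirDeriv_mul {v : TangentSpace (𝓡 (4 * n + 3)) x} (hU : IsOpen U) (hf : SmoothFun n U f)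
    (hh : SmoothFun n U h) (hx : x ∈ U) :
    dirDeriv (fun x => f x * h x) x v = f x * dirDeriv h x v + h x * dirDeriv f x v := by
  have := mvfderiv_mul (hf.mdifferentiableAt hU hx) (hh.mdifferentiableAt hU hx)
  exact congrArg (fun l => l v) this

lemma dirDeriv_const (c : ℝ) {v : TangentSpace (𝓡 (4 * n + 3)) x} :
    dirDeriv (fun _ : M => c) x v = 0 := by
  have := mvfderiv_const (I := 𝓡 (4 * n + 3)) (x := x) c
  exact congrArg (fun l => l v) this

lemma mlieBracket_add (hU : IsOpen U) (hB : SmoothField U B) (hD : SmoothField U D) (hx : x ∈ U) :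
    VectorField.mlieBracket (𝓡 (4 * n + 3)) A (fun x => B x + D x) x
      = VectorField.mlieBracket (𝓡 (4 * n + 3)) A B x
        + VectorField.mlieBracket (𝓡 (4 * n + 3)) A D x :=
  VectorField.mlieBracket_add_right (hB.mdifferentiableAt hU hx) (hD.mdifferentiableAt hU hx)

lemma mlieBracket_smul (hU : IsOpen U) (hf : SmoothFun n U f) (hB : SmoothField U B) (hx : x ∈ U) :
    VectorField.mlieBracket (𝓡 (4 * n + 3)) A (fun x => f x • B x) x
      = f x • VectorField.mlieBracket (𝓡 (4 * n + 3)) A B x + dirDeriv f x (A x) • B x := by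
  exact (VectorField.mlieBracket_smul_right (hf.mdifferentiableAt hU hx)
    (hB.mdifferentiableAt hU hx)).trans (add_comm _ _)

lemma mlieBracket_congr {A' B' : (x : M) → TangentSpace (𝓡 (4 * n + 3)) x} (hU : IsOpen U)
    (hA : ∀ x ∈ U, A x = A' x) (hB : ∀ x ∈ U, B x = B' x) (hx : x ∈ U) :
    VectorField.mlieBracket (𝓡 (4 * n + 3)) A B x = VectorField.mlieBracket (𝓡 (4 * n + 3)) A' B' x :=
  Filter.EventuallyEq.mlieBracket_vectorField_eq
    (Filter.eventuallyEq_of_mem (hU.mem_nhds hx) hA) (Filter.eventuallyEq_of_mem (hU.mem_nhds hx) hB)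

lemma mlieBracket_jacobi (hU : IsOpen U) (hA : SmoothField U A) (hB : SmoothField U B)
    (hD : SmoothField U D) (hx : x ∈ U) :
    VectorField.mlieBracket (𝓡 (4 * n + 3)) A (VectorField.mlieBracket (𝓡 (4 * n + 3)) B D) x
      = VectorField.mlieBracket (𝓡 (4 * n + 3)) (VectorField.mlieBracket (𝓡 (4 * n + 3)) A B) D x
        + VectorField.mlieBracket (𝓡 (4 * n + 3)) B
          (VectorField.mlieBracket (𝓡 (4 * n + 3)) A D) x := by
  have : IsManifold (𝓡 (4 * n + 3)) (minSmoothness ℝ 3) M := by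
    simp only [minSmoothness_of_isRCLikeNormedField]; infer_instance
  have h2 : minSmoothness ℝ 2 ≤ (∞ : WithTop ℕ∞) := by
    simp only [minSmoothness_of_isRCLikeNormedField]; exact ENat.LEInfty.out
  apply VectorField.leibniz_identity_mlieBracket_apply
  · exact (hA.contMDiffAt hU hx).of_le h2
  · exact (hB.contMDiffAt hU hx).of_le h2
  · exact (hD.contMDiffAt hU hx).of_le h2

variable {P : HorizontalData n M} (C : P.Connection)

lemma nabla_congr {A' B' : (x : M) → TangentSpace (𝓡 (4 * n + 3)) x} (hU : IsOpen U)
    (hB : SmoothField U B) (hA' : ∀ x ∈ U, A x = A' x) (hB' : ∀ x ∈ U, B x = B' x) (hx : x ∈ U) :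
    C.nabla A B x = C.nabla A' B' x := by
  have h := C.cov.isCovariantDerivativeOnUniv.congr_of_eventuallyEq (hB.mdifferentiableAt hU hx)
    ((hB.congr fun x hx => (hB' x hx).symm).mdifferentiableAt hU hx) Filter.univ_mem
    (Filter.eventually_of_mem (hU.mem_nhds hx) hB')
  simp only [HorizontalData.Connection.nabla, hA' x hx]
  exact congrArg (fun l => l (A' x)) h

lemma nabla_add (hU : IsOpen U) (hB : SmoothField U B) (hD : SmoothField U D) (hx : x ∈ U) :
    C.nabla A (fun x => B x + D x) x = C.nabla A B x + C.nabla A D x := by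
  have h := C.cov.isCovariantDerivativeOnUniv.add (hB.mdifferentiableAt hU hx)
    (hD.mdifferentiableAt hU hx)
  exact congrArg (fun l => l (A x)) h

lemma nabla_smul (hU : IsOpen U) (hf : SmoothFun n U f) (hB : SmoothField U B) (hx : x ∈ U) :
    C.nabla A (fun x => f x • B x) x = f x • C.nabla A B x + dirDeriv f x (A x) • B x := by
  have h := C.cov.isCovariantDerivativeOnUniv.leibniz (hB.mdifferentiableAt hU hx)
    (hf.mdifferentiableAt hU hx)
  exact congrArg (fun l => l (A x)) h

/-- Smoothness of the covariant derivative is available for global sections only, so the local field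
is cut off by a bump function supported in U and equal to one near the point. -/
lemma SmoothField.nabla [T2Space M] (hC : C.cov.ContMDiffCovariantDerivative ∞) (hU : IsOpen U)
    (hA : SmoothField U A) (hB : SmoothField U B) : SmoothField U (C.nabla A B) := by
  intro x hx
  obtain ⟨χ, -, hχ⟩ := (SmoothBumpFunction.nhds_basis_tsupport (I := 𝓡 (4 * n + 3)) x).mem_iff.1
    (hU.mem_nhds hx)
  have h1 : SmoothField Set.univ (fun y => χ y • B y) :=
    (ContMDiffOn.smul_section_of_tsupport (χ.contMDiff.contMDiffOn (s := U)) hU hχ hB).contMDiffOn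
  have h2 := (hC.contMDiff.contMDiff (σ := fun y => χ y • B y) h1).contMDiffAt Filter.univ_mem (x := x)
  have h3 := (h2.clm_bundle_apply (hA.contMDiffAt hU hx))
  refine ContMDiffAt.contMDiffWithinAt (h3.congr_of_eventuallyEq ?_)
  -- The covariant derivative at a nearby point sees the field on a neighbourhood of that point, so
  -- the cut-off has to be one around every nearby point.
  have h4 := χ.eventuallyEq_one.eventually_nhds
  filter_upwards [h4, hU.mem_nhds hx] with y hy hyU
  have := C.cov.isCovariantDerivativeOnUniv.congr_of_eventuallyEq (hB.mdifferentiableAt hU hyU)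
    (h1.mdifferentiableAt isOpen_univ (Set.mem_univ y)) Filter.univ_mem
    (hy.mono fun z hz => by simp [hz])
  simp only [HorizontalData.Connection.nabla]
  rw [this]

lemma torsion_eq (hU : IsOpen U) (hA : SmoothField U A) (hB : SmoothField U B) (hx : x ∈ U) :
    C.cov.torsion x (A x) (B x) = C.nabla A B x - C.nabla B A x
      - VectorField.mlieBracket (𝓡 (4 * n + 3)) A B x :=
  C.cov.torsion_apply (hA.mdifferentiableAt hU hx) (hB.mdifferentiableAt hU hx)

end Calculus

section LocalStructure

variable {n : ℕ} {M : Type*} [TopologicalSpace M]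
  [ChartedSpace (EuclideanSpace ℝ (Fin (4 * n + 3))) M]
  [IsManifold (𝓡 (4 * n + 3)) ∞ M] {U : Set M} {P : HorizontalData n M}

open HorizontalData

/-- Averaging over the paraquaternion basis with these signs makes an endomorphism commute with
every J_i: composition with J_i merely permutes the four terms up to sign. -/
lemma PQModule.skewAverage_J {A H : Type*} [CommRing A] [Algebra ℝ A] [AddCommGroup H]
    [Module A H] (L : PQModule n A H) (i : Fin 3) (X Y Z : H) :
    L.g X (L.J i Z) • Y - L.g Y (L.J i Z) • X
      - ∑ u, ep A u • (L.g (L.J u X) (L.J i Z) • L.J u Y - L.g (L.J u Y) (L.J i Z) • L.J u X)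
    = L.J i (L.g X Z • Y - L.g Y Z • X
      - ∑ u, ep A u • (L.g (L.J u X) Z • L.J u Y - L.g (L.J u Y) Z • L.J u X)) := by
  have hc : Cyc i (i + 1) (i + 2) := Cyc.mk' i
  have hJ : ∀ X Y, L.g X (L.J i Y) = -L.g (L.J i X) Y := fun X Y => by rw [L.g_J, neg_neg]
  simp only [hc.sum, map_sub, map_add, map_smul, hJ, L.J_ij hc, L.J_ji hc.rot.rot,
    L.J_sq, map_smul, LinearMap.smul_apply, smul_eq_mul]
  rcases hc.ep_cases (A := A) with ⟨e1, e2, e3⟩ | ⟨e1, e2, e3⟩ | ⟨e1, e2, e3⟩ <;>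
    simp only [e1, e2, e3] <;> module

/-! ## Pointwise linear algebra of a pqc structure -/

/-- Orthonormal vectors are independent even for an indefinite metric because their norms are ±1,
and 4n of them span by dimension. -/
lemma HorizontalData.IsOrthonormalAt.expand (hP : P.IsPQC) (hn : 1 ≤ n) {x : M} {e : Fin (4 * n) → P.H x}
    (he : P.IsOrthonormalAt x e) (X : P.H x) :
    X = ∑ a, (P.g x (e a) (e a) * P.g x X (e a)) • e a := by
  have hsq : ∀ a, P.g x (e a) (e a) * P.g x (e a) (e a) = 1 := fun a => by
    rcases he.1 a with h | h <;> rw [h] <;> norm_num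
  have key : ∀ (c : Fin (4 * n) → ℝ) a, P.g x (∑ b, c b • e b) (e a) = c a * P.g x (e a) (e a) := by
    intro c a
    simp only [map_sum, map_smul, LinearMap.sum_apply, LinearMap.smul_apply, smul_eq_mul]
    rw [Finset.sum_eq_single a (fun b _ hb => by rw [he.2 b a hb, mul_zero]) (by simp)]
  have hli : LinearIndependent ℝ e := by
    rw [Fintype.linearIndependent_iff]
    intro c hc a
    have h := key c a
    rw [hc, map_zero, LinearMap.zero_apply] at h
    have h2 := hsq a
    rcases mul_eq_zero.1 h.symm with h3 | h3
    · exact h3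
    · rw [h3] at h2; norm_num at h2
  have : Nonempty (Fin (4 * n)) := ⟨⟨0, by omega⟩⟩
  let b := basisOfLinearIndependentOfCardEqFinrank hli (by rw [hP.finrank_H x, Fintype.card_fin])
  have hb : ∀ a, b a = e a := fun a => by simp [b]
  have hX : X = ∑ a, b.repr X a • e a := by
    conv_lhs => rw [← b.sum_repr X]
    simp only [hb]
  conv_lhs => rw [hX]
  refine Finset.sum_congr rfl fun a _ => ?_
  congr 1
  conv_rhs => rw [hX]
  rw [key, mul_left_comm, hsq, mul_one]

/-! ### Reeb fields, brackets and the horizontal projection over an open set -/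

section Local

variable {η : Fin 3 → (x : M) → TangentSpace (𝓡 (4 * n + 3)) x →L[ℝ] ℝ}
  {J : Fin 3 → (x : M) → Module.End ℝ (P.H x)}
  {ξ ξ' : Fin 3 → (x : M) → TangentSpace (𝓡 (4 * n + 3)) x}

/-- Both contractions of θ are constant near the point, so the two derivative terms of the exterior
derivative vanish. This converts the contact and Reeb conditions into statements on brackets. -/
lemma dForm_eq (hU : IsOpen U) {θ : (x : M) → TangentSpace (𝓡 (4 * n + 3)) x →L[ℝ] ℝ}
    {A B : (x : M) → TangentSpace (𝓡 (4 * n + 3)) x} {c : ℝ} (hA : ∀ x ∈ U, θ x (A x) = c)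
    (hB : ∀ x ∈ U, θ x (B x) = 0) {x : M} (hx : x ∈ U) :
    dForm θ A B x = -θ x (VectorField.mlieBracket (𝓡 (4 * n + 3)) A B x) := by
  rw [dForm, dirDeriv_congr (h := fun _ => 0) (Filter.eventually_of_mem (hU.mem_nhds hx) hB),
    dirDeriv_congr (h := fun _ => c) (Filter.eventually_of_mem (hU.mem_nhds hx) hA), dirDeriv_const,
    dirDeriv_const]
  ring

lemma HorizontalData.IsAdmissible.eta_inc (ha : P.IsAdmissible U η J) {x : M} (hx : x ∈ U) (X : P.H x) (s : Fin 3) :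
    η s x X = 0 := (ha.ker x hx X).1 X.2 s

/-- The component in `H` of a tangent vector with respect to the Reeb vector fields. -/
lemma HorizontalData.IsReeb.sub_mem (ha : P.IsAdmissible U η J) (hr : P.IsReeb U η ξ) {x : M} (hx : x ∈ U)
    (v : TangentSpace (𝓡 (4 * n + 3)) x) : v - ∑ s, η s x v • ξ s x ∈ P.H x := by
  rw [ha.ker x hx]
  intro t
  simp only [map_sub, map_sum, map_smul, hr.dual x hx, smul_eq_mul, mul_ite, mul_one, mul_zero,
    Finset.sum_ite_eq, Finset.mem_univ, if_true, sub_self]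

lemma mlieBracket_swap (A B : (x : M) → TangentSpace (𝓡 (4 * n + 3)) x) (x : M) :
    VectorField.mlieBracket (𝓡 (4 * n + 3)) A B x
      = -VectorField.mlieBracket (𝓡 (4 * n + 3)) B A x :=
  VectorField.mlieBracket_swap_apply

variable {F : P.LocalFrame} {x : M}

lemma eta_mlieBracket_inc (hU : IsOpen U) (ha : P.IsAdmissible U η J) {X Y : (x : M) → P.H x}
    (hX : P.SmoothH U X) (hY : P.SmoothH U Y) (hx : x ∈ U) (s : Fin 3) :
    η s x (VectorField.mlieBracket (𝓡 (4 * n + 3)) (P.inc X) (P.inc Y) x)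
      = 2 * eps s * P.g x (J s x (X x)) (Y x) := by
  have h := ha.contact U hU subset_rfl X Y hX hY x hx s
  rw [dForm_eq (A := P.inc X) (B := P.inc Y) hU (fun y hy => ha.eta_inc hy _ s)
    (fun y hy => ha.eta_inc hy _ s) hx] at h
  linear_combination -h

lemma eta_mlieBracket_reeb (hU : IsOpen U) (ha : P.IsAdmissible U η J) (hr : P.IsReeb U η ξ)
    {X : (x : M) → P.H x} (hX : P.SmoothH U X) (hx : x ∈ U) (s : Fin 3) :
    η s x (VectorField.mlieBracket (𝓡 (4 * n + 3)) (ξ s) (P.inc X) x) = 0 := by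
  have h := hr.contr U hU subset_rfl X hX x hx s
  rw [dForm_eq (A := ξ s) (B := P.inc X) hU (c := 1) (fun y hy => by rw [hr.dual y hy, if_pos rfl])
    (fun y hy => ha.eta_inc hy _ s) hx] at h
  linear_combination -h

lemma eta_mlieBracket_dim_seven (hU : IsOpen U) (ha : P.IsAdmissible U η J)
    (hr : P.IsReeb U η ξ) (hn : n = 1) {X : (x : M) → P.H x} (hX : P.SmoothH U X) (hx : x ∈ U)
    (i : Fin 3) :
    η i x (VectorField.mlieBracket (𝓡 (4 * n + 3)) (ξ (i + 1)) (P.inc X) x)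
      = eps (i + 2)
        * η (i + 1) x (VectorField.mlieBracket (𝓡 (4 * n + 3)) (ξ i) (P.inc X) x) := by
  have h := hr.dim_seven hn U hU subset_rfl X hX x hx i
  rw [dForm_eq (A := ξ (i + 1)) (B := P.inc X) hU (fun y hy => hr.dual y hy i (i + 1))
      (fun y hy => ha.eta_inc hy _ i) hx,
    dForm_eq (A := ξ i) (B := P.inc X) hU (fun y hy => hr.dual y hy (i + 1) i)
      (fun y hy => ha.eta_inc hy _ (i + 1)) hx] at h
  linear_combination -h

/-- The difference h of two Reeb fields with the same index is horizontal, and both conditions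
together give η_s([e_a, h]) = 0 for every a. By the contact condition J_s h is then orthogonal to
the frame, so h = 0. The definition of the canonical connection supplies only some Reeb triple
spanning V; uniqueness identifies it with the given one. -/
lemma reeb_unique (hP : P.IsPQC) (hn : 1 ≤ n) (hU : IsOpen U) (hF : F.IsAdapted U)
    (hr' : P.IsReeb U F.η ξ') (hx : x ∈ U) (s : Fin 3) : ξ' s x = F.ξ s x := by
  classical
  have ha := hF.admissible
  have hr := hF.reeb
  have hmem : ∀ y ∈ U, ξ' s y - F.ξ s y ∈ P.H y := fun y hy => by
    rw [ha.ker y hy]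
    intro t
    rw [map_sub, hr.dual y hy, hr'.dual y hy, sub_self]
  let h : (y : M) → P.H y := fun y => if hy : ξ' s y - F.ξ s y ∈ P.H y then ⟨_, hy⟩ else 0
  have hh : ∀ y ∈ U, P.inc h y = ξ' s y - F.ξ s y := fun y hy => by
    simp only [HorizontalData.inc, h, dif_pos (hmem y hy)]
  have hs : P.SmoothH U h := ((hr'.smooth s).sub (hr.smooth s)).congr hh
  have hz : F.J s x (h x) = 0 := by
    rw [IsOrthonormalAt.expand hP hn (hF.orthonormal x hx) (F.J s x (h x))]
    refine Finset.sum_eq_zero fun a _ => ?_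
    have h1 := eta_mlieBracket_inc hU ha hs (hF.smooth a) hx s
    have h2 := eta_mlieBracket_reeb hU ha hr (hF.smooth a) hx s
    have h3 := eta_mlieBracket_reeb hU ha hr' (hF.smooth a) hx s
    rw [mlieBracket_swap, map_neg, neg_eq_zero] at h2 h3
    rw [mlieBracket_swap, map_neg] at h1
    rw [mlieBracket_congr (A' := P.inc (F.e a)) (B' := fun y => F.ξ s y + P.inc h y) hU
      (fun _ _ => rfl) (fun y hy => by rw [hh y hy]; abel) hx,
      mlieBracket_add hU (hr.smooth s) hs hx, map_add, h2, zero_add] at h3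
    rw [h3, neg_zero] at h1
    have he0 : 2 * eps s ≠ 0 := by fin_cases s <;> simp [eps]
    rw [(mul_eq_zero.1 h1.symm).resolve_left he0, mul_zero, zero_smul]
  have hz3 : eps s • h x = 0 := by
    have := LinearMap.congr_fun (ha.sq x hx s) (h x)
    simp only [Module.End.mul_apply, hz, map_zero, LinearMap.smul_apply, Module.End.one_apply]
      at this
    exact this.symm
  have he0 : eps s ≠ 0 := by fin_cases s <;> simp [eps]
  have := hh x hx
  rw [HorizontalData.inc, (smul_eq_zero.1 hz3).resolve_left he0] at this
  exact sub_eq_zero.1 this.symm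

variable {C : P.Connection}

lemma reeb_mem_V (hP : P.IsPQC) (hn : 1 ≤ n) (hC : C.IsCanonical) (hU : IsOpen U)
    (hF : F.IsAdapted U) (hx : x ∈ U) (s : Fin 3) : F.ξ s x ∈ C.V x := by
  obtain ⟨ξ', hr', hV⟩ := hC.vertical U hU F.η F.J hF.admissible
  rw [hV x hx, ← reeb_unique hP hn hU hF hr' hx s]
  exact Submodule.subset_span ⟨s, rfl⟩

lemma hor_of_mem {x : M} {v : TangentSpace (𝓡 (4 * n + 3)) x} (hv : v ∈ P.H x) :
    C.hor x v = ⟨v, hv⟩ :=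
  Submodule.projectionOnto_apply_left (C.isCompl x) ⟨v, hv⟩

lemma hor_inc (X : (x : M) → P.H x) (x : M) : C.hor x (P.inc X x) = X x := hor_of_mem (X x).2

lemma hor_of_mem_V {x : M} {v : TangentSpace (𝓡 (4 * n + 3)) x} (hv : v ∈ C.V x) :
    C.hor x v = 0 :=
  (Submodule.projectionOnto_apply_eq_zero_iff (C.isCompl x)).2 hv

lemma coe_hor (hP : P.IsPQC) (hn : 1 ≤ n) (hC : C.IsCanonical) (hU : IsOpen U)
    (hF : F.IsAdapted U) (hx : x ∈ U) (v : TangentSpace (𝓡 (4 * n + 3)) x) :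
    (C.hor x v : TangentSpace (𝓡 (4 * n + 3)) x) = v - ∑ s, F.η s x v • F.ξ s x := by
  have h1 := hF.reeb.sub_mem hF.admissible hx v
  have h2 : C.hor x (∑ s, F.η s x v • F.ξ s x) = 0 :=
    hor_of_mem_V (Submodule.sum_mem _ fun s _ =>
      Submodule.smul_mem _ _ (reeb_mem_V hP hn hC hU hF hx s))
  have h3 := hor_of_mem (C := C) h1
  rw [map_sub, h2, sub_zero] at h3
  rw [h3]

lemma smoothH_hor (hP : P.IsPQC) (hn : 1 ≤ n) (hC : C.IsCanonical) (hU : IsOpen U)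
    (hF : F.IsAdapted U) {A : (x : M) → TangentSpace (𝓡 (4 * n + 3)) x} (hA : SmoothField U A) :
    P.SmoothH U (fun x => C.hor x (A x)) := by
  refine SmoothField.congr (hA.sub (SmoothField.sum Finset.univ fun s _ =>
    SmoothField.smul (hF.admissible.smooth_form s U hU subset_rfl A hA) (hF.reeb.smooth s)))
    fun x hx => coe_hor hP hn hC hU hF hx (A x)

/-- The derivative of f along A is η_1([A, f ξ_1]) - f η_1([A, ξ_1]), and brackets and contact forms
are already known to preserve smoothness. -/
lemma smoothFun_dirDeriv (hU : IsOpen U) (hF : F.IsAdapted U)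
    {A : (x : M) → TangentSpace (𝓡 (4 * n + 3)) x} (hA : SmoothField U A) {f : M → ℝ}
    (hf : SmoothFun n U f) : SmoothFun n U (fun x => dirDeriv f x (A x)) := by
  have hξ := hF.reeb.smooth 0
  have h1 := hF.admissible.smooth_form 0 U hU subset_rfl _ (hA.mlieBracket hU (hξ.smul hf))
  have h2 := hF.admissible.smooth_form 0 U hU subset_rfl _ (hA.mlieBracket hU hξ)
  refine (h1.sub (hf.mul h2)).congr fun x hx => ?_
  rw [mlieBracket_smul hU hf hξ hx]
  simp only [map_add, map_smul, smul_eq_mul, hF.reeb.dual x hx, if_true]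
  ring

lemma cov_inc_mem (hC : C.IsCanonical) (hU : IsOpen U) {X : (x : M) → P.H x}
    (hX : P.SmoothH U X) (hx : x ∈ U) (v : TangentSpace (𝓡 (4 * n + 3)) x) :
    C.cov (P.inc X) x v ∈ P.H x := hC.preserves_H U hU X hX x hx v

lemma cov_reeb_mem (hP : P.IsPQC) (hn : 1 ≤ n) (hC : C.IsCanonical) (hU : IsOpen U)
    (hF : F.IsAdapted U) (hx : x ∈ U) (v : TangentSpace (𝓡 (4 * n + 3)) x) (s : Fin 3) :
    C.cov (F.ξ s) x v ∈ C.V x :=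
  hC.preserves_V U hU _ (hF.reeb.smooth s) (fun _ hy => reeb_mem_V hP hn hC hU hF hy s) x hx v

lemma inSpSp_J (ha : P.IsAdmissible U η J) (hx : x ∈ U) (s : Fin 3) : P.InSpSp x (J s x) := by
  refine ⟨0, J s x, (zero_add _).symm, ?_, by simp, by simp⟩
  rw [ha.span x hx]
  exact Submodule.subset_span ⟨s, rfl⟩

/-- The average over `PQ` of the elementary skew-symmetric endomorphism defined by `X` and `Y`. -/
def skewAverage (P : HorizontalData n M) (J : Fin 3 → (x : M) → Module.End ℝ (P.H x)) (x : M)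
    (X Y : P.H x) : Module.End ℝ (P.H x) :=
  (P.g x X).smulRight Y - (P.g x Y).smulRight X
    - ∑ u, eps u • ((P.g x (J u x X)).smulRight (J u x Y) - (P.g x (J u x Y)).smulRight (J u x X))

lemma skewAverage_apply (X Y Z : P.H x) : skewAverage P J x X Y Z = P.g x X Z • Y - P.g x Y Z • X
    - ∑ u, eps u • (P.g x (J u x X) Z • J u x Y - P.g x (J u x Y) Z • J u x X) := by
  simp [skewAverage]

/-- The horizontal space at a point with an orthonormal basis. -/
def pointwise (hP : P.IsPQC) (hn : 1 ≤ n) (ha : P.IsAdmissible U η J) (hx : x ∈ U)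
    {e : Fin (4 * n) → P.H x} (he : P.IsOrthonormalAt x e) : PQModule n ℝ (P.H x) where
  g := P.g x
  J s := J s x
  e := e
  g_symm := hP.symm x
  J_sq s X := LinearMap.congr_fun (ha.sq x hx s) X
  J_mul i X := LinearMap.congr_fun (ha.mul x hx i) X
  J_mul_swap i X := LinearMap.congr_fun (ha.mul_swap x hx i) X
  g_J_J := ha.compat x hx
  sgn_sq a := by rcases he.1 a with h | h <;> rw [h] <;> norm_num
  expand := he.expand hP hn

/-- These averages lie in sp(n, ℝ): they are skew by inspection, and they commute with a spanning
set of `PQ` by `skewAverage_J`. -/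
lemma inSpSp_skewAverage (hP : P.IsPQC) (hn : 1 ≤ n) (ha : P.IsAdmissible U η J) (hx : x ∈ U)
    (X Y : P.H x) : P.InSpSp x (skewAverage P J x X Y) := by
  refine ⟨_, 0, (add_zero _).symm, Submodule.zero_mem _, ?_, ?_⟩
  · intro Z W
    simp only [skewAverage_apply, Fin.sum_univ_three, map_sub, map_add, map_smul,
      LinearMap.sub_apply, LinearMap.add_apply, LinearMap.smul_apply, smul_eq_mul,
      hP.symm x Z]
    ring
  · intro ρ hρ
    rw [ha.span x hx] at hρ
    induction hρ using Submodule.span_induction with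
    | mem ρ h =>
      obtain ⟨i, rfl⟩ := h
      obtain ⟨e, he, -⟩ := hP.neutral x
      have h := (pointwise hP hn ha hx he).skewAverage_J i X Y
      refine LinearMap.ext fun Z => ?_
      simp only [Module.End.mul_apply, skewAverage_apply]
      exact h Z
    | zero => simp
    | add a b _ _ h1 h2 => rw [mul_add, add_mul, h1, h2]
    | smul c a _ h => rw [mul_smul_comm, smul_mul_assoc, h]

end Local

end LocalStructure

/-! ## The modules of smooth functions and of smooth vector fields on an open set -/

section Modules

/-- Extension by zero of a section over `U`. -/
def extend {M : Type*} {U : Set M} {E : M → Type*} [∀ x, Zero (E x)] (f : (x : U) → E x) (x : M) :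
    E x :=
  open Classical in if h : x ∈ U then f ⟨x, h⟩ else 0

section Extend

variable {M : Type*} {U : Set M}

lemma extend_apply {E : M → Type*} [∀ x, Zero (E x)] (f : (x : U) → E x) {x : M} (hx : x ∈ U) :
    extend f x = f ⟨x, hx⟩ := dif_pos hx

lemma extend_add {E : M → Type*} [∀ x, AddCommGroup (E x)] (f h : (x : U) → E x) :
    extend (f + h) = fun x => extend f x + extend h x := by
  funext x
  by_cases hx : x ∈ U <;> simp [extend, hx]

lemma extend_mul (f h : U → ℝ) :
    extend (E := fun _ => ℝ) (f * h) = fun x => extend (E := fun _ => ℝ) f x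
      * extend (E := fun _ => ℝ) h x := by
  funext x
  by_cases hx : x ∈ U <;> simp [extend, hx]

lemma extend_smul {E : M → Type*} [∀ x, AddCommGroup (E x)] [∀ x, Module ℝ (E x)] (f : U → ℝ)
    (h : (x : U) → E x) :
    extend (f • h) = fun x => extend (E := fun _ => ℝ) f x • extend h x := by
  funext x
  by_cases hx : x ∈ U <;> simp [extend, hx]

end Extend

variable (n : ℕ) {M : Type*} [TopologicalSpace M]
  [ChartedSpace (EuclideanSpace ℝ (Fin (4 * n + 3))) M]
  [IsManifold (𝓡 (4 * n + 3)) ∞ M]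

/-- The algebra of smooth functions on `U`. -/
def fnAlg (U : Set M) : Subalgebra ℝ (U → ℝ) where
  carrier := {f | SmoothFun n U (extend (E := fun _ => ℝ) f)}
  add_mem' {f h} hf hh := by
    rw [Set.mem_ofPred_eq, extend_add]; exact hf.add hh
  mul_mem' {f h} hf hh := by
    rw [Set.mem_ofPred_eq, extend_mul]; exact hf.mul hh
  algebraMap_mem' r := (SmoothFun.const r).congr fun x hx => extend_apply _ hx

variable {n}

/-- The module of smooth vector fields on `U`. -/
def vfMod (U : Set M) : Submodule (fnAlg n U) ((x : U) → TangentSpace (𝓡 (4 * n + 3)) (x : M)) where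
  carrier := {A | SmoothField U (extend A)}
  zero_mem' := SmoothField.zero.congr fun _ hx => extend_apply _ hx
  add_mem' {A B} hA hB := by
    rw [Set.mem_ofPred_eq, extend_add]; exact hA.add hB
  smul_mem' f A hA := by
    change SmoothField U (extend ((f : U → ℝ) • A))
    rw [extend_smul]; exact SmoothField.smul f.2 hA

/-- The module of smooth horizontal vector fields on `U`. -/
def hfMod (P : HorizontalData n M) (U : Set M) : Submodule (fnAlg n U) ((x : U) → P.H x) where
  carrier := {X | P.SmoothH U (extend X)}
  zero_mem' := SmoothField.zero.congr fun x hx => by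
    simp [HorizontalData.inc, extend]
  add_mem' {A B} hA hB := by
    rw [Set.mem_ofPred_eq, extend_add]
    exact (SmoothField.add hA hB).congr fun x _ => rfl
  smul_mem' f A hA := by
    change P.SmoothH U (extend ((f : U → ℝ) • A))
    rw [extend_smul]
    exact (SmoothField.smul f.2 hA).congr fun x _ => rfl

variable (n) in
/-- The smooth functions on `U`. -/
def Fn (U : Set M) : Type _ := fnAlg n U

variable (n) in
/-- The smooth vector fields on `U`. -/
def Vf (U : Set M) : Type _ := vfMod (n := n) U

/-- The smooth horizontal vector fields on `U`. -/
def Hf (P : HorizontalData n M) (U : Set M) : Type _ := hfMod P U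

variable {U : Set M} {P : HorizontalData n M}

instance : CommRing (Fn n U) := inferInstanceAs (CommRing (fnAlg n U))
instance : Algebra ℝ (Fn n U) := inferInstanceAs (Algebra ℝ (fnAlg n U))
instance : AddCommGroup (Vf n U) := inferInstanceAs (AddCommGroup (vfMod (n := n) U))
instance : Module (Fn n U) (Vf n U) := inferInstanceAs (Module (fnAlg n U) (vfMod (n := n) U))
instance : AddCommGroup (Hf P U) := inferInstanceAs (AddCommGroup (hfMod P U))
instance : Module (Fn n U) (Hf P U) := inferInstanceAs (Module (fnAlg n U) (hfMod P U))

/-- The function defined by an element of `Fn n U`. -/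
def Fn.val (f : Fn n U) : M → ℝ := extend (E := fun _ => ℝ) f.1

/-- The vector field defined by an element of `Vf n U`. -/
def Vf.val (A : Vf n U) : (x : M) → TangentSpace (𝓡 (4 * n + 3)) x := extend A.1

/-- The horizontal vector field defined by an element of `Hf P U`. -/
def Hf.val (X : Hf P U) : (x : M) → P.H x := extend X.1

lemma Fn.smooth (f : Fn n U) : SmoothFun n U f.val := f.2
lemma Vf.smooth (A : Vf n U) : SmoothField U A.val := A.2
lemma Hf.smooth (X : Hf P U) : P.SmoothH U X.val := X.2

/-- A smooth function as an element of `Fn n U`. -/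
def Fn.mk (f : M → ℝ) (hf : SmoothFun n U f) : Fn n U :=
  ⟨fun x => f x, hf.congr fun _ hx => extend_apply _ hx⟩

/-- A smooth vector field as an element of `Vf n U`. -/
def Vf.mk (A : (x : M) → TangentSpace (𝓡 (4 * n + 3)) x) (hA : SmoothField U A) : Vf n U :=
  ⟨fun x => A x, hA.congr fun _ hx => extend_apply _ hx⟩

/-- A smooth horizontal vector field as an element of `Hf P U`. -/
def Hf.mk (X : (x : M) → P.H x) (hX : P.SmoothH U X) : Hf P U :=
  ⟨fun x => X x, SmoothField.congr hX fun x hx => by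
    simp only [HorizontalData.inc]; rw [extend_apply _ hx]⟩

variable {x : M}

lemma Fn.val_mk {f : M → ℝ} (hf : SmoothFun n U f) (hx : x ∈ U) : (Fn.mk f hf).val x = f x :=
  extend_apply _ hx

lemma Vf.val_mk {A : (x : M) → TangentSpace (𝓡 (4 * n + 3)) x} (hA : SmoothField U A)
    (hx : x ∈ U) : (Vf.mk A hA).val x = A x := extend_apply _ hx

lemma Hf.val_mk {X : (x : M) → P.H x} (hX : P.SmoothH U X) (hx : x ∈ U) :
    (Hf.mk X hX).val x = X x := extend_apply _ hx

lemma Fn.ext {f h : Fn n U} (hfh : ∀ x ∈ U, f.val x = h.val x) : f = h :=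
  Subtype.ext <| funext fun x => by
    have := hfh x x.2
    rwa [Fn.val, Fn.val, extend_apply _ x.2, extend_apply _ x.2] at this

lemma Vf.ext {A B : Vf n U} (h : ∀ x ∈ U, A.val x = B.val x) : A = B :=
  Subtype.ext <| funext fun x => by
    have := h x x.2
    rwa [Vf.val, Vf.val, extend_apply _ x.2, extend_apply _ x.2] at this

lemma Hf.ext {A B : Hf P U} (h : ∀ x ∈ U, A.val x = B.val x) : A = B :=
  Subtype.ext <| funext fun x => by
    have := h x x.2
    rwa [Hf.val, Hf.val, extend_apply _ x.2, extend_apply _ x.2] at this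

/-- Stated as an equality of functions on all of M, true because extension by zero is additive, so
that it can be rewritten under a derivative. Nonzero constants extend to functions with the right
value on U only. -/
lemma Fn.val_add (f h : Fn n U) : (f + h).val = fun x => f.val x + h.val x :=
  extend_add (E := fun _ => ℝ) f.1 h.1

lemma Fn.val_add_apply (f h : Fn n U) (x : M) : (f + h).val x = f.val x + h.val x :=
  congrFun (f.val_add h) x

lemma Fn.val_mul (f h : Fn n U) : (f * h).val = fun x => f.val x * h.val x :=
  extend_mul f.1 h.1

lemma Fn.val_mul_apply (f h : Fn n U) (x : M) : (f * h).val x = f.val x * h.val x :=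
  congrFun (f.val_mul h) x

lemma Fn.val_algebraMap (r : ℝ) (hx : x ∈ U) : (algebraMap ℝ (Fn n U) r).val x = r :=
  extend_apply _ hx

lemma Fn.val_zero (hx : x ∈ U) : (0 : Fn n U).val x = 0 := extend_apply _ hx

lemma Fn.val_one (hx : x ∈ U) : (1 : Fn n U).val x = 1 := extend_apply _ hx

lemma Fn.val_neg (f : Fn n U) (hx : x ∈ U) : (-f).val x = -f.val x := by
  rw [Fn.val, Fn.val, extend_apply _ hx, extend_apply _ hx]; rfl

lemma Fn.val_sub (f h : Fn n U) (hx : x ∈ U) : (f - h).val x = f.val x - h.val x := by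
  rw [sub_eq_add_neg, Fn.val_add_apply, Fn.val_neg _ hx, sub_eq_add_neg]

lemma Fn.val_natCast (m : ℕ) (hx : x ∈ U) : (m : Fn n U).val x = m := extend_apply _ hx

lemma Fn.val_ofNat (m : ℕ) [m.AtLeastTwo] (hx : x ∈ U) :
    (ofNat(m) : Fn n U).val x = (ofNat(m) : ℝ) := extend_apply _ hx

lemma Fn.val_sum {ι : Type*} (s : Finset ι) (f : ι → Fn n U) (hx : x ∈ U) :
    (∑ a ∈ s, f a).val x = ∑ a ∈ s, (f a).val x := by
  classical
  induction s using Finset.induction_on with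
  | empty => simp [Fn.val_zero hx]
  | insert a s ha ih => rw [Finset.sum_insert ha, Finset.sum_insert ha, Fn.val_add_apply, ih]

lemma Fn.val_ep (s : Fin 3) (hx : x ∈ U) : (ep (Fn n U) s).val x = eps s := Fn.val_algebraMap _ hx

lemma Vf.val_add (A B : Vf n U) : (A + B).val = fun x => A.val x + B.val x :=
  extend_add A.1 B.1

lemma Vf.val_add_apply (A B : Vf n U) (x : M) : (A + B).val x = A.val x + B.val x :=
  congrFun (A.val_add B) x

lemma Vf.val_smul (f : Fn n U) (A : Vf n U) : (f • A).val = fun x => f.val x • A.val x :=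
  extend_smul f.1 A.1

lemma Vf.val_smul_apply (f : Fn n U) (A : Vf n U) (x : M) : (f • A).val x = f.val x • A.val x :=
  congrFun (Vf.val_smul f A) x

lemma Vf.val_zero (x : M) : (0 : Vf n U).val x = 0 := by
  by_cases hx : x ∈ U
  · exact extend_apply _ hx
  · exact dif_neg hx

lemma Vf.val_neg (A : Vf n U) (hx : x ∈ U) : (-A).val x = -A.val x := by
  rw [Vf.val, Vf.val, extend_apply _ hx, extend_apply _ hx]; rfl

lemma Vf.val_sub (A B : Vf n U) (hx : x ∈ U) : (A - B).val x = A.val x - B.val x := by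
  rw [sub_eq_add_neg, Vf.val_add_apply, Vf.val_neg _ hx, sub_eq_add_neg]

lemma Vf.val_sum {ι : Type*} (s : Finset ι) (f : ι → Vf n U) (x : M) :
    (∑ a ∈ s, f a).val x = ∑ a ∈ s, (f a).val x := by
  classical
  induction s using Finset.induction_on with
  | empty => simp [Vf.val_zero x]
  | insert a s ha ih => rw [Finset.sum_insert ha, Finset.sum_insert ha, Vf.val_add_apply, ih]

lemma Hf.val_add (A B : Hf P U) : (A + B).val = fun x => A.val x + B.val x :=
  extend_add (E := fun x => P.H x) A.1 B.1

lemma Hf.val_add_apply (A B : Hf P U) (x : M) : (A + B).val x = A.val x + B.val x :=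
  congrFun (A.val_add B) x

lemma Hf.val_smul (f : Fn n U) (A : Hf P U) : (f • A).val = fun x => f.val x • A.val x :=
  extend_smul (E := fun x => P.H x) f.1 A.1

lemma Hf.val_smul_apply (f : Fn n U) (A : Hf P U) (x : M) : (f • A).val x = f.val x • A.val x :=
  congrFun (Hf.val_smul f A) x

lemma Hf.val_zero (x : M) : (0 : Hf P U).val x = 0 := by
  by_cases hx : x ∈ U
  · exact extend_apply _ hx
  · exact dif_neg hx

lemma Hf.val_neg (A : Hf P U) (hx : x ∈ U) : (-A).val x = -A.val x := by
  rw [Hf.val, Hf.val, extend_apply _ hx, extend_apply _ hx]; rfl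

lemma Hf.val_sub (A B : Hf P U) (hx : x ∈ U) : (A - B).val x = A.val x - B.val x := by
  rw [sub_eq_add_neg, Hf.val_add_apply, Hf.val_neg _ hx, sub_eq_add_neg]

lemma Hf.val_sum {ι : Type*} (s : Finset ι) (f : ι → Hf P U) (x : M) :
    (∑ a ∈ s, f a).val x = ∑ a ∈ s, (f a).val x := by
  classical
  induction s using Finset.induction_on with
  | empty => simp [Hf.val_zero x]
  | insert a s ha ih => rw [Finset.sum_insert ha, Finset.sum_insert ha, Hf.val_add_apply, ih]

end Modules

/-! ## The algebraic model of the smooth sections over an open set -/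

section Model

variable {n : ℕ} {M : Type*} [TopologicalSpace M] [T2Space M]
  [ChartedSpace (EuclideanSpace ℝ (Fin (4 * n + 3))) M]
  [IsManifold (𝓡 (4 * n + 3)) ∞ M] {P : HorizontalData n M} {C : P.Connection}
  {U : Set M} {F : P.LocalFrame}

/-- The metric on sections. -/
def gSec (hP : P.IsPQC) (hU : IsOpen U) : Hf P U →ₗ[Fn n U] Hf P U →ₗ[Fn n U] Fn n U :=
  LinearMap.mk₂ (Fn n U)
    (fun X Y => Fn.mk (fun x => P.g x (X.val x) (Y.val x)) (hP.smooth_g U hU _ _ X.smooth Y.smooth))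
    (fun X Y Z => Fn.ext fun x hx => by
      simp only [Fn.val_add_apply, Fn.val_mk _ hx, Hf.val_add_apply, map_add, LinearMap.add_apply])
    (fun f Y Z => Fn.ext fun x hx => by
      simp only [smul_eq_mul, Fn.val_mul_apply, Fn.val_mk _ hx, Hf.val_smul_apply, map_smul,
        LinearMap.smul_apply])
    (fun X Y Z => Fn.ext fun x hx => by
      simp only [Fn.val_add_apply, Fn.val_mk _ hx, Hf.val_add_apply, map_add])
    (fun f Y Z => Fn.ext fun x hx => by
      simp only [smul_eq_mul, Fn.val_mul_apply, Fn.val_mk _ hx, Hf.val_smul_apply, map_smul])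

lemma val_gSec (hP : P.IsPQC) (hU : IsOpen U) (X Y : Hf P U) {x : M} (hx : x ∈ U) :
    (gSec hP hU X Y).val x = P.g x (X.val x) (Y.val x) := Fn.val_mk _ hx

/-- The endomorphism `J s` on sections. -/
def JSec (hU : IsOpen U) (hF : F.IsAdapted U) (s : Fin 3) : Hf P U →ₗ[Fn n U] Hf P U where
  toFun X := Hf.mk (fun x => F.J s x (X.val x))
    (hF.admissible.smooth_end s U hU subset_rfl _ X.smooth)
  map_add' X Y := Hf.ext fun x hx => by
    simp only [Hf.val_add_apply, Hf.val_mk _ hx, map_add]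
  map_smul' f Y := Hf.ext fun x hx => by
    simp only [RingHom.id_apply, Hf.val_smul_apply, Hf.val_mk _ hx, map_smul]

lemma val_JSec (hU : IsOpen U) (hF : F.IsAdapted U) (s : Fin 3) (X : Hf P U) {x : M}
    (hx : x ∈ U) : (JSec hU hF s X).val x = F.J s x (X.val x) := Hf.val_mk _ hx

/-- Horizontal vector fields as vector fields. -/
def incSec (P : HorizontalData n M) (U : Set M) : Hf P U →ₗ[Fn n U] Vf n U where
  toFun X := Vf.mk (P.inc X.val) X.smooth
  map_add' X Y := Vf.ext fun x hx => by
    have h (Z : Hf P U) := Vf.val_mk (A := P.inc Z.val) Z.smooth hx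
    rw [Vf.val_add_apply, h, h, h]
    simp only [HorizontalData.inc, Hf.val_add_apply, Submodule.coe_add]
  map_smul' f Y := Vf.ext fun x hx => by
    have h (Z : Hf P U) := Vf.val_mk (A := P.inc Z.val) Z.smooth hx
    rw [RingHom.id_apply, Vf.val_smul_apply, h, h]
    simp only [HorizontalData.inc, Hf.val_smul_apply, Submodule.coe_smul]

lemma val_incSec (X : Hf P U) {x : M} (hx : x ∈ U) :
    (incSec P U X).val x = P.inc X.val x := Vf.val_mk X.smooth hx

/-- The horizontal part of a vector field. -/
def horSec (hP : P.IsPQC) (hn : 1 ≤ n) (hC : C.IsCanonical) (hU : IsOpen U) (hF : F.IsAdapted U) :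
    Vf n U →ₗ[Fn n U] Hf P U where
  toFun A := Hf.mk (fun x => C.hor x (A.val x)) (smoothH_hor hP hn hC hU hF A.smooth)
  map_add' X Y := Hf.ext fun x hx => by
    simp only [Hf.val_add_apply, Hf.val_mk _ hx, Vf.val_add_apply, map_add]
  map_smul' f Y := Hf.ext fun x hx => by
    simp only [RingHom.id_apply, Hf.val_smul_apply, Hf.val_mk _ hx, Vf.val_smul_apply, map_smul]

lemma val_horSec (hP : P.IsPQC) (hn : 1 ≤ n) (hC : C.IsCanonical) (hU : IsOpen U)
    (hF : F.IsAdapted U) (A : Vf n U) {x : M} (hx : x ∈ U) :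
    (horSec hP hn hC hU hF A).val x = C.hor x (A.val x) := Hf.val_mk _ hx

/-- The contact forms on sections. -/
def etaSec (hU : IsOpen U) (hF : F.IsAdapted U) (s : Fin 3) : Vf n U →ₗ[Fn n U] Fn n U where
  toFun A := Fn.mk (fun x => F.η s x (A.val x))
    (hF.admissible.smooth_form s U hU subset_rfl _ A.smooth)
  map_add' X Y := Fn.ext fun x hx => by
    simp only [Fn.val_add_apply, Fn.val_mk _ hx, Vf.val_add_apply, map_add]
  map_smul' f Y := Fn.ext fun x hx => by
    simp only [RingHom.id_apply, smul_eq_mul, Fn.val_mul_apply, Fn.val_mk _ hx, Vf.val_smul_apply,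
      map_smul]

lemma val_etaSec (hU : IsOpen U) (hF : F.IsAdapted U) (s : Fin 3) (A : Vf n U) {x : M}
    (hx : x ∈ U) : (etaSec hU hF s A).val x = F.η s x (A.val x) := Fn.val_mk _ hx

/-- The horizontal frame as sections. -/
def eSec (hF : F.IsAdapted U) (a : Fin (4 * n)) : Hf P U := Hf.mk (F.e a) (hF.smooth a)

lemma val_eSec (hF : F.IsAdapted U) (a : Fin (4 * n)) {x : M} (hx : x ∈ U) :
    (eSec hF a).val x = F.e a x := Hf.val_mk _ hx

/-- The metric, the paraquaternionic structure and the frame on sections. -/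
def pqSec (hP : P.IsPQC) (hn : 1 ≤ n) (hU : IsOpen U) (hF : F.IsAdapted U) :
    PQModule n (Fn n U) (Hf P U) where
  g := gSec hP hU
  J := JSec hU hF
  e := eSec hF
  g_symm X Y := Fn.ext fun x hx => by
    rw [val_gSec hP hU _ _ hx, val_gSec hP hU _ _ hx, hP.symm]
  J_sq s X := Hf.ext fun x hx => by
    rw [val_JSec hU hF _ _ hx, val_JSec hU hF _ _ hx, Hf.val_smul_apply, Fn.val_ep _ hx]
    exact LinearMap.congr_fun (hF.admissible.sq x hx s) _
  J_mul i X := Hf.ext fun x hx => by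
    rw [val_JSec hU hF _ _ hx, val_JSec hU hF _ _ hx, Hf.val_smul_apply, Fn.val_neg _ hx,
      Fn.val_ep _ hx, val_JSec hU hF _ _ hx]
    exact LinearMap.congr_fun (hF.admissible.mul x hx i) _
  J_mul_swap i X := Hf.ext fun x hx => by
    rw [val_JSec hU hF _ _ hx, val_JSec hU hF _ _ hx, Hf.val_smul_apply,
      Fn.val_ep _ hx, val_JSec hU hF _ _ hx]
    exact LinearMap.congr_fun (hF.admissible.mul_swap x hx i) _
  g_J_J s X Y := Fn.ext fun x hx => by
    rw [val_gSec hP hU _ _ hx, val_JSec hU hF _ _ hx, val_JSec hU hF _ _ hx, Fn.val_mul_apply,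
      Fn.val_neg _ hx, Fn.val_ep _ hx, val_gSec hP hU _ _ hx]
    exact hF.admissible.compat x hx s _ _
  sgn_sq a := Fn.ext fun x hx => by
    rw [Fn.val_mul_apply, val_gSec hP hU _ _ hx, val_eSec hF _ hx, Fn.val_one hx]
    rcases (hF.orthonormal x hx).1 a with h | h <;> rw [h] <;> norm_num
  expand X := Hf.ext fun x hx => by
    simp only [Hf.val_sum, Hf.val_smul_apply, Fn.val_mul_apply, val_gSec hP hU _ _ hx,
      val_eSec hF _ hx]
    exact (hF.orthonormal x hx).expand hP hn _

/-- The derivative of a function along a vector field. -/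
def DSec (hU : IsOpen U) (hF : F.IsAdapted U) (A : Vf n U) (f : Fn n U) : Fn n U :=
  Fn.mk (fun x => dirDeriv f.val x (A.val x)) (smoothFun_dirDeriv hU hF A.smooth f.smooth)

lemma val_DSec (hU : IsOpen U) (hF : F.IsAdapted U) (A : Vf n U) (f : Fn n U) {x : M}
    (hx : x ∈ U) : (DSec hU hF A f).val x = dirDeriv f.val x (A.val x) := Fn.val_mk _ hx

/-- The bracket of vector fields on `U`. -/
def lieSec (hU : IsOpen U) (A B : Vf n U) : Vf n U :=
  Vf.mk (VectorField.mlieBracket (𝓡 (4 * n + 3)) A.val B.val) (A.smooth.mlieBracket hU B.smooth)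

lemma val_lieSec (hU : IsOpen U) (A B : Vf n U) {x : M} (hx : x ∈ U) :
    (lieSec hU A B).val x = VectorField.mlieBracket (𝓡 (4 * n + 3)) A.val B.val x :=
  Vf.val_mk _ hx

/-- The covariant derivative of vector fields on `U`. -/
def nbSec (hC : C.IsCanonical) (hU : IsOpen U) (A B : Vf n U) : Vf n U :=
  Vf.mk (C.nabla A.val B.val) (A.smooth.nabla C hC.smooth hU B.smooth)

lemma val_nbSec (hC : C.IsCanonical) (hU : IsOpen U) (A B : Vf n U) {x : M} (hx : x ∈ U) :
    (nbSec hC hU A B).val x = C.nabla A.val B.val x := Vf.val_mk _ hx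

/-- The Reeb vector fields as sections. -/
def xiSec (hF : F.IsAdapted U) (s : Fin 3) : Vf n U := Vf.mk (F.ξ s) (hF.reeb.smooth s)

lemma val_xiSec (hF : F.IsAdapted U) (s : Fin 3) {x : M} (hx : x ∈ U) :
    (xiSec hF s).val x = F.ξ s x := Vf.val_mk _ hx

lemma val_nbSec_inc (hC : C.IsCanonical) (hU : IsOpen U) (A : Vf n U) (X : Hf P U) {x : M}
    (hx : x ∈ U) : (nbSec hC hU A (incSec P U X)).val x = C.cov (P.inc X.val) x (A.val x) := by
  rw [val_nbSec hC hU _ _ hx]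
  exact nabla_congr C hU (Vf.smooth _) (fun _ _ => rfl) (fun y hy => val_incSec X hy) hx

lemma val_nbSec_xi (hC : C.IsCanonical) (hU : IsOpen U) (hF : F.IsAdapted U) (A : Vf n U)
    (s : Fin 3) {x : M} (hx : x ∈ U) :
    (nbSec hC hU A (xiSec hF s)).val x = C.cov (F.ξ s) x (A.val x) := by
  rw [val_nbSec hC hU _ _ hx]
  exact nabla_congr C hU (Vf.smooth _) (fun _ _ => rfl) (fun y hy => val_xiSec hF s hy) hx

lemma val_hor_nbSec_inc (hP : P.IsPQC) (hn : 1 ≤ n) (hC : C.IsCanonical) (hU : IsOpen U)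
    (hF : F.IsAdapted U) (A : Vf n U) (X : Hf P U) {x : M} (hx : x ∈ U) :
    (horSec hP hn hC hU hF (nbSec hC hU A (incSec P U X))).val x
      = C.nablaAt X.val x (A.val x) := by
  rw [val_horSec hP hn hC hU hF _ hx, val_nbSec_inc hC hU _ _ hx]; rfl

/-- The connection is local, so fields that agree on the open set have the same derivative there;
this allows extensions by zero to replace the given fields. -/
lemma nablaAt_congr (C : P.Connection) (hU : IsOpen U) {X X' : (x : M) → P.H x}
    (hX : P.SmoothH U X) (h : ∀ x ∈ U, X x = X' x) {x : M} (hx : x ∈ U)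
    {v : TangentSpace (𝓡 (4 * n + 3)) x} : C.nablaAt X x v = C.nablaAt X' x v := by
  have := nabla_congr C (A := fun _ => v) (A' := fun _ => v) (B := P.inc X) (B' := P.inc X') hU hX
    (fun _ _ => rfl) (fun y hy => congrArg Subtype.val (h y hy)) hx
  exact congrArg (C.hor x) this

lemma val_lieSec_congr (hU : IsOpen U) {A B : Vf n U}
    {A' B' : (x : M) → TangentSpace (𝓡 (4 * n + 3)) x} (hA : ∀ x ∈ U, A.val x = A' x)
    (hB : ∀ x ∈ U, B.val x = B' x) {x : M} (hx : x ∈ U) :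
    (lieSec hU A B).val x = VectorField.mlieBracket (𝓡 (4 * n + 3)) A' B' x := by
  rw [val_lieSec hU _ _ hx, mlieBracket_congr hU hA hB hx]

lemma val_torsion (hC : C.IsCanonical) (hU : IsOpen U) (A B : Vf n U) {x : M} (hx : x ∈ U) :
    (nbSec hC hU A B - nbSec hC hU B A - lieSec hU A B).val x
      = C.cov.torsion x (A.val x) (B.val x) := by
  rw [Vf.val_sub _ _ hx, Vf.val_sub _ _ hx, val_nbSec hC hU _ _ hx, val_nbSec hC hU _ _ hx,
    val_lieSec hU _ _ hx, torsion_eq C hU A.smooth B.smooth hx]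

lemma val_hor_torsion_xi (hP : P.IsPQC) (hn : 1 ≤ n) (hC : C.IsCanonical) (hU : IsOpen U)
    (hF : F.IsAdapted U) (s : Fin 3) (X : Hf P U) {x : M} (hx : x ∈ U) :
    (horSec hP hn hC hU hF (nbSec hC hU (xiSec hF s) (incSec P U X)
      - nbSec hC hU (incSec P U X) (xiSec hF s) - lieSec hU (xiSec hF s) (incSec P U X))).val x
      = C.torH x (F.ξ s x) (X.val x) := by
  rw [val_horSec hP hn hC hU hF _ hx, val_torsion hC hU _ _ hx, val_xiSec hF _ hx,
    val_incSec _ hx]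
  rfl

/-- The orthogonality condition is pointwise, while the axioms of `Geo` test against maps of
sections. It suffices that the map of sections induces at x an endomorphism in sp(n, ℝ) ⊕ sp(1, ℝ).
-/
lemma val_torsion_sum (hP : P.IsPQC) (hn : 1 ≤ n) (hC : C.IsCanonical) (hU : IsOpen U)
    (hF : F.IsAdapted U) (s : Fin 3) (B : Hf P U → Hf P U) {x : M} (hx : x ∈ U)
    (B' : Module.End ℝ (P.H x)) (hB' : P.InSpSp x B')
    (hB : ∀ X, (B X).val x = B' (X.val x)) :
    (∑ a, gSec hP hU (eSec hF a) (eSec hF a) * gSec hP hU (horSec hP hn hC hU hF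
      (nbSec hC hU (xiSec hF s) (incSec P U (eSec hF a))
        - nbSec hC hU (incSec P U (eSec hF a)) (xiSec hF s)
        - lieSec hU (xiSec hF s) (incSec P U (eSec hF a)))) (B (eSec hF a))).val x = 0 := by
  rw [Fn.val_sum _ _ hx,
    ← hC.torsion_V x _ (reeb_mem_V hP hn hC hU hF hx s) B' hB' _ (hF.orthonormal x hx)]
  refine Finset.sum_congr rfl fun a _ => ?_
  rw [Fn.val_mul_apply, val_gSec hP hU _ _ hx, val_gSec hP hU _ _ hx,
    val_hor_torsion_xi hP hn hC hU hF _ _ hx, hB, val_eSec hF _ hx]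

/-- The smooth sections over `U` with the operations of the pqc structure. -/
def geoSec (hP : P.IsPQC) (hn : 1 ≤ n) (hC : C.IsCanonical) (hU : IsOpen U) (hF : F.IsAdapted U) :
    Geo n (Fn n U) (Vf n U) (Hf P U) where
  toPQModule := pqSec hP hn hU hF
  D := DSec hU hF
  lie := lieSec hU
  nb := nbSec hC hU
  inc := incSec P U
  hor := horSec hP hn hC hU hF
  eta := etaSec hU hF
  xi := xiSec hF
  D_add_left u v f := Fn.ext fun x hx => by
    simp only [val_DSec hU hF _ _ hx, Fn.val_add_apply, Vf.val_add_apply, dirDeriv, map_add]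
  D_smul_left h u f := Fn.ext fun x hx => by
    simp only [val_DSec hU hF _ _ hx, Fn.val_mul_apply, Vf.val_smul_apply, dirDeriv, map_smul,
      smul_eq_mul]
  D_add u f h := Fn.ext fun x hx => by
    rw [val_DSec hU hF _ _ hx, Fn.val_add, dirDeriv_add hU f.smooth h.smooth hx,
      Fn.val_add_apply, val_DSec hU hF _ _ hx, val_DSec hU hF _ _ hx]
  D_mul u f h := Fn.ext fun x hx => by
    rw [val_DSec hU hF _ _ hx, Fn.val_mul, dirDeriv_mul hU f.smooth h.smooth hx,
      Fn.val_add_apply, Fn.val_mul_apply, Fn.val_mul_apply, val_DSec hU hF _ _ hx,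
      val_DSec hU hF _ _ hx]
  D_const u r := Fn.ext fun x hx => by
    rw [val_DSec hU hF _ _ hx, dirDeriv_congr (h := fun _ => r)
      (Filter.eventually_of_mem (hU.mem_nhds hx) fun y hy => Fn.val_algebraMap r hy),
      dirDeriv_const, Fn.val_zero hx]
  lie_swap u v := Vf.ext fun x hx => by
    rw [Vf.val_neg _ hx, val_lieSec hU _ _ hx, val_lieSec hU _ _ hx, mlieBracket_swap]
  lie_add u v w := Vf.ext fun x hx => by
    rw [Vf.val_add_apply, val_lieSec hU _ _ hx, val_lieSec hU _ _ hx, val_lieSec hU _ _ hx,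
      Vf.val_add, mlieBracket_add hU v.smooth w.smooth hx]
  lie_smul u f v := Vf.ext fun x hx => by
    rw [Vf.val_add_apply, Vf.val_smul_apply, Vf.val_smul_apply, val_lieSec hU _ _ hx,
      val_lieSec hU _ _ hx, Vf.val_smul, mlieBracket_smul hU f.smooth v.smooth hx,
      val_DSec hU hF _ _ hx]
  jacobi u v w := Vf.ext fun x hx => by
    rw [Vf.val_add_apply, val_lieSec_congr hU (fun _ _ => rfl) (fun y hy => val_lieSec hU v w hy) hx,
      val_lieSec_congr hU (fun y hy => val_lieSec hU u v hy) (fun _ _ => rfl) hx,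
      val_lieSec_congr hU (fun _ _ => rfl) (fun y hy => val_lieSec hU u w hy) hx,
      mlieBracket_jacobi hU u.smooth v.smooth w.smooth hx]
  nb_add_left u v w := Vf.ext fun x hx => by
    simp only [val_nbSec hC hU _ _ hx, Vf.val_add_apply, HorizontalData.Connection.nabla, map_add]
  nb_smul_left f u w := Vf.ext fun x hx => by
    simp only [val_nbSec hC hU _ _ hx, Vf.val_smul_apply, HorizontalData.Connection.nabla, map_smul]
  nb_add u v w := Vf.ext fun x hx => by
    rw [Vf.val_add_apply, val_nbSec hC hU _ _ hx, val_nbSec hC hU _ _ hx, val_nbSec hC hU _ _ hx,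
      Vf.val_add, nabla_add C hU v.smooth w.smooth hx]
  nb_smul u f v := Vf.ext fun x hx => by
    rw [Vf.val_add_apply, Vf.val_smul_apply, Vf.val_smul_apply, val_nbSec hC hU _ _ hx,
      val_nbSec hC hU _ _ hx, Vf.val_smul, nabla_smul C hU f.smooth v.smooth hx,
      val_DSec hU hF _ _ hx]
  hor_inc X := Hf.ext fun x hx => by
    rw [val_horSec hP hn hC hU hF _ hx, val_incSec _ hx, hor_inc]
  hor_xi s := Hf.ext fun x hx => by
    rw [val_horSec hP hn hC hU hF _ hx, val_xiSec hF _ hx,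
      hor_of_mem_V (reeb_mem_V hP hn hC hU hF hx s), Hf.val_zero]
  eta_inc s X := Fn.ext fun x hx => by
    rw [val_etaSec hU hF _ _ hx, val_incSec _ hx, Fn.val_zero hx]
    exact hF.admissible.eta_inc hx _ s
  eta_xi s t := Fn.ext fun x hx => by
    rw [val_etaSec hU hF _ _ hx, val_xiSec hF _ hx, hF.reeb.dual x hx]
    split_ifs
    · rw [Fn.val_one hx]
    · rw [Fn.val_zero hx]
  decomp v := Vf.ext fun x hx => by
    rw [Vf.val_add_apply, Vf.val_sum, val_incSec _ hx, HorizontalData.inc,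
      val_horSec hP hn hC hU hF _ hx, coe_hor hP hn hC hU hF hx]
    simp only [Vf.val_smul_apply, val_etaSec hU hF _ _ hx, val_xiSec hF _ hx, sub_add_cancel]
  eta_nb_inc s v Y := Fn.ext fun x hx => by
    rw [val_etaSec hU hF _ _ hx, val_nbSec_inc hC hU _ _ hx, Fn.val_zero hx]
    exact (hF.admissible.ker x hx _).1 (cov_inc_mem hC hU Y.smooth hx _) s
  hor_nb_xi s v := Hf.ext fun x hx => by
    rw [val_horSec hP hn hC hU hF _ hx, val_nbSec_xi hC hU hF _ _ hx, Hf.val_zero]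
    exact hor_of_mem_V (cov_reeb_mem hP hn hC hU hF hx _ s)
  metric v Y Z := Fn.ext fun x hx => by
    rw [val_DSec hU hF _ _ hx, Fn.val_add_apply]
    change dirDeriv (gSec hP hU Y Z).val x _ = _
    rw [dirDeriv_congr (h := fun y => P.g y (Y.val y) (Z.val y)) (Filter.eventually_of_mem (hU.mem_nhds hx)
        fun y hy => val_gSec hP hU Y Z hy), hC.metric U hU _ _ Y.smooth Z.smooth x hx]
    change _ = (gSec hP hU _ _).val x + (gSec hP hU _ _).val x
    rw [val_gSec hP hU _ _ hx, val_gSec hP hU _ _ hx, val_hor_nbSec_inc hP hn hC hU hF _ _ hx,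
      val_hor_nbSec_inc hP hn hC hU hF _ _ hx]
  parallel v s Y := Hf.ext fun x hx => by
    change (_ - JSec hU hF s _).val x = (∑ t, _ • JSec hU hF t Y).val x
    rw [Hf.val_sub _ _ hx, Hf.val_sum, val_JSec hU hF _ _ hx,
      val_hor_nbSec_inc hP hn hC hU hF _ _ hx, val_hor_nbSec_inc hP hn hC hU hF _ _ hx]
    simp only [Hf.val_smul_apply, val_JSec hU hF _ _ hx, val_etaSec hU hF _ _ hx,
      val_nbSec_xi hC hU hF _ _ hx]
    rw [← hC.parallel U hU _ _ _ hF.admissible hF.reeb _ Y.smooth x hx]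
    exact congrArg (· - _)
      (nablaAt_congr C hU (Hf.smooth _) (fun y hy => val_JSec hU hF s Y hy) hx)
  hor_tor X Y := Hf.ext fun x hx => by
    rw [val_horSec hP hn hC hU hF _ hx, val_torsion hC hU _ _ hx, val_incSec _ hx,
      val_incSec _ hx, Hf.val_zero]
    have h := hC.torsion_H U hU _ _ X.smooth Y.smooth x hx
    change C.hor x (C.cov.torsion x (X.val x) (Y.val x)) = 0
    rw [h]
    exact hor_of_mem_V (Submodule.neg_mem _ (Subtype.mem _))
  contact s X Y := Fn.ext fun x hx => by
    rw [val_etaSec hU hF _ _ hx, val_lieSec_congr hU (fun y hy => val_incSec X hy)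
      (fun y hy => val_incSec Y hy) hx,
      eta_mlieBracket_inc hU hF.admissible X.smooth Y.smooth hx, Fn.val_mul_apply,
      Fn.val_mul_apply, Fn.val_ofNat _ hx, Fn.val_ep _ hx]
    change _ = _ * (gSec hP hU (JSec hU hF s X) Y).val x
    rw [val_gSec hP hU _ _ hx, val_JSec hU hF _ _ hx]
  reeb s Y := Fn.ext fun x hx => by
    rw [val_etaSec hU hF _ _ hx, val_lieSec_congr hU (fun y hy => val_xiSec hF s hy)
      (fun y hy => val_incSec Y hy) hx,
      eta_mlieBracket_reeb hU hF.admissible hF.reeb Y.smooth hx, Fn.val_zero hx]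
  dim_seven hn1 i Y := Fn.ext fun x hx => by
    rw [Fn.val_mul_apply, Fn.val_ep _ hx, val_etaSec hU hF _ _ hx, val_etaSec hU hF _ _ hx,
      val_lieSec_congr hU (fun y hy => val_xiSec hF _ hy) (fun y hy => val_incSec Y hy) hx,
      val_lieSec_congr hU (fun y hy => val_xiSec hF _ hy) (fun y hy => val_incSec Y hy) hx,
      eta_mlieBracket_dim_seven hU hF.admissible hF.reeb hn1 Y.smooth hx]
  tor_J s u := Fn.ext fun x hx => by
    rw [Fn.val_zero hx]
    exact val_torsion_sum hP hn hC hU hF s (JSec hU hF u) hx (F.J u x)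
      (inSpSp_J hF.admissible hx u) fun X => val_JSec hU hF u X hx
  tor_sp s X Y := Fn.ext fun x hx => by
    rw [Fn.val_zero hx]
    refine val_torsion_sum hP hn hC hU hF s (fun Z => gSec hP hU X Z • Y - gSec hP hU Y Z • X
        - ∑ u, ep (Fn n U) u • (gSec hP hU (JSec hU hF u X) Z • JSec hU hF u Y
          - gSec hP hU (JSec hU hF u Y) Z • JSec hU hF u X)) hx
      (skewAverage P F.J x (X.val x) (Y.val x)) (inSpSp_skewAverage hP hn hF.admissible hx _ _)
      fun Z => ?_
    simp only [Hf.val_sub _ _ hx, Hf.val_sum, Hf.val_smul_apply, val_gSec hP hU _ _ hx,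
      val_JSec hU hF _ _ hx, Fn.val_ep _ hx, skewAverage_apply]

end Model

/-! ## The tensors of the manifold as elements of the algebraic model -/

section Transfer

variable {n : ℕ} {M : Type*} [TopologicalSpace M] [T2Space M]
  [ChartedSpace (EuclideanSpace ℝ (Fin (4 * n + 3))) M]
  [IsManifold (𝓡 (4 * n + 3)) ∞ M] {P : HorizontalData n M} {C : P.Connection}
  {U : Set M} {F : P.LocalFrame}

/-- The section `f` over `U` is the restriction of the function `f'`. -/
def Fn.Rep (f : Fn n U) (f' : M → ℝ) : Prop := ∀ x ∈ U, f.val x = f' x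

/-- The section `A` over `U` is the restriction of the vector field `A'`. -/
def Vf.Rep (A : Vf n U) (A' : (x : M) → TangentSpace (𝓡 (4 * n + 3)) x) : Prop :=
  ∀ x ∈ U, A.val x = A' x

/-- The section `X` over `U` is the restriction of the horizontal vector field `X'`. -/
def Hf.Rep (X : Hf P U) (X' : (x : M) → P.H x) : Prop := ∀ x ∈ U, X.val x = X' x

variable (hP : P.IsPQC) (hn : 1 ≤ n) (hC : C.IsCanonical) (hU : IsOpen U) (hF : F.IsAdapted U)
  {A B D : Vf n U} {A' B' D' : (x : M) → TangentSpace (𝓡 (4 * n + 3)) x}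
  {X Y : Hf P U} {X' Y' : (x : M) → P.H x} {f : Fn n U} {f' : M → ℝ} {x : M}

lemma rep_lie (hA : A.Rep A') (hB : B.Rep B') :
    ((geoSec hP hn hC hU hF).lie A B).Rep (VectorField.mlieBracket (𝓡 (4 * n + 3)) A' B') :=
  fun _ hx => val_lieSec_congr hU hA hB hx

lemma rep_nb (hA : A.Rep A') (hB : B.Rep B') :
    ((geoSec hP hn hC hU hF).nb A B).Rep (C.nabla A' B') := fun x hx => by
  change (nbSec hC hU A B).val x = _
  rw [val_nbSec hC hU _ _ hx]
  exact nabla_congr C hU B.smooth hA hB hx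

/-- A derivative depends on a neighbourhood, which is why `Rep` demands agreement on the whole open
set and not at one point. -/
lemma rep_D (hA : A.Rep A') (hf : f.Rep f') :
    ((geoSec hP hn hC hU hF).D A f).Rep (fun x => dirDeriv f' x (A' x)) := fun x hx => by
  change (DSec hU hF A f).val x = _
  rw [val_DSec hU hF _ _ hx, hA x hx]
  exact dirDeriv_congr (Filter.eventually_of_mem (hU.mem_nhds hx) hf)

lemma rep_inc (hX : X.Rep X') : ((geoSec hP hn hC hU hF).inc X).Rep (P.inc X') := fun x hx => by
  change (incSec P U X).val x = _
  rw [val_incSec _ hx, HorizontalData.inc, hX x hx]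
  rfl

lemma rep_nh (hA : A.Rep A') (hX : X.Rep X') :
    ((geoSec hP hn hC hU hF).nh A X).Rep (fun x => C.nablaAt X' x (A' x)) := fun x hx => by
  refine (val_hor_nbSec_inc hP hn hC hU hF A X hx).trans ?_
  rw [hA x hx]
  exact nablaAt_congr C hU X.smooth hX hx

lemma rep_J (hX : X.Rep X') (s : Fin 3) :
    ((geoSec hP hn hC hU hF).J s X).Rep (F.app s X') := fun x hx => by
  refine (val_JSec hU hF s X hx).trans ?_
  rw [hX x hx]
  rfl

lemma rep_xi (s : Fin 3) : ((geoSec hP hn hC hU hF).xi s).Rep (F.ξ s) :=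
  fun _ hx => val_xiSec hF s hx

lemma rep_e (a : Fin (4 * n)) : ((geoSec hP hn hC hU hF).e a).Rep (F.e a) :=
  fun _ hx => val_eSec hF a hx

lemma val_g (X Y : Hf P U) (hx : x ∈ U) :
    ((geoSec hP hn hC hU hF).g X Y).val x = P.g x (X.val x) (Y.val x) := val_gSec hP hU X Y hx

lemma val_J (s : Fin 3) (X : Hf P U) (hx : x ∈ U) :
    ((geoSec hP hn hC hU hF).J s X).val x = F.J s x (X.val x) := val_JSec hU hF s X hx

lemma val_eta (s : Fin 3) (A : Vf n U) (hx : x ∈ U) :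
    ((geoSec hP hn hC hU hF).eta s A).val x = F.η s x (A.val x) := val_etaSec hU hF s A hx

lemma val_hor (A : Vf n U) (hx : x ∈ U) :
    ((geoSec hP hn hC hU hF).hor A).val x = C.hor x (A.val x) := val_horSec hP hn hC hU hF A hx

lemma rep_omega (hX : X.Rep X') (hY : Y.Rep Y') (s : Fin 3) :
    ((geoSec hP hn hC hU hF).g ((geoSec hP hn hC hU hF).J s X) Y).Rep (F.ω s X' Y') :=
  fun x hx => by rw [val_g hP hn hC hU hF _ _ hx, val_J hP hn hC hU hF _ _ hx, hX x hx, hY x hx]; rfl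

lemma rep_curv (hA : A.Rep A') (hB : B.Rep B') (hD : D.Rep D') :
    ((geoSec hP hn hC hU hF).curv A B D).Rep (C.curv A' B' D') := fun x hx => by
  rw [Geo.curv_apply, Vf.val_sub _ _ hx, Vf.val_sub _ _ hx,
    rep_nb hP hn hC hU hF hA (rep_nb hP hn hC hU hF hB hD) x hx,
    rep_nb hP hn hC hU hF hB (rep_nb hP hn hC hU hF hA hD) x hx,
    rep_nb hP hn hC hU hF (rep_lie hP hn hC hU hF hA hB) hD x hx]
  rfl

lemma rep_R (hA : A.Rep A') (hB : B.Rep B') (hX : X.Rep X') (hY : Y.Rep Y') :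
    ((geoSec hP hn hC hU hF).g ((geoSec hP hn hC hU hF).RH A B X) Y).Rep (C.R A' B' X' Y') :=
  fun x hx => by
    rw [val_g hP hn hC hU hF _ _ hx, Geo.RH_apply, val_hor hP hn hC hU hF _ hx,
      rep_curv hP hn hC hU hF hA hB (rep_inc hP hn hC hU hF hX) x hx, hY x hx]
    rfl

lemma rep_tr {φ : Hf P U → Hf P U → Fn n U} {ψ : Fin (4 * n) → M → ℝ}
    (h : ∀ a, (φ ((geoSec hP hn hC hU hF).e a) ((geoSec hP hn hC hU hF).e a)).Rep (ψ a)) :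
    ((geoSec hP hn hC hU hF).tr φ).Rep (fun x => ∑ a, F.sgn a x * ψ a x) := fun x hx => by
  rw [PQModule.tr, Fn.val_sum _ _ hx]
  refine Finset.sum_congr rfl fun a _ => ?_
  rw [Fn.val_mul_apply, h a x hx, val_g hP hn hC hU hF _ _ hx, rep_e hP hn hC hU hF a x hx]
  rfl

lemma rep_rho (s : Fin 3) (hA : A.Rep A') (hB : B.Rep B') :
    ((geoSec hP hn hC hU hF).rho s A B).Rep (C.rho F s A' B') := fun x hx => by
  have h := rep_tr hP hn hC hU hF (φ := fun Y Z => (geoSec hP hn hC hU hF).g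
    ((geoSec hP hn hC hU hF).RH A B Y) ((geoSec hP hn hC hU hF).J s Z)) (fun a =>
    rep_R hP hn hC hU hF hA hB (rep_e hP hn hC hU hF a)
      (rep_J hP hn hC hU hF (rep_e hP hn hC hU hF a) s)) x hx
  rw [Geo.rho, Fn.val_mul_apply, Fn.val_algebraMap _ hx, h]
  rfl

lemma rep_Ric (hX : X.Rep X') (hY : Y.Rep Y') :
    ((geoSec hP hn hC hU hF).Ric X Y).Rep (C.Ric F X' Y') :=
  rep_tr hP hn hC hU hF fun a => rep_R hP hn hC hU hF
    (rep_inc hP hn hC hU hF (rep_e hP hn hC hU hF a)) (rep_inc hP hn hC hU hF hX) hY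
    (rep_e hP hn hC hU hF a)

lemma rep_Scal : (geoSec hP hn hC hU hF).Scal.Rep (C.Scal F) :=
  rep_tr hP hn hC hU hF fun a => rep_Ric hP hn hC hU hF (rep_e hP hn hC hU hF a)
    (rep_e hP hn hC hU hF a)

lemma val_TT (s : Fin 3) (X Y : Hf P U) (hx : x ∈ U) :
    ((geoSec hP hn hC hU hF).TT s X Y).val x = C.T x (F.ξ s x) (X.val x) (Y.val x) := by
  rw [Geo.TT, val_g hP hn hC hU hF _ _ hx]
  have h : ((geoSec hP hn hC hU hF).tt s X).val x = C.torH x (F.ξ s x) (X.val x) :=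
    val_hor_torsion_xi hP hn hC hU hF s X hx
  rw [h]
  rfl

lemma val_tau (X Y : Hf P U) (hx : x ∈ U) :
    ((geoSec hP hn hC hU hF).tau X Y).val x = C.tau F x (X.val x) (Y.val x) := by
  rw [Geo.tau, Fn.val_neg _ hx, Fn.val_sum _ _ hx]
  refine congrArg Neg.neg (Finset.sum_congr rfl fun s _ => ?_)
  rw [Geo.TS, Fn.val_mul_apply, Fn.val_ep _ hx, Fn.val_mul_apply, Fn.val_algebraMap _ hx,
    Fn.val_add_apply, val_TT hP hn hC hU hF _ _ _ hx, val_TT hP hn hC hU hF _ _ _ hx,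
    val_J hP hn hC hU hF _ _ hx, HorizontalData.Connection.TSym]
  ring

lemma val_muS (s : Fin 3) (X Y : Hf P U) (hx : x ∈ U) :
    ((geoSec hP hn hC hU hF).muS s X Y).val x = C.muS F s x (X.val x) (Y.val x) := by
  rw [Geo.muS, Geo.TA, Fn.val_mul_apply, Fn.val_ep _ hx, Fn.val_mul_apply,
    Fn.val_algebraMap _ hx, Fn.val_sub _ _ hx, val_TT hP hn hC hU hF _ _ _ hx,
    val_TT hP hn hC hU hF _ _ _ hx, val_J hP hn hC hU hF _ _ hx,
    HorizontalData.Connection.muS, HorizontalData.Connection.TAlt]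
  ring

lemma val_mu (X Y : Hf P U) (hx : x ∈ U) :
    ((geoSec hP hn hC hU hF).mu X Y).val x = C.mu F x (X.val x) (Y.val x) :=
  val_muS hP hn hC hU hF 0 X Y hx

/-- The hypothesis `hS` asks that S be given pointwise by a tensor S'; differentiating S' along the
represented fields then needs only `rep_D` and `rep_nh`. -/
lemma rep_nbS {S : Hf P U → Hf P U → Fn n U} {S' : (x : M) → P.H x → P.H x → ℝ}
    (hS : ∀ X Y, ∀ x ∈ U, (S X Y).val x = S' x (X.val x) (Y.val x))
    (hA : A.Rep A') (hX : X.Rep X') (hY : Y.Rep Y') :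
    ((geoSec hP hn hC hU hF).nbS S A X Y).Rep (C.nablaT S' A' X' Y') := fun x hx => by
  rw [Geo.nbS, Fn.val_sub _ _ hx, Fn.val_sub _ _ hx, hS _ _ x hx, hS _ _ x hx,
    rep_D hP hn hC hU hF hA (f := S X Y) (f' := fun y => S' y (X' y) (Y' y))
      (fun y hy => by rw [hS _ _ y hy, hX y hy, hY y hy]) x hx,
    rep_nh hP hn hC hU hF hA hX x hx, rep_nh hP hn hC hU hF hA hY x hx, hX x hx, hY x hx]
  rfl

lemma rep_nbS_tau (hA : A.Rep A') (hX : X.Rep X') (hY : Y.Rep Y') :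
    ((geoSec hP hn hC hU hF).nbS (geoSec hP hn hC hU hF).tau A X Y).Rep
      (C.nablaT (C.tau F) A' X' Y') :=
  rep_nbS hP hn hC hU hF (fun _ _ _ hx => val_tau hP hn hC hU hF _ _ hx) hA hX hY

lemma rep_nbS_mu (hA : A.Rep A') (hX : X.Rep X') (hY : Y.Rep Y') :
    ((geoSec hP hn hC hU hF).nbS (geoSec hP hn hC hU hF).mu A X Y).Rep
      (C.nablaT (C.mu F) A' X' Y') :=
  rep_nbS hP hn hC hU hF (fun _ _ _ hx => val_mu hP hn hC hU hF _ _ hx) hA hX hY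

lemma rep_divS {S : Hf P U → Hf P U → Fn n U} {S' : (x : M) → P.H x → P.H x → ℝ}
    (hS : ∀ X Y, ∀ x ∈ U, (S X Y).val x = S' x (X.val x) (Y.val x)) (hX : X.Rep X') :
    ((geoSec hP hn hC hU hF).divS S X).Rep (C.div F S' X') :=
  rep_tr hP hn hC hU hF fun a => rep_nbS hP hn hC hU hF hS
    (rep_inc hP hn hC hU hF (rep_e hP hn hC hU hF a)) (rep_e hP hn hC hU hF a) hX

lemma rep_divJ (s : Fin 3) {S : Hf P U → Hf P U → Fn n U} {S' : (x : M) → P.H x → P.H x → ℝ}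
    (hS : ∀ X Y, ∀ x ∈ U, (S X Y).val x = S' x (X.val x) (Y.val x)) (hX : X.Rep X') :
    ((geoSec hP hn hC hU hF).divJ s S X).Rep (C.divI F s S' X') :=
  rep_tr hP hn hC hU hF fun a => rep_nbS hP hn hC hU hF hS
    (rep_inc hP hn hC hU hF (rep_e hP hn hC hU hF a))
    (rep_J hP hn hC hU hF (rep_e hP hn hC hU hF a) s) (rep_J hP hn hC hU hF hX s)

lemma rep_nbRho (s : Fin 3) (hA : A.Rep A') (hB : B.Rep B') (hD : D.Rep D') :
    ((geoSec hP hn hC hU hF).nbRho s A B D).Rep (C.nablaRho F s A' B' D') := fun x hx => by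
  rw [Geo.nbRho, Fn.val_sub _ _ hx, Fn.val_sub _ _ hx, Fn.val_sub _ _ hx, Fn.val_sum _ _ hx,
    rep_D hP hn hC hU hF hA (rep_rho hP hn hC hU hF s hB hD) x hx,
    rep_rho hP hn hC hU hF s (rep_nb hP hn hC hU hF hA hB) hD x hx,
    rep_rho hP hn hC hU hF s hB (rep_nb hP hn hC hU hF hA hD) x hx]
  refine congrArg (_ - ·) (Finset.sum_congr rfl fun t _ => ?_)
  rw [Fn.val_mul_apply, rep_rho hP hn hC hU hF t hB hD x hx, Geo.cf,
    val_eta hP hn hC hU hF _ _ hx, rep_nb hP hn hC hU hF hA (rep_xi hP hn hC hU hF s) x hx]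

end Transfer

/-! ## The curvature identities on the manifold -/

lemma Geo.D_Scal {n : ℕ} {A V H : Type*} [CommRing A] [Algebra ℝ A] [AddCommGroup V] [Module A V]
    [AddCommGroup H] [Module A H] (G : Geo n A V H) (hn : 1 ≤ n) (u : V) :
    G.D u G.Scal = 8 * n * (n + 2) * G.D u G.sc := by
  have h := G.D_natCast_mul u (8 * n * (n + 2)) G.sc
  push_cast at h
  rw [G.Scal_eq hn, h]

section Identities

variable {n : ℕ} {M : Type*} [TopologicalSpace M] [T2Space M]
  [ChartedSpace (EuclideanSpace ℝ (Fin (4 * n + 3))) M]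
  [IsManifold (𝓡 (4 * n + 3)) ∞ M] {P : HorizontalData n M} {C : P.Connection}
  {U : Set M} {F : P.LocalFrame}

lemma Hf.rep_mk {X : (x : M) → P.H x} (hX : P.SmoothH U X) : (Hf.mk X hX).Rep X :=
  fun _ hx => Hf.val_mk hX hx

lemma Vf.rep_mk {A : (x : M) → TangentSpace (𝓡 (4 * n + 3)) x} (hA : SmoothField U A) :
    (Vf.mk A hA).Rep A := fun _ hx => Vf.val_mk hA hx

variable {X Y Z : (x : M) → P.H x} {x : M}

/-- A vector at x is extended with constant coefficients in the smooth frame. This turns identities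
for sections into identities for vectors at a point. -/
lemma exists_section (hP : P.IsPQC) (hn : 1 ≤ n) (hF : F.IsAdapted U) (hx : x ∈ U) (v : P.H x) :
    ∃ X : Hf P U, X.val x = v := by
  refine ⟨∑ a, algebraMap ℝ (Fn n U) (P.g x (F.e a x) (F.e a x) * P.g x v (F.e a x)) • eSec hF a, ?_⟩
  rw [Hf.val_sum]
  simp only [Hf.val_smul_apply, Fn.val_algebraMap _ hx, val_eSec hF _ hx]
  exact ((hF.orthonormal x hx).expand hP hn v).symm

theorem R_reeb_horizontal (hP : P.IsPQC) (hn : 1 ≤ n) (hC : C.IsCanonical) (hU : IsOpen U)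
    (hF : F.IsAdapted U) (hX : P.SmoothH U X) (hY : P.SmoothH U Y) (hZ : P.SmoothH U Z)
    {i j k : Fin 3} (hc : Cyc i j k) (hx : x ∈ U) :
    C.R (F.ξ i) (P.inc X) Y Z x =
      -C.nablaT (C.mu F) (P.inc X) (F.app i Y) Z x
      - 1 / 4 * (C.nablaT (C.tau F) (P.inc Y) (F.app i Z) X x
          + C.nablaT (C.tau F) (P.inc Y) Z (F.app i X) x)
      + 1 / 4 * (C.nablaT (C.tau F) (P.inc Z) (F.app i Y) X x
          + C.nablaT (C.tau F) (P.inc Z) Y (F.app i X) x)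
      + F.ω j X Y x * C.rho F k (P.inc (F.app i Z)) (F.ξ i) x
      - F.ω k X Y x * C.rho F j (P.inc (F.app i Z)) (F.ξ i) x
      - F.ω j X Z x * C.rho F k (P.inc (F.app i Y)) (F.ξ i) x
      + F.ω k X Z x * C.rho F j (P.inc (F.app i Y)) (F.ξ i) x
      - F.ω j Y Z x * C.rho F k (P.inc (F.app i X)) (F.ξ i) x
      + F.ω k Y Z x * C.rho F j (P.inc (F.app i X)) (F.ξ i) x := by
  have h := congrArg (fun f : Fn n U => f.val x) ((geoSec hP hn hC hU hF).R_xi_inc hn hc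
    (Hf.mk X hX) (Hf.mk Y hY) (Hf.mk Z hZ))
  have rX := Hf.rep_mk hX
  have rY := Hf.rep_mk hY
  have rZ := Hf.rep_mk hZ
  have rI {A : Hf P U} {A'} (hA : A.Rep A') := rep_inc hP hn hC hU hF hA
  have rJ {A : Hf P U} {A'} (hA : A.Rep A') := rep_J hP hn hC hU hF hA i
  have rξ := rep_xi hP hn hC hU hF i
  simp only [Fn.val_add_apply, Fn.val_mul_apply, Fn.val_neg _ hx, Fn.val_sub _ _ hx,
    Fn.val_ofNat _ hx] at h
  rw [rep_R hP hn hC hU hF rξ (rI rX) rY rZ x hx,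
    rep_nbS_mu hP hn hC hU hF (rI rX) (rJ rY) rZ x hx,
    rep_nbS_tau hP hn hC hU hF (rI rY) (rJ rZ) rX x hx,
    rep_nbS_tau hP hn hC hU hF (rI rY) rZ (rJ rX) x hx,
    rep_nbS_tau hP hn hC hU hF (rI rZ) (rJ rY) rX x hx,
    rep_nbS_tau hP hn hC hU hF (rI rZ) rY (rJ rX) x hx,
    rep_omega hP hn hC hU hF rX rY j x hx, rep_omega hP hn hC hU hF rX rY k x hx,
    rep_omega hP hn hC hU hF rX rZ j x hx, rep_omega hP hn hC hU hF rX rZ k x hx,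
    rep_omega hP hn hC hU hF rY rZ j x hx, rep_omega hP hn hC hU hF rY rZ k x hx,
    rep_rho hP hn hC hU hF k (rI (rJ rZ)) rξ x hx, rep_rho hP hn hC hU hF j (rI (rJ rZ)) rξ x hx,
    rep_rho hP hn hC hU hF k (rI (rJ rY)) rξ x hx, rep_rho hP hn hC hU hF j (rI (rJ rY)) rξ x hx,
    rep_rho hP hn hC hU hF k (rI (rJ rX)) rξ x hx, rep_rho hP hn hC hU hF j (rI (rJ rX)) rξ x hx]
    at h
  linear_combination (1 / 4) * h

/-- This relation eliminates the auxiliary scalar `sc` from the final formulas in favour of Scal;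
dividing by 8n(n+2) requires n ≠ 0. -/
lemma val_Scal (hP : P.IsPQC) (hn : 1 ≤ n) (hC : C.IsCanonical) (hU : IsOpen U)
    (hF : F.IsAdapted U) (hx : x ∈ U) :
    C.Scal F x = 8 * n * (n + 2) * (geoSec hP hn hC hU hF).sc.val x := by
  have h := congrArg (fun f : Fn n U => f.val x) ((geoSec hP hn hC hU hF).Scal_eq hn)
  simp only [Fn.val_add_apply, Fn.val_mul_apply, Fn.val_ofNat _ hx, Fn.val_natCast _ hx] at h
  rwa [rep_Scal hP hn hC hU hF x hx] at h

lemma dirDeriv_Scal (hP : P.IsPQC) (hn : 1 ≤ n) (hC : C.IsCanonical) (hU : IsOpen U)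
    (hF : F.IsAdapted U) (hX : P.SmoothH U X) (hx : x ∈ U) :
    dirDeriv (C.Scal F) x (P.inc X x) = 8 * n * (n + 2)
      * ((geoSec hP hn hC hU hF).D ((geoSec hP hn hC hU hF).inc (Hf.mk X hX))
        (geoSec hP hn hC hU hF).sc).val x := by
  have h := congrArg (fun f : Fn n U => f.val x) ((geoSec hP hn hC hU hF).D_Scal hn
    ((geoSec hP hn hC hU hF).inc (Hf.mk X hX)))
  simp only [Fn.val_add_apply, Fn.val_mul_apply, Fn.val_ofNat _ hx, Fn.val_natCast _ hx] at h
  rwa [rep_D hP hn hC hU hF (rep_inc hP hn hC hU hF (Hf.rep_mk hX)) (rep_Scal hP hn hC hU hF) x hx]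
    at h

theorem R_reeb_reeb (hP : P.IsPQC) (hn : 1 ≤ n) (hC : C.IsCanonical) (hU : IsOpen U)
    (hF : F.IsAdapted U) (hX : P.SmoothH U X) (hY : P.SmoothH U Y)
    {i j k : Fin 3} (hc : Cyc i j k) (hx : x ∈ U) :
    C.R (F.ξ i) (F.ξ j) X Y x =
      C.nablaT (C.mu F) (F.ξ i) (F.app j X) Y x
      - C.nablaT (C.mu F) (F.ξ j) (F.app i X) Y x
      + PQC.eps j * C.nablaRho F k (P.inc X) (P.inc (F.app i Y)) (F.ξ i) x
      - 1 / 4 * (C.nablaT (C.tau F) (F.ξ i) (F.app j X) Y x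
          + C.nablaT (C.tau F) (F.ξ i) X (F.app j Y) x)
      + 1 / 4 * (C.nablaT (C.tau F) (F.ξ j) (F.app i X) Y x
          + C.nablaT (C.tau F) (F.ξ j) X (F.app i Y) x)
      + PQC.eps k * (C.Scal F x / (8 * n * (n + 2))) * C.T x (F.ξ k x) (X x) (Y x)
      - ∑ a, F.sgn a x * (C.T x (F.ξ j x) (X x) (F.e a x) * C.T x (F.ξ i x) (F.e a x) (Y x))
      + ∑ a, F.sgn a x * (C.T x (F.ξ j x) (F.e a x) (Y x) * C.T x (F.ξ i x) (X x) (F.e a x)) := by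
  have h := congrArg (fun f : Fn n U => f.val x) ((geoSec hP hn hC hU hF).R_xi_xi hn hc
    (Hf.mk X hX) (Hf.mk Y hY))
  have rX := Hf.rep_mk hX
  have rY := Hf.rep_mk hY
  have rI {A : Hf P U} {A'} (hA : A.Rep A') := rep_inc hP hn hC hU hF hA
  have rJ {A : Hf P U} {A'} (s) (hA : A.Rep A') := rep_J hP hn hC hU hF hA s
  have ri := rep_xi hP hn hC hU hF i
  have rj := rep_xi hP hn hC hU hF j
  have t1 := rep_tr hP hn hC hU hF (φ := fun Z W => (geoSec hP hn hC hU hF).TT j (Hf.mk X hX) Z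
      * (geoSec hP hn hC hU hF).TT i W (Hf.mk Y hY))
    (ψ := fun a x => C.T x (F.ξ j x) (X x) (F.e a x) * C.T x (F.ξ i x) (F.e a x) (Y x))
    (fun a y hy => by
      rw [Fn.val_mul_apply, val_TT hP hn hC hU hF _ _ _ hy, val_TT hP hn hC hU hF _ _ _ hy,
        rep_e hP hn hC hU hF a y hy, rX y hy, rY y hy]) x hx
  have t2 := rep_tr hP hn hC hU hF (φ := fun Z W => (geoSec hP hn hC hU hF).TT j Z (Hf.mk Y hY)
      * (geoSec hP hn hC hU hF).TT i (Hf.mk X hX) W)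
    (ψ := fun a x => C.T x (F.ξ j x) (F.e a x) (Y x) * C.T x (F.ξ i x) (X x) (F.e a x))
    (fun a y hy => by
      rw [Fn.val_mul_apply, val_TT hP hn hC hU hF _ _ _ hy, val_TT hP hn hC hU hF _ _ _ hy,
        rep_e hP hn hC hU hF a y hy, rX y hy, rY y hy]) x hx
  simp only [Fn.val_add_apply, Fn.val_mul_apply, Fn.val_sub _ _ hx, Fn.val_ofNat _ hx,
    Fn.val_ep _ hx] at h
  rw [t1, t2, rep_R hP hn hC hU hF ri rj rX rY x hx,
    rep_nbS_mu hP hn hC hU hF ri (rJ j rX) rY x hx,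
    rep_nbS_mu hP hn hC hU hF rj (rJ i rX) rY x hx,
    rep_nbRho hP hn hC hU hF k (rI rX) (rI (rJ i rY)) ri x hx,
    rep_nbS_tau hP hn hC hU hF ri (rJ j rX) rY x hx,
    rep_nbS_tau hP hn hC hU hF ri rX (rJ j rY) x hx,
    rep_nbS_tau hP hn hC hU hF rj (rJ i rX) rY x hx,
    rep_nbS_tau hP hn hC hU hF rj rX (rJ i rY) x hx,
    val_TT hP hn hC hU hF _ _ _ hx, rX x hx, rY x hx] at h
  have hn0 : (n : ℝ) ≠ 0 := by exact_mod_cast (by omega : n ≠ 0)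
  have hn2 : (n : ℝ) + 2 ≠ 0 := by positivity
  have hs : C.Scal F x / (8 * n * (n + 2)) = (geoSec hP hn hC hU hF).sc.val x := by
    rw [val_Scal hP hn hC hU hF hx]
    field_simp
  rw [hs]
  linear_combination (1 / 4) * h

theorem rho_reeb_self (hP : P.IsPQC) (hn : 1 ≤ n) (hC : C.IsCanonical) (hU : IsOpen U)
    (hF : F.IsAdapted U) (hX : P.SmoothH U X) (i : Fin 3) (hx : x ∈ U) :
    3 * (2 * n + 1) * C.rho F i (F.ξ i) (P.inc X) x =
      -PQC.eps i * (1 / 4) * C.div F (C.tau F) X x - 3 / 4 * C.divI F i (C.tau F) X x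
      + PQC.eps i * C.div F (C.mu F) X x
      - PQC.eps i * ((2 * n + 1) / (16 * n * (n + 2)))
          * PQC.dirDeriv (C.Scal F) x (P.inc X x) := by
  have h := congrArg (fun f : Fn n U => f.val x) ((geoSec hP hn hC hU hF).rho_xi_self hn i
    (Hf.mk X hX))
  have rX := Hf.rep_mk hX
  simp only [Fn.val_add_apply, Fn.val_mul_apply, Fn.val_sub _ _ hx, Fn.val_neg _ hx,
    Fn.val_ofNat _ hx, Fn.val_one hx, Fn.val_natCast _ hx, Fn.val_ep _ hx] at h
  rw [rep_rho hP hn hC hU hF i (rep_xi hP hn hC hU hF i) (rep_inc hP hn hC hU hF rX) x hx,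
    rep_divS hP hn hC hU hF (fun _ _ _ hx => val_tau hP hn hC hU hF _ _ hx) rX x hx,
    rep_divS hP hn hC hU hF (fun _ _ _ hx => val_mu hP hn hC hU hF _ _ hx) rX x hx,
    rep_divJ hP hn hC hU hF i (fun _ _ _ hx => val_tau hP hn hC hU hF _ _ hx) rX x hx] at h
  have hn0 : (n : ℝ) ≠ 0 := by exact_mod_cast (by omega : n ≠ 0)
  have hn2 : (n : ℝ) + 2 ≠ 0 := by positivity
  rw [dirDeriv_Scal hP hn hC hU hF hX hx]
  field_simp
  linear_combination 16 * h

theorem rho_reeb_mixed (hP : P.IsPQC) (hn : 1 ≤ n) (hC : C.IsCanonical) (hU : IsOpen U)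
    (hF : F.IsAdapted U) (hX : P.SmoothH U X) {i j k : Fin 3} (hc : Cyc i j k) (hx : x ∈ U) :
    3 * (2 * n + 1) * C.rho F i (P.inc (F.app k X)) (F.ξ j) x =
        -(3 * (2 * n + 1) * C.rho F i (P.inc (F.app j X)) (F.ξ k) x) ∧
    3 * (2 * n + 1) * C.rho F i (P.inc (F.app k X)) (F.ξ j) x =
      -((2 * n + 1) * (2 * n - 1) / (16 * n * (n + 2)))
          * PQC.dirDeriv (C.Scal F) x (P.inc X x)
      + 2 * (n + 1) * C.div F (C.mu F) X x
      + (4 * n + 1) / 4 * C.div F (C.tau F) X x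
      - PQC.eps i * (3 / 4) * C.divI F i (C.tau F) X x := by
  have rX := Hf.rep_mk hX
  have rI {A : Hf P U} {A'} (hA : A.Rep A') := rep_inc hP hn hC hU hF hA
  constructor
  · have h1 := congrArg (fun f : Fn n U => f.val x)
      ((geoSec hP hn hC hU hF).rho_J_mixed hn hc (Hf.mk X hX)).1
    have h2 := congrArg (fun f : Fn n U => f.val x)
      ((geoSec hP hn hC hU hF).rho_J_mixed hn hc (Hf.mk X hX)).2
    simp only [Fn.val_neg _ hx] at h1 h2
    rw [rep_rho hP hn hC hU hF i (rI (rep_J hP hn hC hU hF rX k)) (rep_xi hP hn hC hU hF j) x hx]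
      at h1
    rw [rep_rho hP hn hC hU hF i (rI (rep_J hP hn hC hU hF rX j)) (rep_xi hP hn hC hU hF k) x hx]
      at h2
    rw [h1, h2]
    ring
  have h := congrArg (fun f : Fn n U => f.val x)
    ((geoSec hP hn hC hU hF).rho_J_xi_mixed hn hc (Hf.mk X hX))
  simp only [Fn.val_add_apply, Fn.val_mul_apply, Fn.val_sub _ _ hx, Fn.val_neg _ hx,
    Fn.val_ofNat _ hx, Fn.val_one hx, Fn.val_natCast _ hx, Fn.val_ep _ hx] at h
  rw [rep_rho hP hn hC hU hF i (rI (rep_J hP hn hC hU hF rX k)) (rep_xi hP hn hC hU hF j) x hx,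
    rep_divS hP hn hC hU hF (fun _ _ _ hx => val_tau hP hn hC hU hF _ _ hx) rX x hx,
    rep_divS hP hn hC hU hF (fun _ _ _ hx => val_mu hP hn hC hU hF _ _ hx) rX x hx,
    rep_divJ hP hn hC hU hF i (fun _ _ _ hx => val_tau hP hn hC hU hF _ _ hx) rX x hx] at h
  have hn0 : (n : ℝ) ≠ 0 := by exact_mod_cast (by omega : n ≠ 0)
  have hn2 : (n : ℝ) + 2 ≠ 0 := by positivity
  rw [dirDeriv_Scal hP hn hC hU hF hX hx]
  field_simp
  linear_combination 16 * h

theorem torsion_tau_mu (hP : P.IsPQC) (hn : 1 ≤ n) (hC : C.IsCanonical) (hU : IsOpen U)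
    (hF : F.IsAdapted U) (s : Fin 3) (hx : x ∈ U) (v w : P.H x) :
    C.muS F s x v w = C.mu F x v w ∧
    C.T x (F.ξ s x) v w = C.mu F x (F.J s x v) w
      - 1 / 4 * (C.tau F x (F.J s x v) w + C.tau F x v (F.J s x w)) := by
  obtain ⟨X, rfl⟩ := exists_section hP hn hF hx v
  obtain ⟨Y, rfl⟩ := exists_section hP hn hF hx w
  have h1 := congrArg (fun f : Fn n U => f.val x) ((geoSec hP hn hC hU hF).muS_eq_mu hn s X Y)
  have h2 := congrArg (fun f : Fn n U => f.val x) ((geoSec hP hn hC hU hF).TT_formula hn s X Y)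
  simp only [Fn.val_add_apply, Fn.val_mul_apply, Fn.val_sub _ _ hx, Fn.val_ofNat _ hx,
    val_muS hP hn hC hU hF _ _ _ hx, val_mu hP hn hC hU hF _ _ hx, val_tau hP hn hC hU hF _ _ hx,
    val_TT hP hn hC hU hF _ _ _ hx, val_J hP hn hC hU hF _ _ hx] at h1 h2
  exact ⟨h1, by linear_combination (1 / 4) * h2⟩

theorem tau_mu_Ric (hP : P.IsPQC) (hn : 1 ≤ n) (hC : C.IsCanonical) (hU : IsOpen U)
    (hF : F.IsAdapted U) (hX : P.SmoothH U X) (hY : P.SmoothH U Y) (hx : x ∈ U) :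
    C.tau F x (X x) (Y x) = 1 / (2 * n + 2) * (1 / 4 *
      (3 * C.Ric F X Y x + ∑ s, PQC.eps s * C.Ric F (F.app s X) (F.app s Y) x)) ∧
    C.mu F x (X x) (Y x) = 1 / (4 * n + 10) * (1 / 4 *
      (C.Ric F X Y x - ∑ s, PQC.eps s * C.Ric F (F.app s X) (F.app s Y) x)
        - C.Scal F x / (4 * n) * P.g x (X x) (Y x)) := by
  have rX := Hf.rep_mk hX
  have rY := Hf.rep_mk hY
  have h1 := congrArg (fun f : Fn n U => f.val x)
    ((geoSec hP hn hC hU hF).tau_Ric hn (Hf.mk X hX) (Hf.mk Y hY))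
  have h2 := congrArg (fun f : Fn n U => f.val x)
    ((geoSec hP hn hC hU hF).mu_Ric hn (Hf.mk X hX) (Hf.mk Y hY))
  simp only [Fn.val_add_apply, Fn.val_mul_apply, Fn.val_sub _ _ hx, Fn.val_ofNat _ hx,
    Fn.val_natCast _ hx, Fn.val_sum _ _ hx, Fn.val_ep _ hx, val_mu hP hn hC hU hF _ _ hx,
    val_tau hP hn hC hU hF _ _ hx, val_g hP hn hC hU hF _ _ hx, rX x hx, rY x hx,
    rep_Ric hP hn hC hU hF rX rY x hx,
    fun s => rep_Ric hP hn hC hU hF (rep_J hP hn hC hU hF rX s) (rep_J hP hn hC hU hF rY s) x hx]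
    at h1 h2
  have hn0 : (n : ℝ) ≠ 0 := by exact_mod_cast (by omega : n ≠ 0)
  have hn2 : (2 * n + 2 : ℝ) ≠ 0 := by positivity
  have hn3 : (4 * n + 10 : ℝ) ≠ 0 := by positivity
  have hs : C.Scal F x / (4 * n) = 2 * (n + 2) * (geoSec hP hn hC hU hF).sc.val x := by
    rw [val_Scal hP hn hC hU hF hx]
    field_simp
    ring
  rw [hs]
  constructor
  · rw [one_div_mul_eq_div (2 * n + 2 : ℝ), eq_div_iff hn2]
    linear_combination (1 / 4) * h1
  · rw [one_div_mul_eq_div (4 * n + 10 : ℝ), eq_div_iff hn3]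
    linear_combination (1 / 4) * h2

theorem curv_mem_and_reeb (hP : P.IsPQC) (hn : 1 ≤ n) (hC : C.IsCanonical) (hU : IsOpen U)
    (hF : F.IsAdapted U) {A B : (x : M) → TangentSpace (𝓡 (4 * n + 3)) x} (hA : SmoothField U A)
    (hB : SmoothField U B) (hx : x ∈ U) :
    (∀ X, P.SmoothH U X → C.curv A B (P.inc X) x ∈ P.H x) ∧
    ∀ i j k : Fin 3, j = i + 1 → k = i + 2 →
      C.curv A B (F.ξ i) x = (-2 * PQC.eps i * C.rho F k A B x) • F.ξ j x
        + (2 * PQC.eps i * C.rho F j A B x) • F.ξ k x := by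
  have rA := Vf.rep_mk hA
  have rB := Vf.rep_mk hB
  refine ⟨fun X hX => ?_, fun i j k hj hk => ?_⟩
  · rw [hF.admissible.ker x hx]
    intro s
    have h := congrArg (fun f : Fn n U => f.val x) ((geoSec hP hn hC hU hF).eta_curv_inc s
      (Vf.mk A hA) (Vf.mk B hB) (Hf.mk X hX))
    simp only [val_eta hP hn hC hU hF _ _ hx, Fn.val_zero hx] at h
    rwa [rep_curv hP hn hC hU hF rA rB (rep_inc hP hn hC hU hF (Hf.rep_mk hX)) x hx] at h
  · have hc : Cyc i j k := ⟨hj, hk⟩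
    have h := congrArg (fun V : Vf n U => V.val x) ((geoSec hP hn hC hU hF).curv_xi i
      (Vf.mk A hA) (Vf.mk B hB))
    rw [hc.sum, Geo.kap_diag _ hn, Geo.kap_ij _ hn hc, Geo.kap_ik _ hn hc, zero_smul, zero_add]
      at h
    simp only [Vf.val_add_apply, Vf.val_smul_apply, Fn.val_mul_apply, Fn.val_neg _ hx,
      Fn.val_ofNat _ hx, Fn.val_ep _ hx, rep_xi hP hn hC hU hF _ x hx,
      rep_rho hP hn hC hU hF _ rA rB x hx,
      rep_curv hP hn hC hU hF rA rB (rep_xi hP hn hC hU hF i) x hx] at h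
    exact h

end Identities


end PQC

end


/-! ### The complete curvature theorem -/

theorem mainTheorem3 {n : ℕ} (hn : 1 ≤ n) {M : Type*} [TopologicalSpace M] [T2Space M]
    [ChartedSpace (EuclideanSpace ℝ (Fin (4 * n + 3))) M]
    [IsManifold (𝓡 (4 * n + 3)) ∞ M]
    (P : PQC.HorizontalData n M) (hP : P.IsPQC)
    (C : P.Connection) (hC : C.IsCanonical)
    (U : Set M) (hU : IsOpen U) (F : P.LocalFrame) (hF : F.IsAdapted U) :
    -- the mixed components with one vertical argument
    (∀ i j k : Fin 3, j = i + 1 → k = i + 2 →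
      ∀ X Y Z, P.SmoothH U X → P.SmoothH U Y → P.SmoothH U Z → ∀ x ∈ U,
        C.R (F.ξ i) (P.inc X) Y Z x =
          -C.nablaT (C.mu F) (P.inc X) (F.app i Y) Z x
          - 1 / 4 * (C.nablaT (C.tau F) (P.inc Y) (F.app i Z) X x
              + C.nablaT (C.tau F) (P.inc Y) Z (F.app i X) x)
          + 1 / 4 * (C.nablaT (C.tau F) (P.inc Z) (F.app i Y) X x
              + C.nablaT (C.tau F) (P.inc Z) Y (F.app i X) x)
          + F.ω j X Y x * C.rho F k (P.inc (F.app i Z)) (F.ξ i) x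
          - F.ω k X Y x * C.rho F j (P.inc (F.app i Z)) (F.ξ i) x
          - F.ω j X Z x * C.rho F k (P.inc (F.app i Y)) (F.ξ i) x
          + F.ω k X Z x * C.rho F j (P.inc (F.app i Y)) (F.ξ i) x
          - F.ω j Y Z x * C.rho F k (P.inc (F.app i X)) (F.ξ i) x
          + F.ω k Y Z x * C.rho F j (P.inc (F.app i X)) (F.ξ i) x) ∧
    -- the components with two vertical arguments
    (∀ i j k : Fin 3, j = i + 1 → k = i + 2 →
      ∀ X Y, P.SmoothH U X → P.SmoothH U Y → ∀ x ∈ U,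
        C.R (F.ξ i) (F.ξ j) X Y x =
          C.nablaT (C.mu F) (F.ξ i) (F.app j X) Y x
          - C.nablaT (C.mu F) (F.ξ j) (F.app i X) Y x
          + PQC.eps j * C.nablaRho F k (P.inc X) (P.inc (F.app i Y)) (F.ξ i) x
          - 1 / 4 * (C.nablaT (C.tau F) (F.ξ i) (F.app j X) Y x
              + C.nablaT (C.tau F) (F.ξ i) X (F.app j Y) x)
          + 1 / 4 * (C.nablaT (C.tau F) (F.ξ j) (F.app i X) Y x
              + C.nablaT (C.tau F) (F.ξ j) X (F.app i Y) x)
          + PQC.eps k * (C.Scal F x / (8 * n * (n + 2))) * C.T x (F.ξ k x) (X x) (Y x)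
          - ∑ a, F.sgn a x * (C.T x (F.ξ j x) (X x) (F.e a x) * C.T x (F.ξ i x) (F.e a x) (Y x))
          + ∑ a, F.sgn a x * (C.T x (F.ξ j x) (F.e a x) (Y x) * C.T x (F.ξ i x) (X x) (F.e a x)))
      ∧
    -- the mixed Ricci 2-forms
    (∀ i : Fin 3, ∀ X, P.SmoothH U X → ∀ x ∈ U,
      3 * (2 * n + 1) * C.rho F i (F.ξ i) (P.inc X) x =
        -PQC.eps i * (1 / 4) * C.div F (C.tau F) X x - 3 / 4 * C.divI F i (C.tau F) X x
        + PQC.eps i * C.div F (C.mu F) X x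
        - PQC.eps i * ((2 * n + 1) / (16 * n * (n + 2)))
            * PQC.dirDeriv (C.Scal F) x (P.inc X x)) ∧
    (∀ i j k : Fin 3, j = i + 1 → k = i + 2 → ∀ X, P.SmoothH U X → ∀ x ∈ U,
      3 * (2 * n + 1) * C.rho F i (P.inc (F.app k X)) (F.ξ j) x =
          -(3 * (2 * n + 1) * C.rho F i (P.inc (F.app j X)) (F.ξ k) x) ∧
      3 * (2 * n + 1) * C.rho F i (P.inc (F.app k X)) (F.ξ j) x =
        -((2 * n + 1) * (2 * n - 1) / (16 * n * (n + 2)))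
            * PQC.dirDeriv (C.Scal F) x (P.inc X x)
        + 2 * (n + 1) * C.div F (C.mu F) X x
        + (4 * n + 1) / 4 * C.div F (C.tau F) X x
        - PQC.eps i * (3 / 4) * C.divI F i (C.tau F) X x) ∧
    -- the whole curvature is determined by its horizontal part: the torsion endomorphism is
    -- given by `τ` and `μ`, these are components of the horizontal Ricci tensor, the curvature
    -- preserves `H`, and on the vertical vectors it is given by the Ricci 2-forms
    (∀ s : Fin 3, ∀ x ∈ U, ∀ X Y : P.H x,
      C.muS F s x X Y = C.mu F x X Y ∧
      C.T x (F.ξ s x) X Y = C.mu F x (F.J s x X) Y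
        - 1 / 4 * (C.tau F x (F.J s x X) Y + C.tau F x X (F.J s x Y))) ∧
    (∀ X Y, P.SmoothH U X → P.SmoothH U Y → ∀ x ∈ U,
      C.tau F x (X x) (Y x) = 1 / (2 * n + 2) * (1 / 4 *
        (3 * C.Ric F X Y x + ∑ s, PQC.eps s * C.Ric F (F.app s X) (F.app s Y) x)) ∧
      C.mu F x (X x) (Y x) = 1 / (4 * n + 10) * (1 / 4 *
        (C.Ric F X Y x - ∑ s, PQC.eps s * C.Ric F (F.app s X) (F.app s Y) x)
          - C.Scal F x / (4 * n) * P.g x (X x) (Y x))) ∧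
    (∀ A B, PQC.SmoothField U A → PQC.SmoothField U B → ∀ x ∈ U,
      (∀ X, P.SmoothH U X → C.curv A B (P.inc X) x ∈ P.H x) ∧
      ∀ i j k : Fin 3, j = i + 1 → k = i + 2 →
        C.curv A B (F.ξ i) x = (-2 * PQC.eps i * C.rho F k A B x) • F.ξ j x
          + (2 * PQC.eps i * C.rho F j A B x) • F.ξ k x) := by
  exact ⟨fun i j k hj hk X Y Z hX hY hZ x hx =>
      PQC.R_reeb_horizontal hP hn hC hU hF hX hY hZ ⟨hj, hk⟩ hx,
    fun i j k hj hk X Y hX hY x hx => PQC.R_reeb_reeb hP hn hC hU hF hX hY ⟨hj, hk⟩ hx,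
    fun i X hX x hx => PQC.rho_reeb_self hP hn hC hU hF hX i hx,
    fun i j k hj hk X hX x hx => PQC.rho_reeb_mixed hP hn hC hU hF hX ⟨hj, hk⟩ hx,
    fun s x hx v w => PQC.torsion_tau_mu hP hn hC hU hF s hx v w,
    fun X Y hX hY x hx => PQC.tau_mu_Ric hP hn hC hU hF hX hY hx,
    fun A B hA hB x hx => PQC.curv_mem_and_reeb hP hn hC hU hF hA hB hx⟩
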